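/- **Notation.** For positive integers $m,n$ let $\Lambda_\infty([m],[n])$ be the set of non-decreasing maps $f:\mathbb Z\to\mathbb Z$ with $f(a+m)=f(a)+n$ for all $a$, and let $\sigma\in\Lambda_\infty([m],[m])$ be $\sigma(a)=a+m$. For an integer $p\ge 1$, the paracyclic category $\Lambda_p$ has the objects $[m]$, $m\ge 1$, and the morphism sets $\Lambda_p([m],[n])=\Lambda_\infty([m],[n])/\sigma^p$; Connes' cyclic category is $\Lambda=\Lambda_1$. The functor $i_p:\Lambda_p\to\Lambda$ sends $[m]$ to $[mp]$ and the class of $f$ to the class of $f$. For a category $\mathcal C$ and a small category $I$, let $\mathrm{Fun}(I,\mathcal C)$ be the category of functors $I\to\mathcal C$. If $\mathcal C$ is abelian, $D^-(\mathcal C)$ is the derived category of complexes in $\mathcal C$ bounded from above. When it exists, $H_\bullet(I,-):D^-(\mathrm{Fun}(I,\mathcal C))\to D^-(\mathcal C)$ denotes the left derived functor of $\mathrm{colim}_I$ (left Kan extension to the point). For a functor $\sigma:I\to J$ write $\sigma^*E=E\circ\sigma$, and let $\sigma_!:H_\bullet(I,\sigma^*E)\to H_\bullet(J,E)$ be the natural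 map induced by $\mathrm{colim}_I\,\sigma^*E\to\mathrm{colim}_J\,E$ through the universal property of $H_\bullet(J,-)$. For a unital associative algebra $A$ over a commutative ring $k$, let $A_\#\in\mathrm{Fun}(\Lambda,k\text{-mod})$ be the cyclic $k$-module with $A_\#([m])=A^{\otimes_k m}$ (factors indexed by $\mathbb Z/m$), in which the class of $f\in\Lambda_\infty([m],[n])$ sends $\bigotimes_i a_i$ to $\bigotimes_{j\in\mathbb Z/n}\prod_{i\in\mathbb Z,\,f(i)=j}a_{i \bmod m}$, where the products are taken in increasing order of $i$ and an empty product is $1$. Its cyclic homology is $HC_\bullet(A)=H_\bullet(\Lambda,A_\#)$. **Proposition.** Let $p\ge 1$ be an integer. 1. Let $\mathcal C$ be an abelian category with exact small coproducts (AB3 and AB4), for example any Grothendieck abelian category. The derived functors $H_\bullet(\Lambda_p,-)$ and $H_\bullet(\Lambda,-)$ exist on $D^-(\mathrm{Fun}(\Lambda_p,\mathcal C))$ and $D^-(\mathrm{Fun}(\Lambda,\mathcal C))$, and for every $E\in\mathrm{Fun}(\Lambda,\mathcal C)$ the natural map $$i_{p!}:H_\bullet(\Lambda_p,i_p^*E)\to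 H_\bullet(\Lambda,E)$$ is a quasi-isomorphism, that is, an isomorphism in $D^-(\mathcal C)$. 2. In particular, let $A$ be a unital associative algebra over a commutative ring $k$. Then the $p$-cyclic $k$-module $i_p^*A_\#$ has the values $(i_p^*A_\#)([l])=A^{\otimes_k pl}$, and the natural map $H_\bullet(\Lambda_p,i_p^*A_\#)\to H_\bullet(\Lambda,A_\#)=HC_\bullet(A)$ is a quasi-isomorphism. -/

import Mathlib

open CategoryTheory CategoryTheory.Limits

/-! ### Paracyclic categories -/

/-- Objects of the paracyclic category `Λ_p`: the objects `[m]`, one for each integer `m ≥ 1`.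
`Paracyclic 1` is Connes' cyclic category `Λ`. -/
structure Paracyclic (p : ℕ) : Type where
  /-- The integer `m` of the object `[m]`. -/
  len : ℕ
  len_pos : 0 < len

/-- Morphisms `[m] ⟶ [n]` of `Λ_∞`: nondecreasing maps `f : ℤ → ℤ` with `f (a + m) = f a + n`. -/
@[ext]
structure ParaMap (m n : ℕ) : Type where
  /-- The underlying map of integers. -/
  toFun : ℤ → ℤ
  mono : Monotone toFun
  map_add : ∀ a, toFun (a + m) = toFun a + n

namespace ParaMap

variable {l m n : ℕ}

theorem map_add_mul (f : ParaMap m n) (k a : ℤ) : f.toFun (a + k * m) = f.toFun a + k * n := by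
  induction k using Int.induction_on generalizing a with
  | zero => simp
  | succ k ih =>
    have h := f.map_add (a + k * m)
    rw [ih] at h
    rw [show a + ((k : ℤ) + 1) * m = a + k * m + m by ring, h]; ring
  | pred k ih =>
    have h := f.map_add (a + (-(k : ℤ) - 1) * m)
    rw [show a + (-(k : ℤ) - 1) * m + m = a + (-k) * m by ring, ih] at h
    linarith

/-- The identity of `[m]` in `Λ_∞`. -/
def id (m : ℕ) : ParaMap m m := ⟨fun a => a, monotone_id, fun _ => rfl⟩

/-- Composition in `Λ_∞` (first `f`, then `g`). -/
def comp (f : ParaMap l m) (g : ParaMap m n) : ParaMap l n :=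
  ⟨fun a => g.toFun (f.toFun a), g.mono.comp f.mono, fun a => by rw [f.map_add, g.map_add]⟩

/-- The relation defining `Λ_p`: `g` is `f ∘ σ ^ (k * p)` for some integer `k`, where
`σ a = a + m` on `[m]`. -/
def rel (p m n : ℕ) : Setoid (ParaMap m n) where
  r f g := ∃ k : ℤ, ∀ a, g.toFun a = f.toFun (a + k * (p * m))
  iseqv :=
    { refl := fun f => ⟨0, fun a => by simp⟩
      symm := by
        rintro f g ⟨k, h⟩
        exact ⟨-k, fun a => by rw [h]; congr 1; ring⟩
      trans := by
        rintro f g e ⟨k, h⟩ ⟨k', h'⟩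
        exact ⟨k + k', fun a => by rw [h', h]; congr 1; ring⟩ }

end ParaMap

namespace Paracyclic

/-- The category `Λ_p`, with `Λ_p([m], [n]) = Λ_∞([m], [n]) / σ ^ p`. -/
instance (p : ℕ) : Category.{0} (Paracyclic p) where
  Hom X Y := Quotient (ParaMap.rel p X.len Y.len)
  id X := Quotient.mk _ (ParaMap.id X.len)
  comp {X Y Z} f g := Quotient.map₂ ParaMap.comp (by
    rintro f f' ⟨k, h⟩ g g' ⟨k', h'⟩
    refine ⟨k + k', fun a => ?_⟩
    have e : f.toFun (a + (k + k') * (p * X.len)) =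
        f.toFun (a + k * (p * X.len)) + k' * (p * Y.len) := by
      have := f.map_add_mul (k' * p) (a + k * (p * X.len))
      rw [show a + (k + k') * (p * X.len) = a + k * (p * X.len) + k' * p * X.len by ring, this]
      ring
    change g'.toFun (f'.toFun a) = g.toFun (f.toFun (a + (k + k') * (p * X.len)))
    rw [h', h, e]) f g
  id_comp := by rintro X Y ⟨f⟩; rfl
  comp_id := by rintro X Y ⟨f⟩; rfl
  assoc := by rintro X Y Z W ⟨f⟩ ⟨g⟩ ⟨h⟩; rfl

end Paracyclic

/-- Connes' cyclic category `Λ`. -/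
abbrev CyclicCat : Type := Paracyclic 1

/-- A map `[m] ⟶ [n]` of `Λ_∞`, viewed as a map `[m * p] ⟶ [n * p]`. -/
def ParaMap.subdivide (p : ℕ) {m n : ℕ} (f : ParaMap m n) : ParaMap (m * p) (n * p) :=
  ⟨f.toFun, f.mono, fun a => by
    have := f.map_add_mul p a
    push_cast
    rw [show a + (m : ℤ) * p = a + p * m by ring, this]; ring⟩

/-- The embedding `i_p : Λ_p ⥤ Λ`, `[m] ↦ [m * p]`, which is the identity on underlying maps of
integers. -/
def cyclicEmbedding (p : ℕ) (hp : 0 < p) : Paracyclic p ⥤ CyclicCat where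
  obj X := ⟨X.len * p, Nat.mul_pos X.len_pos hp⟩
  map {X Y} f := Quotient.map (ParaMap.subdivide p) (by
    rintro f g ⟨k, h⟩
    refine ⟨k, fun a => ?_⟩
    change g.toFun a = f.toFun _
    rw [h]; congr 1; push_cast; ring) f
  map_id X := rfl
  map_comp := by rintro X Y Z ⟨f⟩ ⟨g⟩; rfl

/-! ### The derived category of complexes bounded from above -/

universe v u v' u' w

section Minus

variable (A : Type u) [Category.{v} A] [Abelian A] (B : Type u') [Category.{v'} B] [Abelian B]

/-- Cochain complexes bounded from above. -/
def minusProperty : ObjectProperty (CochainComplex A ℤ) :=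
  fun K => ∃ n : ℤ, K.IsStrictlyLE n

/-- The category of cochain complexes bounded from above. -/
abbrev ComplexMinus : Type _ := (minusProperty A).FullSubcategory

/-- Quasi-isomorphisms between complexes bounded from above. -/
def quasiIsoMinus : MorphismProperty (ComplexMinus A) :=
  (HomologicalComplex.quasiIso A (ComplexShape.up ℤ)).inverseImage (minusProperty A).ι

/-- The derived category `D⁻(A)`: complexes bounded from above localized at quasi-isomorphisms. -/
abbrev DMinus : Type _ := (quasiIsoMinus A).Localization

/-- The localization functor to `D⁻(A)`. -/
abbrev DMinus.Q : ComplexMinus A ⥤ DMinus A := (quasiIsoMinus A).Q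

/-- An object of `A`, viewed as a complex concentrated in degree `0`. -/
noncomputable def ComplexMinus.single : A ⥤ ComplexMinus A :=
  (minusProperty A).lift (CochainComplex.singleFunctor A 0) fun _ => ⟨0, inferInstance⟩

/-- An object of `A`, viewed as an object of `D⁻(A)` concentrated in degree `0`. -/
noncomputable abbrev DMinus.single : A ⥤ DMinus A := ComplexMinus.single A ⋙ DMinus.Q A

variable {A B}

/-- The functor on complexes induced by `F : A ⥤ B`, applied degreewise. -/
def ComplexMinus.map (F : A ⥤ B) [F.PreservesZeroMorphisms] : ComplexMinus A ⥤ ComplexMinus B :=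
  (minusProperty B).lift ((minusProperty A).ι ⋙ F.mapHomologicalComplex (ComplexShape.up ℤ))
    fun K => by
      obtain ⟨n, hn⟩ := K.2
      refine ⟨n, ?_⟩
      dsimp
      infer_instance

theorem ComplexMinus.map_isInverted (F : A ⥤ B) [F.Additive] [F.PreservesHomology] :
    (quasiIsoMinus A).IsInvertedBy (ComplexMinus.map F ⋙ DMinus.Q B) := by
  intro K L f hf
  have hf' : QuasiIso f.hom := hf
  refine Localization.inverts (DMinus.Q B) (quasiIsoMinus B) _ ?_
  exact HomologicalComplex.quasiIso_map_of_preservesHomology f.hom F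

/-- The functor `D⁻(A) ⥤ D⁻(B)` induced by an exact functor `F : A ⥤ B`, applied degreewise. -/
noncomputable def DMinus.map (F : A ⥤ B) [F.Additive] [F.PreservesHomology] :
    DMinus A ⥤ DMinus B :=
  Localization.lift (ComplexMinus.map F ⋙ DMinus.Q B) (ComplexMinus.map_isInverted F) (DMinus.Q A)

/-- `DMinus.map F` is induced by applying `F` degreewise to complexes. -/
noncomputable def DMinus.mapFac (F : A ⥤ B) [F.Additive] [F.PreservesHomology] :
    DMinus.Q A ⋙ DMinus.map F ≅ ComplexMinus.map F ⋙ DMinus.Q B :=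
  Localization.fac _ _ _

end Minus

/-! ### Homology of small categories -/

section Homology

theorem hasColimitsOfSize_of_hasCoproducts (C : Type u) [Category.{v} C] [Abelian C]
    [HasCoproducts.{0} C] : HasColimitsOfSize.{0, 0} C :=
  has_colimits_of_hasCoequalizers_and_coproducts

attribute [local instance] hasColimitsOfSize_of_hasCoproducts

variable (I J : Type) [SmallCategory I] [SmallCategory J] (C : Type u) [Category.{v} C] [Abelian C]

/-- Restriction of functors along `σ : I ⥤ J`, namely `σ^* E = σ ⋙ E`. -/
abbrev restr {I J : Type} [SmallCategory I] [SmallCategory J] (σ : I ⥤ J) (C : Type u)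
    [Category.{v} C] : (J ⥤ C) ⥤ (I ⥤ C) :=
  (Functor.whiskeringLeft I J C).obj σ

instance (σ : I ⥤ J) : (restr σ C).Additive where
  map_add := rfl

instance (σ : I ⥤ J) : (restr σ C).PreservesHomology := inferInstance

variable [HasCoproducts.{0} C]

/-- The colimit functor `(I ⥤ C) ⥤ C`, that is, the left Kan extension `τ_!` along the functor
`τ : I ⥤ pt`, applied degreewise to complexes bounded from above, with values in `D⁻(C)`. -/
noncomputable abbrev colimMinus : ComplexMinus (I ⥤ C) ⥤ DMinus C :=
  ComplexMinus.map (colim (J := I) (C := C)) ⋙ DMinus.Q C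

/-- The left derived functor of the colimit functor exists on `D⁻(I ⥤ C)`. -/
abbrev HasHomology : Prop :=
  (colimMinus I C).HasLeftDerivedFunctor (quasiIsoMinus (I ⥤ C))

/-- The homology `H_•(I, -) : D⁻(I ⥤ C) ⥤ D⁻(C)` of the small category `I`: the total left derived
functor of the colimit functor. -/
noncomputable def homologyOfCat [HasHomology I C] : DMinus (I ⥤ C) ⥤ DMinus C :=
  (colimMinus I C).totalLeftDerived (DMinus.Q (I ⥤ C)) (quasiIsoMinus (I ⥤ C))

/-- The canonical map from the homology `H_•(I, K)` to the colimit of the complex `K`. -/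
noncomputable def homologyOfCatCounit [HasHomology I C] :
    DMinus.Q (I ⥤ C) ⋙ homologyOfCat I C ⟶ colimMinus I C :=
  (colimMinus I C).totalLeftDerivedCounit (DMinus.Q (I ⥤ C)) (quasiIsoMinus (I ⥤ C))

instance [HasHomology I C] : (homologyOfCat I C).IsLeftDerivedFunctor
    (homologyOfCatCounit I C) (quasiIsoMinus (I ⥤ C)) := by
  unfold homologyOfCat homologyOfCatCounit
  infer_instance

variable {I J}

/-- The natural map `colim σ^* E ⟶ colim E`. -/
noncomputable def colimRestr (σ : I ⥤ J) : restr σ C ⋙ colim ⟶ (colim : (J ⥤ C) ⥤ C) where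
  app E := colimit.pre E σ
  naturality E E' f := by
    refine colimit.hom_ext fun i => ?_
    dsimp
    simp

/-- The natural map `colim σ^* K ⟶ colim K` of complexes, for `K` bounded from above. -/
noncomputable def complexColimRestrAux (σ : I ⥤ J) :
    ComplexMinus.map (restr σ C) ⋙ ComplexMinus.map colim ⟶
      ComplexMinus.map (colim : (J ⥤ C) ⥤ C) where
  app K := ObjectProperty.homMk
    ((NatTrans.mapHomologicalComplex (colimRestr C σ) (ComplexShape.up ℤ)).app K.obj)
  naturality K L f := by
    ext : 1
    exact (NatTrans.mapHomologicalComplex (colimRestr C σ) (ComplexShape.up ℤ)).naturality f.hom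

/-- The natural map `colim σ^* K ⟶ colim K` in `D⁻(C)`, for complexes `K` bounded from above. -/
noncomputable def complexColimRestr (σ : I ⥤ J) :
    ComplexMinus.map (restr σ C) ⋙ colimMinus I C ⟶ colimMinus J C :=
  Functor.whiskerRight (complexColimRestrAux C σ) (DMinus.Q C)

/-- The natural map `σ_! : H_•(I, σ^* K) ⟶ H_•(J, K)`: the unique natural transformation
compatible with the maps to colimits and with `colim σ^* K ⟶ colim K`. -/
noncomputable def homologyMap (σ : I ⥤ J) [HasHomology I C] [HasHomology J C] :
    DMinus.map (restr σ C) ⋙ homologyOfCat I C ⟶ homologyOfCat J C :=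
  (homologyOfCat J C).leftDerivedLift (homologyOfCatCounit J C) (quasiIsoMinus (J ⥤ C)) _
    (Functor.whiskerRight (DMinus.mapFac (restr σ C)).hom (homologyOfCat I C) ≫
      Functor.whiskerLeft (ComplexMinus.map (restr σ C)) (homologyOfCatCounit I C) ≫
      complexColimRestr C σ)

end Homology

/-! ### The cyclic module of an algebra -/

section CyclicModule

open scoped TensorProduct

/-- The least `i` with `j ≤ f i`. The fiber of `f` over `j` is the interval
`lo j ≤ i < lo (j + 1)`, see `ParaMap.eq_iff_lo`. -/
noncomputable def ParaMap.lo {m n : ℕ} (f : ParaMap m n) (j : ℤ) : ℤ := sInf {i | j ≤ f.toFun i}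

namespace ParaMap

variable {l m n : ℕ} (f : ParaMap m n)

theorem lo_le_iff (hn : 0 < n) (i j : ℤ) : f.lo j ≤ i ↔ j ≤ f.toFun i := by
  have hne : {i | j ≤ f.toFun i}.Nonempty := by
    refine ⟨0 + |j - f.toFun 0| * m, ?_⟩
    have h1 : (1 : ℤ) ≤ n := by exact_mod_cast hn
    change j ≤ f.toFun (0 + |j - f.toFun 0| * m)
    rw [f.map_add_mul]
    nlinarith [abs_nonneg (j - f.toFun 0), le_abs_self (j - f.toFun 0)]
  have hbd : BddBelow {i | j ≤ f.toFun i} := by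
    refine ⟨0 + (-(|j - f.toFun 0| + 1)) * m, fun i hi => ?_⟩
    by_contra hlt
    have h1 : (1 : ℤ) ≤ n := by exact_mod_cast hn
    have h2 := f.mono (not_le.mp hlt).le
    rw [f.map_add_mul] at h2
    have h3 : j ≤ f.toFun i := hi
    nlinarith [abs_nonneg (j - f.toFun 0), neg_abs_le (j - f.toFun 0)]
  constructor
  · intro h
    exact le_trans (Int.csInf_mem hne hbd) (f.mono h)
  · intro h
    exact csInf_le hbd h

theorem eq_iff_lo (hn : 0 < n) (i j : ℤ) :
    f.toFun i = j ↔ f.lo j ≤ i ∧ i < f.lo (j + 1) := by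
  rw [← not_le, f.lo_le_iff hn, f.lo_le_iff hn]
  omega

theorem lo_mono (hn : 0 < n) {j k : ℤ} (h : j ≤ k) : f.lo j ≤ f.lo k :=
  (f.lo_le_iff hn _ _).2 (h.trans ((f.lo_le_iff hn _ _).1 le_rfl))

theorem lo_add_mul (hn : 0 < n) (j k : ℤ) : f.lo (j + k * n) = f.lo j + k * m := by
  refine eq_of_forall_ge_iff fun i => ?_
  have h := f.map_add_mul (-k) i
  rw [f.lo_le_iff hn, ← le_sub_iff_add_le, ← le_sub_iff_add_le, f.lo_le_iff hn,
    show i - k * m = i + (-k) * m by ring, h]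
  constructor <;> intro h <;> linarith

theorem lo_comp (hm : 0 < m) (hn : 0 < n) (f : ParaMap l m) (g : ParaMap m n) (j : ℤ) :
    (f.comp g).lo j = f.lo (g.lo j) := by
  refine eq_of_forall_ge_iff fun i => ?_
  rw [lo_le_iff _ hn, f.lo_le_iff hm, g.lo_le_iff hn]
  rfl

theorem lo_id (hm : 0 < m) (j : ℤ) : (ParaMap.id m).lo j = j := by
  refine eq_of_forall_ge_iff fun i => ?_
  rw [lo_le_iff _ hm]
  rfl

end ParaMap

/-- The residue of an integer modulo `m`. -/
def residue {m : ℕ} (hm : 0 < m) (i : ℤ) : Fin m :=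
  ⟨(i % m).toNat, by
    have h0 : (0 : ℤ) < m := by exact_mod_cast hm
    have h1 := Int.emod_nonneg i h0.ne'
    have h2 := Int.emod_lt_of_pos i h0
    omega⟩

theorem residue_eq_iff {m : ℕ} (hm : 0 < m) (i : ℤ) (r : Fin m) :
    residue hm i = r ↔ (m : ℤ) ∣ i - r := by
  have h0 : (0 : ℤ) < m := by exact_mod_cast hm
  have h1 := Int.emod_nonneg i h0.ne'
  have h2 : ((r : ℕ) : ℤ) % m = r := Int.emod_eq_of_lt (by omega) (by exact_mod_cast r.2)
  rw [Int.dvd_iff_emod_eq_zero, ← Int.emod_eq_emod_iff_emod_sub_eq_zero, h2, Fin.ext_iff]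
  simp only [residue]
  omega

theorem residue_add_mul {m : ℕ} (hm : 0 < m) (i k : ℤ) :
    residue hm (i + k * m) = residue hm i := by
  simp [residue]

variable {A : Type u} [Monoid A]

/-- The ordered product `a x * a (x + 1) * ⋯ * a (y - 1)` (equal to `1` if `y ≤ x`). -/
def intervalProd (a : ℤ → A) (x y : ℤ) : A :=
  ((List.range (y - x).toNat).map fun t : ℕ => a (x + t)).prod

theorem intervalProd_self (a : ℤ → A) (x : ℤ) : intervalProd a x x = 1 := by
  simp [intervalProd]

theorem intervalProd_succ (a : ℤ → A) {x y : ℤ} (h : x ≤ y) :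
    intervalProd a x (y + 1) = intervalProd a x y * a y := by
  obtain ⟨t, rfl⟩ := Int.le.dest h
  rw [intervalProd, intervalProd, show (x + t + 1 - x).toNat = t + 1 by omega,
    show (x + t - x).toNat = t by omega]
  simp [List.range_succ]

theorem intervalProd_single (a : ℤ → A) (x : ℤ) : intervalProd a x (x + 1) = a x := by
  rw [intervalProd_succ a le_rfl, intervalProd_self, one_mul]

theorem intervalProd_mul (a : ℤ → A) {x y z : ℤ} (h : x ≤ y) (h' : y ≤ z) :
    intervalProd a x y * intervalProd a y z = intervalProd a x z := by
  induction z, h' using Int.leInduction with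
  | base => rw [intervalProd_self, mul_one]
  | succ z hz ih => rw [intervalProd_succ a hz, intervalProd_succ a (h.trans hz), ← mul_assoc, ih]

theorem intervalProd_congr {a b : ℤ → A} {x y : ℤ} (h : ∀ i, x ≤ i → i < y → a i = b i) :
    intervalProd a x y = intervalProd b x y := by
  unfold intervalProd
  congr 1
  refine List.map_congr_left fun t ht => h _ (by omega) ?_
  have := List.mem_range.1 ht
  omega

theorem intervalProd_add (a : ℤ → A) (x y c : ℤ) :
    intervalProd a (x + c) (y + c) = intervalProd (fun i => a (i + c)) x y := by
  unfold intervalProd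
  rw [show y + c - (x + c) = y - x by ring]
  simp only [add_right_comm]

theorem intervalProd_intervalProd (a : ℤ → A) (u : ℤ → ℤ) (hu : Monotone u) {x y : ℤ}
    (h : x ≤ y) : intervalProd (fun j => intervalProd a (u j) (u (j + 1))) x y =
      intervalProd a (u x) (u y) := by
  induction y, h using Int.leInduction with
  | base => rw [intervalProd_self, intervalProd_self]
  | succ z hz ih =>
    rw [intervalProd_succ _ hz, ih, intervalProd_mul a (hu hz) (hu (by omega))]

namespace ParaMap

variable {l m n : ℕ}

/-- For `f : [m] ⟶ [n]` and `a : ℤ/m → A`, the family `ℤ/n → A` whose value at `j` is the product,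
in increasing order, of the `a i` over all integers `i` with `f i = j`. -/
noncomputable def mulFibers (f : ParaMap m n) (hm : 0 < m) (a : Fin m → A) : Fin n → A :=
  fun j => intervalProd (fun i => a (residue hm i)) (f.lo (j : ℕ)) (f.lo ((j : ℕ) + 1))

theorem mulFibers_residue (f : ParaMap m n) (hm : 0 < m) (hn : 0 < n) (a : Fin m → A) (j : ℤ) :
    f.mulFibers hm a (residue hn j) =
      intervalProd (fun i => a (residue hm i)) (f.lo j) (f.lo (j + 1)) := by
  obtain ⟨k, hk⟩ := (residue_eq_iff hn j _).1 rfl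
  have hj : ((residue hn j : ℕ) : ℤ) = j + (-k) * n := by linarith
  rw [mulFibers, hj, add_right_comm, f.lo_add_mul hn, f.lo_add_mul hn, intervalProd_add]
  simp only [residue_add_mul]

theorem mulFibers_id (hm : 0 < m) (a : Fin m → A) : (ParaMap.id m).mulFibers hm a = a := by
  ext j
  rw [mulFibers, lo_id hm, lo_id hm, intervalProd_single]
  congr 1
  exact (residue_eq_iff hm _ _).2 (by simp)

theorem mulFibers_comp (f : ParaMap l m) (g : ParaMap m n) (hl : 0 < l) (hm : 0 < m) (hn : 0 < n)
    (a : Fin l → A) : (f.comp g).mulFibers hl a = g.mulFibers hm (f.mulFibers hl a) := by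
  ext j
  simp only [mulFibers.eq_def g, mulFibers_residue]
  rw [intervalProd_intervalProd _ f.lo (fun _ _ h => f.lo_mono hm h) (g.lo_mono hn (by omega)),
    mulFibers, lo_comp hm hn, lo_comp hm hn]

theorem mulFibers_eq_of_rel (f g : ParaMap m n) (hm : 0 < m) (hn : 0 < n)
    (h : (ParaMap.rel 1 m n) f g) (a : Fin m → A) : f.mulFibers hm a = g.mulFibers hm a := by
  obtain ⟨k, hk⟩ := h
  have key : ∀ j, f.lo j = g.lo j + k * m := fun j => by
    refine eq_of_forall_ge_iff fun i => ?_
    rw [f.lo_le_iff hn, ← le_sub_iff_add_le, g.lo_le_iff hn, hk]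
    simp
  ext j
  simp only [mulFibers, key, intervalProd_add, residue_add_mul]

theorem mulFibers_update [DecidableEq (Fin m)] (f : ParaMap m n) (hm : 0 < m) (hn : 0 < n)
    (a : Fin m → A) (r : Fin m) : ∃ (j : Fin n) (b c : A), ∀ x : A,
      f.mulFibers hm (Function.update a r x) = Function.update (f.mulFibers hm a) j (b * x * c) := by
  have h0 : (0 : ℤ) < m := by exact_mod_cast hm
  have hn0 : (0 : ℤ) < n := by exact_mod_cast hn
  have hlo : f.lo n = f.lo 0 + m := by simpa using f.lo_add_mul hn 0 1
  -- `t` is the representative of `r` in the fundamental domain `[lo 0, lo 0 + m)`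
  set t : ℤ := f.lo 0 + (r - f.lo 0) % m with ht
  have ht0 : f.lo 0 ≤ t := by have := Int.emod_nonneg (r - f.lo 0) h0.ne'; omega
  have ht1 : t < f.lo 0 + m := by have := Int.emod_lt_of_pos (r - f.lo 0) h0; omega
  have hd : (m : ℤ) ∣ t - r := by
    have := Int.emod_add_mul_ediv (r - f.lo 0) m
    exact ⟨-((r - f.lo 0) / m), by rw [ht]; linarith⟩
  have htr : residue hm t = r := (residue_eq_iff hm _ _).2 hd
  -- it is the only one there
  have huniq : ∀ i, f.lo 0 ≤ i → i < f.lo 0 + m → i ≠ t → residue hm i ≠ r := by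
    intro i hi hi' hne h
    have h3 : (m : ℤ) ∣ i - t := by
      have := dvd_sub ((residue_eq_iff hm i r).1 h) hd
      rwa [sub_sub_sub_cancel_right] at this
    exact hne (by have := Int.eq_zero_of_abs_lt_dvd h3 (by rw [abs_lt]; omega); omega)
  have hj0 : 0 ≤ f.toFun t := (f.lo_le_iff hn _ _).1 ht0
  have hj1 : f.toFun t < n := by
    rw [← not_le, ← f.lo_le_iff hn, hlo]; omega
  obtain ⟨s, hs⟩ := Int.eq_ofNat_of_zero_le hj0
  obtain ⟨hst, hst'⟩ := (f.eq_iff_lo hn t s).1 hs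
  refine ⟨⟨s, by omega⟩, intervalProd (fun i => a (residue hm i)) (f.lo s) t,
    intervalProd (fun i => a (residue hm i)) (t + 1) (f.lo (s + 1)), fun x => ?_⟩
  have hcongr : ∀ u v : ℤ, f.lo 0 ≤ u → v ≤ f.lo 0 + m → (∀ i, u ≤ i → i < v → i ≠ t) →
      intervalProd (fun i => Function.update a r x (residue hm i)) u v =
        intervalProd (fun i => a (residue hm i)) u v := fun u v hu hv hne =>
    intervalProd_congr fun i hi hi' =>
      Function.update_of_ne (huniq i (by omega) (by omega) (hne i hi hi')) _ _
  have hb0 : f.lo 0 ≤ f.lo s := f.lo_mono hn (by omega)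
  have hb1 : f.lo (s + 1) ≤ f.lo 0 + m := by rw [← hlo]; exact f.lo_mono hn (by omega)
  ext j
  by_cases hj : j = ⟨s, by omega⟩
  · subst hj
    rw [Function.update_self, mulFibers]
    change intervalProd _ (f.lo (s : ℤ)) (f.lo ((s : ℤ) + 1)) = _
    rw [← intervalProd_mul _ (x := f.lo s) (y := t + 1) (by omega) (by omega),
      intervalProd_succ _ hst, hcongr _ _ hb0 (by omega) (fun i _ _ => by omega),
      hcongr (t + 1) _ (by omega) hb1 (fun i _ _ => by omega), htr, Function.update_self]
  · rw [Function.update_of_ne hj, mulFibers, mulFibers]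
    refine hcongr _ _ (f.lo_mono hn (by omega)) ?_ ?_
    · rw [← hlo]; exact f.lo_mono hn (by omega)
    · intro i hi hi' hit
      have := (f.eq_iff_lo hn i (j : ℕ)).2 ⟨hi, hi'⟩
      rw [hit] at this
      exact hj (Fin.ext (by simp; omega))

end ParaMap

variable (k : Type u) [CommRing k] (R : Type u) [Ring R] [Algebra k R]

/-- The `k`-linear map `R^{⊗ m} → R^{⊗ n}` induced by `f : [m] ⟶ [n]`: the tensor product over
`j ∈ ℤ/n` of the multiplication maps over the fibers of `f`. -/
noncomputable def ParaMap.tensorMap {m n : ℕ} (f : ParaMap m n) (hm : 0 < m) (hn : 0 < n) :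
    (⨂[k] _ : Fin m, R) →ₗ[k] (⨂[k] _ : Fin n, R) :=
  PiTensorProduct.lift
    { toFun := fun a => PiTensorProduct.tprod k (f.mulFibers hm a)
      map_update_add' := by
        intro _ a r x y
        obtain ⟨j, b, c, h⟩ := f.mulFibers_update hm hn a r
        simp only [h, mul_add, add_mul, MultilinearMap.map_update_add]
      map_update_smul' := by
        intro _ a r x y
        obtain ⟨j, b, c, h⟩ := f.mulFibers_update hm hn a r
        simp only [h, mul_smul_comm, smul_mul_assoc, MultilinearMap.map_update_smul] }

@[simp]
theorem ParaMap.tensorMap_tprod {m n : ℕ} (f : ParaMap m n) (hm : 0 < m) (hn : 0 < n)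
    (a : Fin m → R) : f.tensorMap k R hm hn (PiTensorProduct.tprod k a) =
      PiTensorProduct.tprod k (f.mulFibers hm a) :=
  PiTensorProduct.lift.tprod _

/-- The cyclic `k`-module `R_#` of a unital associative `k`-algebra `R`, with
`R_#([m]) = R^{⊗ m}`. -/
noncomputable def cyclicModule : CyclicCat ⥤ ModuleCat.{u} k where
  obj X := ModuleCat.of k (⨂[k] _ : Fin X.len, R)
  map {X Y} f := Quotient.lift
    (fun f : ParaMap X.len Y.len => ModuleCat.ofHom (f.tensorMap k R X.len_pos Y.len_pos))
    (fun f g h => by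
      congr 1
      refine PiTensorProduct.ext (MultilinearMap.ext fun a => ?_)
      simp [f.mulFibers_eq_of_rel g X.len_pos Y.len_pos h a]) f
  map_id X := by
    change ModuleCat.ofHom ((ParaMap.id X.len).tensorMap k R X.len_pos X.len_pos) = _
    ext : 1
    refine PiTensorProduct.ext (MultilinearMap.ext fun a => ?_)
    simp [ParaMap.mulFibers_id]
  map_comp := by
    rintro X Y Z ⟨f⟩ ⟨g⟩
    change ModuleCat.ofHom ((f.comp g).tensorMap k R X.len_pos Z.len_pos) =
      ModuleCat.ofHom (f.tensorMap k R X.len_pos Y.len_pos) ≫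
        ModuleCat.ofHom (g.tensorMap k R Y.len_pos Z.len_pos)
    ext : 1
    refine PiTensorProduct.ext (MultilinearMap.ext fun a => ?_)
    simp [ParaMap.mulFibers_comp f g X.len_pos Y.len_pos Z.len_pos]

end CyclicModule

/-! The result is a homological form of Quillen's Theorem A (`isIso_homologyRestr`), applied to
`cyclicEmbedding`: if every comma category j\σ (`StructuredArrow j σ`) is connected and has the
homology of a point with constant coefficients (`HomologicallyTrivial`), then H(I, σ^*E) → H(J, E)
is an isomorphism. Part 2 is the special case of the cyclic module.

Homology is computed by explicit functorial resolutions. Let `free E` be the functor i ↦ ∐_{j → i} E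
j. Both `free` and `free ⋙ colim` are, pointwise, coproducts of evaluations, hence exact by AB4.
Iterating the kernel of `free E ⟶ E` resolves E, and the total complex `T` of the resolution of a
complex bounded from above computes the left derived functor of `colim`, which therefore exists
(`hasHomology`).

For Theorem A, σ^*(free E) is the coproduct over j of the left Kan extensions, along j\σ → I, of the
constant functors with value E j. This Kan extension is exact, preserves relatively projective
objects and commutes with colimits, so the homology of I with these coefficients is the
constant-coefficient homology of j\σ. Under the hypothesis, σ^* of a free resolution is thus acyclic
for `colim`. Moreover σ is final, so the colimits over I and J agree.

It remains to contract the comma categories of i_p at [n]. Choosing representatives that send 0 to 0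
replaces them by `PointedUnder n p`: maps [n] → [mp] in Λ_∞, with genuine maps [m] → [m'] between
them. Recording also the points i * m embeds this into `PointedCospan n p`, the cospans [n] → [N] ←
[p] preserving 0 with injective right leg; the comma categories of that functor are the categories
`SubdivisionExtension`. The last two kinds of categories are contracted by zigzags of natural
transformations from the identity to a constant functor. The basic move is to double one point per
period and then map the doubled object down in two different ways. A second use of Theorem A
(`HomologicallyTrivial.of_structuredArrow`) then yields the triviality of `PointedUnder n p`. -/

/-! ### Total complexes of bicomplexes in a half plane -/

/-- The total degree of the position `(i, a)` is `i - a`. -/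
instance totalShapeUpDown :
    TotalComplexShape (ComplexShape.up ℤ) (ComplexShape.down ℕ) (ComplexShape.up ℤ) where
  π x := x.1 - x.2
  ε₁ _ := 1
  ε₂ x := x.1.negOnePow
  rel₁ {i i'} h a := by
    have h' : i + 1 = i' := h
    change i - (a : ℤ) + 1 = i' - (a : ℤ)
    omega
  rel₂ i {a a'} h := by
    have h' : a' + 1 = a := h
    change i - (a : ℤ) + 1 = i - (a' : ℤ)
    omega
  ε₂_ε₁ {i i' a a'} h _ := by
    have h' : i + 1 = i' := h
    subst h'
    simp [Int.negOnePow_succ]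

/-- A decomposition of a cochain complex `T` into components `Y i a` of degree `i - a`, such that
the differential has a part `dv` raising `i` and a part `dh` lowering `a`. -/
structure TotalDecomp {B : Type u'} [Category.{v'} B] [Preadditive B] (Y : ℤ → ℕ → B)
    (dv : ∀ i i' a, Y i a ⟶ Y i' a) (dh : ∀ i a a', Y i a ⟶ Y i a')
    (T : CochainComplex B ℤ) where
  inj (i : ℤ) (a : ℕ) (n : ℤ) (h : i - a = n) : Y i a ⟶ T.X n
  prj (i : ℤ) (a : ℕ) (n : ℤ) (h : i - a = n) : T.X n ⟶ Y i a
  inj_prj (i : ℤ) (a : ℕ) (n : ℤ) (h : i - a = n) : inj i a n h ≫ prj i a n h = 𝟙 _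
  inj_prj_ne (i i' : ℤ) (a a' : ℕ) (n : ℤ) (h : i - a = n) (h' : i' - a' = n) (ha : a ≠ a') :
    inj i a n h ≫ prj i' a' n h' = 0
  d_prj (i i' : ℤ) (a : ℕ) (n n' : ℤ) (hi : i + 1 = i') (h : i - a = n) (h' : i' - a = n') :
    T.d n n' ≫ prj i' a n' h' = prj i a n h ≫ dv i i' a +
      i'.negOnePow • prj i' (a + 1) n (by omega) ≫ dh i' (a + 1) a
  finite (n : ℤ) : ∃ k : ℕ, ∑ a ∈ Finset.range k, prj (n + a) a n (by omega) ≫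
    inj (n + a) a n (by omega) = 𝟙 (T.X n)

namespace TotalDecomp

section

variable {B : Type u'} [Category.{v'} B] [Preadditive B] {Y : ℤ → ℕ → B}
    {dv : ∀ i i' a, Y i a ⟶ Y i' a} {dh : ∀ i a a', Y i a ⟶ Y i a'}
    {T : CochainComplex B ℤ} (D : TotalDecomp Y dv dh T)

include D in
theorem eq_zero {A : B} {n : ℤ} (x : A ⟶ T.X n)
    (hx : ∀ i a h, x ≫ D.prj i a n h = 0) : x = 0 := by
  obtain ⟨k, hk⟩ := D.finite n
  rw [← Category.comp_id x, ← hk, Preadditive.comp_sum]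
  refine Finset.sum_eq_zero fun a _ => ?_
  rw [← Category.assoc, hx, zero_comp]

/-- Supplies the bound from which the inductions over columns start. -/
theorem prj_eq_zero_of_le (n : ℤ) : ∃ k : ℕ, ∀ i a h, k ≤ a → D.prj i a n h = 0 := by
  obtain ⟨k, hk⟩ := D.finite n
  refine ⟨k, fun i a h ha => ?_⟩
  rw [← Category.id_comp (D.prj i a n h), ← hk, Preadditive.sum_comp]
  refine Finset.sum_eq_zero fun b hb => ?_
  rw [Category.assoc, D.inj_prj_ne _ _ _ _ _ _ _ (by have := Finset.mem_range.1 hb; omega),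
    comp_zero]

/-- The image of a decomposition under an additive functor. -/
def map {B' : Type u} [Category.{v} B'] [Preadditive B'] (F : B ⥤ B') [F.Additive] :
    TotalDecomp (fun i a => F.obj (Y i a)) (fun i i' a => F.map (dv i i' a))
      (fun i a a' => F.map (dh i a a')) ((F.mapHomologicalComplex _).obj T) where
  inj i a n h := F.map (D.inj i a n h)
  prj i a n h := F.map (D.prj i a n h)
  inj_prj i a n h := (F.map_comp _ _).symm.trans ((congrArg F.map (D.inj_prj i a n h)).trans
    (F.map_id _))
  inj_prj_ne i i' a a' n h h' ha := (F.map_comp _ _).symm.trans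
    ((congrArg F.map (D.inj_prj_ne _ _ _ _ _ h h' ha)).trans (F.map_zero _ _))
  d_prj i i' a n n' hi h h' := by
    have e : F.map (T.d n n') ≫ F.map (D.prj i' a n' h') =
        F.map (D.prj i a n h) ≫ F.map (dv i i' a) +
          i'.negOnePow • F.map (D.prj i' (a + 1) n (by omega)) ≫ F.map (dh i' (a + 1) a) := by
      rw [← F.map_comp, D.d_prj i i' a n n' hi h h', F.map_add, F.map_comp]
      congr 1
      rw [Units.smul_def, F.map_zsmul, F.map_comp, Units.smul_def]
    exact e
  finite n := by
    obtain ⟨k, hk⟩ := D.finite n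
    refine ⟨k, ?_⟩
    have e : ∑ a ∈ Finset.range k, F.map (D.prj (n + a) a n (by omega)) ≫
        F.map (D.inj (n + a) a n (by omega)) = 𝟙 (F.obj (T.X n)) := by
      rw [← F.map_id, ← hk, F.map_sum]
      simp only [F.map_comp]
    exact e

end

section

variable {A : Type u} [Category.{v} A] [Preadditive A]
  (K : HomologicalComplex₂ A (ComplexShape.up ℤ) (ComplexShape.down ℕ))
  [K.HasTotal (ComplexShape.up ℤ)]

/-- The projection of the total complex of a bicomplex to one of its components. -/
noncomputable def totalPrj (i : ℤ) (a : ℕ) (n : ℤ) (h : i - a = n) :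
    (K.total (ComplexShape.up ℤ)).X n ⟶ (K.X i).X a :=
  K.totalDesc fun i' a' h' => if ha : a' = a then
    (K.XXIsoOfEq _ _ _ (by change i' - (a' : ℤ) = n at h'; omega) ha).hom else 0

theorem ι_totalPrj (i : ℤ) (a : ℕ) (n : ℤ) (h : i - a = n) :
    K.ιTotal (ComplexShape.up ℤ) i a n h ≫ totalPrj K i a n h = 𝟙 _ := by
  simp [totalPrj]

theorem ι_totalPrj_ne (i i' : ℤ) (a a' : ℕ) (n : ℤ) (h : i - a = n) (h' : i' - a' = n)
    (ha : a ≠ a') : K.ιTotal (ComplexShape.up ℤ) i a n h ≫ totalPrj K i' a' n h' = 0 := by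
  simp [totalPrj, ha]

/-- The decomposition of the total complex of a bicomplex which vanishes in large degrees. -/
noncomputable def ofBicomplex (N : ℤ) (hN : ∀ i, N < i → ∀ a, IsZero ((K.X i).X a)) :
    TotalDecomp (fun i a => (K.X i).X a) (fun i i' a => (K.d i i').f a)
      (fun i a a' => (K.X i).d a a') (K.total (ComplexShape.up ℤ)) where
  inj i a n h := K.ιTotal (ComplexShape.up ℤ) i a n h
  prj := totalPrj K
  inj_prj := ι_totalPrj K
  inj_prj_ne := ι_totalPrj_ne K
  d_prj i i' a n n' hi h h' := by
    refine HomologicalComplex₂.total.hom_ext _ fun j b hj => ?_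
    have hj' : j - (b : ℤ) = n := hj
    rw [HomologicalComplex₂.total_d, Preadditive.add_comp, Preadditive.comp_add,
      HomologicalComplex₂.ι_D₁_assoc, HomologicalComplex₂.ι_D₂_assoc, Preadditive.comp_add,
      HomologicalComplex₂.d₁_eq K _ (i₁' := j + 1) rfl b n'
        (by change j + 1 - (b : ℤ) = n'; omega)]
    congr 1
    · rw [Linear.units_smul_comp]
      change (1 : ℤˣ) • _ = _
      rw [one_smul, Category.assoc]
      by_cases hb : b = a
      · subst hb
        obtain rfl : j = i := by omega
        subst hi
        rw [ι_totalPrj, Category.comp_id, ← Category.assoc, ι_totalPrj, Category.id_comp]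
      · rw [ι_totalPrj_ne _ _ _ _ _ _ _ _ hb, comp_zero, ← Category.assoc,
          ι_totalPrj_ne _ _ _ _ _ _ _ _ hb, zero_comp]
    · rw [Linear.comp_units_smul]
      obtain _ | b := b
      · rw [HomologicalComplex₂.d₂_eq_zero, zero_comp, ← Category.assoc, ι_totalPrj_ne, zero_comp,
          smul_zero]
        · omega
        · simp
      · rw [HomologicalComplex₂.d₂_eq K _ j (i₂' := b) (by simp) n'
          (by change j - (b : ℤ) = n'; push_cast at hj'; omega), Linear.units_smul_comp]
        change j.negOnePow • _ = _
        by_cases hb : b = a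
        · subst hb
          obtain rfl : j = i' := by push_cast at hj'; omega
          rw [Category.assoc, ι_totalPrj, Category.comp_id, ← Category.assoc, ι_totalPrj,
            Category.id_comp]
        · rw [Category.assoc, ι_totalPrj_ne _ _ _ _ _ _ _ _ hb, comp_zero, ← Category.assoc,
            ι_totalPrj_ne _ _ _ _ _ _ _ _ (by omega), zero_comp, smul_zero, smul_zero]
  finite n := by
    -- A component of total degree n in column b lies in row n + b, which vanishes as soon as n + b
    -- > N. So only the columns b ≤ N - n contribute.
    refine ⟨(N - n + 1).toNat, HomologicalComplex₂.total.hom_ext _ fun j b hj => ?_⟩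
    have hj' : j - (b : ℤ) = n := hj
    by_cases hjN : N < j
    · exact (hN j hjN b).eq_of_src _ _
    · rw [Preadditive.comp_sum, Finset.sum_eq_single b]
      · obtain rfl : j = n + b := by omega
        rw [← Category.assoc, ι_totalPrj, Category.id_comp, Category.comp_id]
      · intro a _ ha
        rw [← Category.assoc, ι_totalPrj_ne _ _ _ _ _ _ _ _ ha.symm, zero_comp]
      · intro hb
        exact absurd (Finset.mem_range.2 (by omega)) hb

end

end TotalDecomp

/-! ### Quasi-isomorphisms in terms of generalized elements -/

section Refinements

variable {B : Type u'} [Category.{v'} B] [Abelian B]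

/-- A morphism of complexes is a quasi-isomorphism if and only if its cone is exact up to
refinements. -/
theorem quasiIso_iff_up_to_refinements {K L : CochainComplex B ℤ} (φ : K ⟶ L) :
    QuasiIso φ ↔ ∀ (m n n' n'' : ℤ) (_ : m + 1 = n) (_ : n + 1 = n') (_ : n' + 1 = n'') ⦃A : B⦄
      (x : A ⟶ K.X n') (y : A ⟶ L.X n), x ≫ K.d n' n'' = 0 → x ≫ φ.f n' = y ≫ L.d n n' →
      ∃ (A' : B) (π : A' ⟶ A) (_ : Epi π) (u : A' ⟶ K.X n) (v : A' ⟶ L.X m),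
        π ≫ x = u ≫ K.d n n' ∧ π ≫ y = u ≫ φ.f n + v ≫ L.d m n := by
  constructor
  -- Injectivity in degree n' makes x a boundary. After subtracting its primitive, y becomes a
  -- cycle, and surjectivity in degree n treats the rest.
  · intro hφ m n n' n'' hm hn hn' A x y hx hxy
    obtain ⟨A₁, π₁, _, u₁, hu₁⟩ := (HomologicalComplex.mono_homologyMap_iff_up_to_refinements φ n n'
      n'' (by simp [← hn]) (by simp [← hn'])).1 inferInstance x hx y hxy
    obtain ⟨A₂, π₂, _, u₂, hu₂, v, hv⟩ :=
      (HomologicalComplex.epi_homologyMap_iff_up_to_refinements φ m n n' (by simp [← hm])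
        (by simp [← hn])).1 inferInstance (π₁ ≫ y - u₁ ≫ φ.f n) (by
          rw [Preadditive.sub_comp, Category.assoc, Category.assoc, φ.comm, ← Category.assoc u₁,
            ← hu₁, ← hxy, Category.assoc, sub_self])
    refine ⟨A₂, π₂ ≫ π₁, inferInstance, π₂ ≫ u₁ + u₂, v, ?_, ?_⟩
    · rw [Preadditive.add_comp, hu₂, add_zero, Category.assoc, Category.assoc, hu₁]
    · rw [Preadditive.comp_sub, sub_eq_iff_eq_add] at hv
      rw [Category.assoc, hv, Preadditive.add_comp, Category.assoc]
      abel
  · intro h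
    rw [quasiIso_iff]
    intro j
    rw [quasiIsoAt_iff_isIso_homologyMap]
    have h₁ : Mono (HomologicalComplex.homologyMap φ j) := by
      rw [HomologicalComplex.mono_homologyMap_iff_up_to_refinements φ (j - 1) j (j + 1) (by simp)
        (by simp)]
      intro A x hx y hy
      obtain ⟨A', π, hπ, u, v, hu, -⟩ := h (j - 1 - 1) (j - 1) j (j + 1) (by omega) (by omega)
        (by omega) x y hx hy
      exact ⟨A', π, hπ, u, hu⟩
    have h₂ : Epi (HomologicalComplex.homologyMap φ j) := by
      rw [HomologicalComplex.epi_homologyMap_iff_up_to_refinements φ (j - 1) j (j + 1) (by simp)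
        (by simp)]
      intro A y hy
      obtain ⟨A', π, hπ, u, v, hu, hv⟩ := h (j - 1) j (j + 1) (j + 1 + 1) (by omega) (by omega)
        (by omega) 0 y (by simp) (by simp [hy])
      exact ⟨A', π, hπ, u, by rw [← hu, comp_zero], v, hv⟩
    exact isIso_of_mono_of_epi _

end Refinements

/-! ### Comparison of total complexes along columns and along rows -/

namespace TotalDecomp

variable {B : Type u'} [Category.{v'} B]

section

variable [Preadditive B] {Y : ℤ → ℕ → B}
    {dv : ∀ i i' a, Y i a ⟶ Y i' a} {dh : ∀ i a a', Y i a ⟶ Y i a'}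
    {T : CochainComplex B ℤ} (D : TotalDecomp Y dv dh T)

theorem inj_d_prj (i i' : ℤ) (a : ℕ) (n n' : ℤ) (hi : i + 1 = i') (h : i - a = n)
    (h' : i' - a = n') : D.inj i a n h ≫ T.d n n' ≫ D.prj i' a n' h' = dv i i' a := by
  rw [D.d_prj i i' a n n' hi h h', Preadditive.comp_add, Linear.comp_units_smul, ← Category.assoc,
    D.inj_prj, Category.id_comp, ← Category.assoc, D.inj_prj_ne _ _ _ _ _ _ _ (by omega),
    zero_comp, smul_zero, add_zero]

theorem inj_d_prj_succ (i : ℤ) (a : ℕ) (n n' : ℤ) (h : i - (a + 1 : ℕ) = n) (h' : i - a = n') :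
    D.inj i (a + 1) n h ≫ T.d n n' ≫ D.prj i a n' h' = i.negOnePow • dh i (a + 1) a := by
  rw [D.d_prj (i - 1) i a n n' (by omega) (by omega) h', Preadditive.comp_add,
    Linear.comp_units_smul, ← Category.assoc, D.inj_prj_ne _ _ _ _ _ _ _ (by omega), zero_comp,
    zero_add, ← Category.assoc, D.inj_prj, Category.id_comp]

theorem inj_d_prj_ne (i j : ℤ) (a b : ℕ) (n n' : ℤ) (h : i - a = n) (h' : j - b = n')
    (hn : n + 1 = n') (hab : a ≠ b) (hab' : a ≠ b + 1) :
    D.inj i a n h ≫ T.d n n' ≫ D.prj j b n' h' = 0 := by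
  rw [D.d_prj (j - 1) j b n n' (by omega) (by omega) h', Preadditive.comp_add,
    Linear.comp_units_smul, ← Category.assoc, D.inj_prj_ne _ _ _ _ _ _ _ hab, zero_comp,
    zero_add, ← Category.assoc, D.inj_prj_ne _ _ _ _ _ _ _ hab', zero_comp, smul_zero]

end

section

variable [Abelian B] {Y Y' : ℤ → ℕ → B}
    {dv : ∀ i i' a, Y i a ⟶ Y i' a} {dh : ∀ i a a', Y i a ⟶ Y i a'}
    {dv' : ∀ i i' a, Y' i a ⟶ Y' i' a} {dh' : ∀ i a a', Y' i a ⟶ Y' i a'}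
    {T T' : CochainComplex B ℤ} (D : TotalDecomp Y dv dh T) (D' : TotalDecomp Y' dv' dh' T')

include D D' in
/-- A morphism of total complexes which is a quasi-isomorphism on columns is a
quasi-isomorphism. -/
theorem quasiIso_of_columns (φ : T ⟶ T') (f : ∀ i a, Y i a ⟶ Y' i a)
    (hφ : ∀ i a n h, φ.f n ≫ D'.prj i a n h = D.prj i a n h ≫ f i a)
    (hcol : ∀ (a : ℕ) (m n n' n'' : ℤ) (_ : m + 1 = n) (_ : n + 1 = n') (_ : n' + 1 = n'') ⦃A : B⦄
      (x : A ⟶ Y n' a) (y : A ⟶ Y' n a), x ≫ dv n' n'' a = 0 → x ≫ f n' a = y ≫ dv' n n' a →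
      ∃ (A' : B) (π : A' ⟶ A) (_ : Epi π) (u : A' ⟶ Y n a) (v : A' ⟶ Y' m a),
        π ≫ x = u ≫ dv n n' a ∧ π ≫ y = u ≫ f n a + v ≫ dv' m n a) :
    QuasiIso φ := by
  rw [quasiIso_iff_up_to_refinements]
  intro m n n' n'' hm hn hn'
  have key : ∀ (k : ℕ) ⦃A : B⦄ (x : A ⟶ T.X n') (y : A ⟶ T'.X n),
      (∀ i a h, k ≤ a → x ≫ D.prj i a n' h = 0) → (∀ i a h, k ≤ a → y ≫ D'.prj i a n h = 0) →
      x ≫ T.d n' n'' = 0 → x ≫ φ.f n' = y ≫ T'.d n n' →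
      ∃ (A' : B) (π : A' ⟶ A) (_ : Epi π) (u : A' ⟶ T.X n) (v : A' ⟶ T'.X m),
        π ≫ x = u ≫ T.d n n' ∧ π ≫ y = u ≫ φ.f n + v ≫ T'.d m n := by
    intro k
    induction k with
    | zero =>
      intro A x y hx hy _ _
      exact ⟨A, 𝟙 A, inferInstance, 0, 0,
        by rw [D.eq_zero x fun i a h => hx i a h (Nat.zero_le _)]; simp,
        by rw [D'.eq_zero y fun i a h => hy i a h (Nat.zero_le _)]; simp⟩
    | succ k ih =>
      intro A x y hx hy hxd hxy
      have e₁ : (x ≫ D.prj (n' + k) k n' (by omega)) ≫ dv (n' + k) (n'' + k) k = 0 := by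
        have := hxd =≫ D.prj (n'' + k) k n'' (by omega)
        rw [Category.assoc, D.d_prj (n' + k) (n'' + k) k n' n'' (by omega) (by omega),
          Preadditive.comp_add, Linear.comp_units_smul, zero_comp] at this
        rwa [← Category.assoc x (D.prj (n'' + k) (k + 1) n' _), hx _ _ _ le_rfl, zero_comp,
          smul_zero, add_zero, ← Category.assoc] at this
      have e₂ : (x ≫ D.prj (n' + k) k n' (by omega)) ≫ f (n' + k) k =
          (y ≫ D'.prj (n + k) k n (by omega)) ≫ dv' (n + k) (n' + k) k := by
        have := hxy =≫ D'.prj (n' + k) k n' (by omega)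
        rw [Category.assoc, hφ, Category.assoc, D'.d_prj (n + k) (n' + k) k n n' (by omega)
          (by omega), Preadditive.comp_add, Linear.comp_units_smul,
          ← Category.assoc y (D'.prj (n' + k) (k + 1) n _), hy _ _ _ le_rfl, zero_comp,
          smul_zero, add_zero, ← Category.assoc, ← Category.assoc] at this
        exact this
      obtain ⟨A₁, π₁, _, u₁, v₁, hu₁, hv₁⟩ := hcol k (m + k) (n + k) (n' + k) (n'' + k) (by omega)
        (by omega) (by omega) _ _ e₁ e₂
      obtain ⟨A₂, π₂, _, u₂, v₂, hu₂, hv₂⟩ := ih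
        (π₁ ≫ x - u₁ ≫ D.inj (n + k) k n (by omega) ≫ T.d n n')
        (π₁ ≫ y - u₁ ≫ D.inj (n + k) k n (by omega) ≫ φ.f n -
          v₁ ≫ D'.inj (m + k) k m (by omega) ≫ T'.d m n) (by
            intro i a h ha
            rw [Preadditive.sub_comp, Category.assoc, Category.assoc, Category.assoc, sub_eq_zero]
            obtain rfl | ha := ha.eq_or_lt
            · obtain rfl : i = n' + k := by omega
              rw [D.inj_d_prj _ _ _ _ _ (by omega), hu₁]
            · rw [D.inj_d_prj_ne _ _ _ _ _ _ _ _ hn (by omega) (by omega), hx _ _ _ ha, comp_zero,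
                comp_zero]) (by
            intro i a h ha
            rw [Preadditive.sub_comp, Preadditive.sub_comp, Category.assoc, Category.assoc,
              Category.assoc, Category.assoc, Category.assoc, hφ]
            obtain rfl | ha := ha.eq_or_lt
            · obtain rfl : i = n + k := by omega
              rw [D'.inj_d_prj _ _ _ _ _ (by omega), hv₁, ← Category.assoc (D.inj _ _ _ _),
                D.inj_prj, Category.id_comp]
              abel
            · rw [D'.inj_d_prj_ne _ _ _ _ _ _ _ _ hm (by omega) (by omega), hy _ _ _ ha, comp_zero,
                comp_zero, ← Category.assoc (D.inj _ _ _ _), D.inj_prj_ne _ _ _ _ _ _ _ ha.ne]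
              simp) (by simp [hxd]) (by simp [hxy])
      refine ⟨A₂, π₂ ≫ π₁, inferInstance, u₂ + π₂ ≫ u₁ ≫ D.inj (n + k) k n (by omega),
        v₂ + π₂ ≫ v₁ ≫ D'.inj (m + k) k m (by omega), ?_, ?_⟩
      · rw [Preadditive.comp_sub, sub_eq_iff_eq_add] at hu₂
        simp [hu₂]
      · rw [Preadditive.comp_sub, Preadditive.comp_sub, sub_eq_iff_eq_add, sub_eq_iff_eq_add] at hv₂
        simp only [Category.assoc, hv₂, Preadditive.add_comp]
        abel
  intro A x y hx hxy
  obtain ⟨k, hk⟩ := D.prj_eq_zero_of_le n'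
  obtain ⟨k', hk'⟩ := D'.prj_eq_zero_of_le n
  exact key (max k k') x y (fun i a h ha => by rw [hk _ _ _ (le_trans (le_max_left _ _) ha),
    comp_zero]) (fun i a h ha => by rw [hk' _ _ _ (le_trans (le_max_right _ _) ha),
    comp_zero]) hx hxy

include D in
/-- The augmentation of a total complex whose augmented rows are exact is a quasi-isomorphism. -/
theorem quasiIso_of_rows {L : CochainComplex B ℤ} (φ : T ⟶ L) (e : ∀ i, Y i 0 ⟶ L.X i)
    (hφ : ∀ n h, φ.f n = D.prj n 0 n h ≫ e n) (he : ∀ i, Epi (e i))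
    (hrow₀ : ∀ (i : ℤ) ⦃A : B⦄ (x : A ⟶ Y i 0), x ≫ e i = 0 →
      ∃ (A' : B) (π : A' ⟶ A) (_ : Epi π) (u : A' ⟶ Y i 1), π ≫ x = u ≫ dh i 1 0)
    (hrow : ∀ (i : ℤ) (a : ℕ) ⦃A : B⦄ (x : A ⟶ Y i (a + 1)), x ≫ dh i (a + 1) a = 0 →
      ∃ (A' : B) (π : A' ⟶ A) (_ : Epi π) (u : A' ⟶ Y i (a + 2)),
        π ≫ x = u ≫ dh i (a + 2) (a + 1)) :
    QuasiIso φ := by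
  have hinj₀ : ∀ n h, D.inj n 0 n h ≫ φ.f n = e n := fun n h => by
    rw [hφ n h, ← Category.assoc, D.inj_prj, Category.id_comp]
  have hinj : ∀ i a n h, D.inj i (a + 1) n h ≫ φ.f n = 0 := fun i a n h => by
    rw [hφ n (by simp), ← Category.assoc, D.inj_prj_ne _ _ _ _ _ _ _ (by omega), zero_comp]
  -- The components of x live in the columns from k to k + r - 1. Exactness of the row lifts the
  -- first one to column k + 1, one degree lower, and subtracting the boundary of the lift moves the
  -- start to k + 1. All corrections lie in positive columns, where φ vanishes, so that `u ≫ φ.f n =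
  -- 0` can be carried along.
  have key : ∀ (n n' n'' : ℤ) (_ : n + 1 = n') (_ : n' + 1 = n'') (r k : ℕ)
      (_ : ∀ i a h, k + r ≤ a → D.prj i a n' h = 0) ⦃A : B⦄ (x : A ⟶ T.X n'),
      (∀ i a h, a < k → x ≫ D.prj i a n' h = 0) → x ≫ T.d n' n'' = 0 → x ≫ φ.f n' = 0 →
      ∃ (A' : B) (π : A' ⟶ A) (_ : Epi π) (u : A' ⟶ T.X n),
        π ≫ x = u ≫ T.d n n' ∧ u ≫ φ.f n = 0 := by
    intro n n' n'' hn hn' r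
    induction r with
    | zero =>
      intro k hk A x hx _ _
      refine ⟨A, 𝟙 A, inferInstance, 0, ?_, by simp⟩
      rw [D.eq_zero x fun i a h => ?_, comp_zero, zero_comp]
      by_cases ha : a < k
      · exact hx _ _ _ ha
      · rw [hk _ _ _ (by omega), comp_zero]
    | succ r ih =>
      intro k hk A x hx hxd hxφ
      -- In column 0 the component is killed by the augmentation, because φ factors through that
      -- column. In a later column it is killed by `dh`: project the cycle condition to the column
      -- before.
      have lift : ∃ (A' : B) (π : A' ⟶ A) (_ : Epi π) (u : A' ⟶ Y (n' + k) (k + 1)),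
          π ≫ x ≫ D.prj (n' + k) k n' (by omega) = u ≫ dh (n' + k) (k + 1) k := by
        obtain _ | k := k
        · refine hrow₀ _ _ ?_
          obtain ⟨i, hi⟩ : ∃ i, i = n' + (0 : ℕ) := ⟨_, rfl⟩
          obtain rfl : i = n' := by simpa using hi
          have h2 : ∀ j (hj : j = i) h, (x ≫ D.prj j 0 i h) ≫ e j = 0 := by
            rintro j rfl h
            rw [Category.assoc, ← hφ, hxφ]
          exact h2 _ (by simp) _
        · refine hrow _ _ _ ?_
          have := hxd =≫ D.prj (n' + (k + 1 : ℕ)) k n'' (by push_cast; omega)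
          rw [Category.assoc, D.d_prj (n' + k) _ k n' n'' (by push_cast; omega) (by omega),
            Preadditive.comp_add, Linear.comp_units_smul, zero_comp, ← Category.assoc,
            hx _ _ _ (by omega), zero_comp, zero_add, smul_eq_zero_iff_eq] at this
          rw [Category.assoc, this]
      obtain ⟨A₁, π₁, _, u₁, hu₁⟩ := lift
      obtain ⟨A₂, π₂, _, u₂, hu₂, hu₂'⟩ := ih (k + 1)
        (fun i a h ha => hk i a h (by omega))
        -- The sign cancels the one that the total differential puts in front of `dh`.
        (π₁ ≫ x - (n' + k : ℤ).negOnePow • u₁ ≫ D.inj (n' + k) (k + 1) n (by push_cast; omega)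
          ≫ T.d n n') (by
            intro i a h ha
            rw [Preadditive.sub_comp, Category.assoc, Linear.units_smul_comp, Category.assoc,
              Category.assoc, sub_eq_zero]
            obtain rfl | ha := (Nat.lt_succ_iff.1 ha).eq_or_lt
            · obtain rfl : i = n' + a := by omega
              rw [D.inj_d_prj_succ, hu₁, Linear.comp_units_smul, smul_smul, Int.units_mul_self,
                one_smul]
            · rw [D.inj_d_prj_ne _ _ _ _ _ _ _ _ hn (by omega) (by omega), hx _ _ _ ha, comp_zero,
                comp_zero, smul_zero]) (by
            rw [Preadditive.sub_comp, Category.assoc, hxd, Linear.units_smul_comp]; simp) (by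
            rw [Preadditive.sub_comp, Category.assoc, hxφ, Linear.units_smul_comp, Category.assoc,
              Category.assoc, ← φ.comm, reassoc_of% hinj]
            simp)
      refine ⟨A₂, π₂ ≫ π₁, inferInstance,
        u₂ + (n' + k : ℤ).negOnePow • π₂ ≫ u₁ ≫ D.inj (n' + k) (k + 1) n (by push_cast; omega),
        ?_, ?_⟩
      · rw [Preadditive.comp_sub, sub_eq_iff_eq_add, Linear.comp_units_smul] at hu₂
        simp only [Category.assoc, hu₂, Preadditive.add_comp, Linear.units_smul_comp]
      · simp [Preadditive.add_comp, hu₂', Linear.units_smul_comp, hinj]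
  rw [quasiIso_iff_up_to_refinements]
  intro m n n' n'' hm hn hn' A x y hx hxy
  -- Lifting y to column 0 through the epimorphism `e n` reduces the claim to y = 0.
  obtain ⟨A₁, π₁, _, y₁, hy₁⟩ := surjective_up_to_refinements_of_epi (e n) y
  obtain ⟨k, hk⟩ := D.prj_eq_zero_of_le n'
  obtain ⟨A₂, π₂, _, u₂, hu₂, hu₂'⟩ := key n n' n'' hn hn' k 0 (by simpa using hk)
    (π₁ ≫ x - y₁ ≫ D.inj n 0 n (by simp) ≫ T.d n n') (by simp) (by simp [hx]) (by
      rw [Preadditive.sub_comp, Category.assoc, hxy, Category.assoc, Category.assoc, ← φ.comm,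
        reassoc_of% hinj₀, reassoc_of% hy₁, sub_self])
  refine ⟨A₂, π₂ ≫ π₁, inferInstance, u₂ + π₂ ≫ y₁ ≫ D.inj n 0 n (by simp), 0, ?_, ?_⟩
  · rw [Preadditive.comp_sub, sub_eq_iff_eq_add] at hu₂
    simp [hu₂]
  · simp [hu₂', hinj₀, hy₁]

end

end TotalDecomp

/-! ### Left derived functors from a functorial resolution -/

section LeftDerivedFunctors

open Functor

variable {𝒞 : Type u} [Category.{v} 𝒞] {ℋ : Type u'} [Category.{v'} ℋ] (W : MorphismProperty 𝒞)
  {T : 𝒞 ⥤ 𝒞} (e : T ⟶ 𝟭 𝒞) (hW : ∀ X, W (e.app X)) (Γ : 𝒞 ⥤ ℋ)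
  (hinv : W.IsInvertedBy (T ⋙ Γ))

/-- The left derived functor obtained from a functorial resolution `e : T ⟶ 𝟭`. -/
noncomputable def derivedOfResolution : W.Localization ⥤ ℋ :=
  Localization.lift (T ⋙ Γ) hinv W.Q

/-- The counit of `derivedOfResolution`. -/
noncomputable def derivedOfResolutionCounit :
    W.Q ⋙ derivedOfResolution W Γ hinv ⟶ Γ :=
  (Localization.fac (T ⋙ Γ) hinv W.Q).hom ≫ whiskerRight e Γ

include hW in
-- In the localization every object is isomorphic to a resolved one, and at resolved objects the
-- counit is invertible because Γ inverts `e.app (T.obj X)`. Natural transformations into the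
-- derived functor are therefore determined, and can be defined, on resolved objects.
theorem isLeftDerivedFunctor_of_resolution (hT : ∀ X, IsIso (Γ.map (e.app (T.obj X)))) :
    (derivedOfResolution W Γ hinv).IsLeftDerivedFunctor
      (derivedOfResolutionCounit W e Γ hinv) W := by
  have hL : ∀ X, IsIso (W.Q.map (e.app X)) := fun X => Localization.inverts W.Q W _ (hW X)
  let α := derivedOfResolutionCounit W e Γ hinv
  have hα : ∀ X, α.app X =
      (Localization.fac (T ⋙ Γ) hinv W.Q).hom.app X ≫ Γ.map (e.app X) := fun X => rfl
  have uniq : ∀ (G : W.Localization ⥤ ℋ) (γ γ' : G ⟶ derivedOfResolution W Γ hinv),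
      whiskerLeft W.Q γ ≫ α = whiskerLeft W.Q γ' ≫ α → γ = γ' := by
    intro G γ γ' h
    refine Localization.natTrans_ext W.Q W fun X => ?_
    have hX : γ.app (W.Q.obj (T.obj X)) = γ'.app (W.Q.obj (T.obj X)) := by
      have h' : γ.app (W.Q.obj (T.obj X)) ≫ α.app (T.obj X) =
        γ'.app (W.Q.obj (T.obj X)) ≫ α.app (T.obj X) := NatTrans.congr_app h (T.obj X)
      have : IsIso (α.app (T.obj X)) := by
        have := hT X
        exact (isIso_comp_left_iff ((Localization.fac (T ⋙ Γ) hinv W.Q).hom.app (T.obj X))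
          (Γ.map (e.app (T.obj X)))).2 this
      exact (cancel_mono _).1 h'
    have := hL X
    rw [← cancel_epi (G.map (W.Q.map (e.app X)))]
    have h₁ := γ.naturality (W.Q.map (e.app X))
    have h₂ := γ'.naturality (W.Q.map (e.app X))
    exact h₁.trans ((congrArg (· ≫ _) hX).trans h₂.symm)
  have exist : ∀ (G : W.Localization ⥤ ℋ) (β : W.Q ⋙ G ⟶ Γ),
      ∃ γ : G ⟶ derivedOfResolution W Γ hinv, whiskerLeft W.Q γ ≫ α = β := by
    intro G β
    -- Pass from X to its resolution inside the localization and apply β there.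
    let τ : W.Q ⋙ G ⟶ T ⋙ Γ :=
      { app X := inv (G.map (W.Q.map (e.app X))) ≫ β.app (T.obj X)
        naturality X Y f := by
          have h₁ := e.naturality f
          have h₂ := β.naturality (T.map f)
          dsimp at h₁ h₂ ⊢
          rw [Category.assoc, ← h₂, ← Category.assoc, ← Category.assoc]
          congr 1
          rw [IsIso.comp_inv_eq, Category.assoc, ← G.map_comp, ← W.Q.map_comp, h₁, W.Q.map_comp,
            G.map_comp, IsIso.inv_hom_id_assoc] }
    let _ : Localization.Lifting W.Q W (T ⋙ Γ) (derivedOfResolution W Γ hinv) :=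
      ⟨Localization.fac (T ⋙ Γ) hinv W.Q⟩
    refine ⟨Localization.liftNatTrans W.Q W (W.Q ⋙ G) (T ⋙ Γ) G
      (derivedOfResolution W Γ hinv) τ, ?_⟩
    ext X
    have h₁ := Localization.liftNatTrans_app W.Q W (W.Q ⋙ G) (T ⋙ Γ) G
      (derivedOfResolution W Γ hinv) τ X
    have h₂ := β.naturality (e.app X)
    change (Localization.liftNatTrans W.Q W (W.Q ⋙ G) (T ⋙ Γ) G
      (derivedOfResolution W Γ hinv) τ).app (W.Q.obj X) ≫ α.app X = β.app X
    rw [h₁, hα]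
    change (𝟙 _ ≫ (inv (G.map (W.Q.map (e.app X))) ≫ β.app (T.obj X)) ≫
      (Localization.fac (T ⋙ Γ) hinv W.Q).inv.app X) ≫
      (Localization.fac (T ⋙ Γ) hinv W.Q).hom.app X ≫ Γ.map (e.app X) = _
    rw [Category.id_comp, Category.assoc, Iso.inv_hom_id_app_assoc, Category.assoc]
    dsimp at h₂ ⊢
    rw [← h₂, IsIso.inv_hom_id_assoc]
  refine (Functor.isLeftDerivedFunctor_iff_isRightKanExtension _ _ _).2 ⟨⟨?_⟩⟩
  choose lift hlift using exist
  exact IsTerminal.ofUniqueHom (fun G => CostructuredArrow.homMk (lift _ G.hom) (hlift _ G.hom))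
    fun G γ => CostructuredArrow.hom_ext _ _
      (uniq _ _ _ ((CostructuredArrow.w γ).trans (hlift _ G.hom).symm))

include hW hinv in
theorem hasLeftDerivedFunctor_of_resolution (hT : ∀ X, IsIso (Γ.map (e.app (T.obj X)))) :
    Γ.HasLeftDerivedFunctor W :=
  have := isLeftDerivedFunctor_of_resolution W e hW Γ hinv hT
  HasLeftDerivedFunctor.mk' (derivedOfResolution W Γ hinv)
    (derivedOfResolutionCounit W e Γ hinv)

include hW hinv in
-- Derived functors are unique, so it suffices to consider `derivedOfResolution`, whose counit is an
-- isomorphism followed by `Γ.map (e.app X)`.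
theorem isIso_counit_app_iff (hT : ∀ X, IsIso (Γ.map (e.app (T.obj X))))
    (LΓ : W.Localization ⥤ ℋ) (α : W.Q ⋙ LΓ ⟶ Γ) [LΓ.IsLeftDerivedFunctor α W] (X : 𝒞) :
    IsIso (α.app X) ↔ IsIso (Γ.map (e.app X)) := by
  have := isLeftDerivedFunctor_of_resolution W e hW Γ hinv hT
  let φ := leftDerivedUnique (derivedOfResolution W Γ hinv) LΓ α
    (derivedOfResolutionCounit W e Γ hinv) W
  have hφ : φ.hom.app (W.Q.obj X) ≫ (derivedOfResolutionCounit W e Γ hinv).app X = α.app X := by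
    simp [φ]
  rw [← hφ, isIso_comp_left_iff]
  exact isIso_comp_left_iff ((Localization.fac (T ⋙ Γ) hinv W.Q).hom.app X) (Γ.map (e.app X))

end LeftDerivedFunctors

/-! ### Quasi-isomorphisms are detected in D⁻ -/

section Minus

variable {A : Type u} [Category.{v} A] [Abelian A]

theorem DMinus.isIso_Q_map {K L : ComplexMinus A} (f : K ⟶ L) [QuasiIso f.hom] :
    IsIso ((DMinus.Q A).map f) :=
  Localization.inverts (DMinus.Q A) (quasiIsoMinus A) f ‹_›

/-- Homology in each degree inverts quasi-isomorphisms and hence factors through the localization.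
-/
theorem DMinus.quasiIso_of_isIso {K L : ComplexMinus A} (f : K ⟶ L)
    [IsIso ((DMinus.Q A).map f)] : QuasiIso f.hom := by
  rw [quasiIso_iff]
  intro n
  rw [quasiIsoAt_iff_isIso_homologyMap]
  let H : ComplexMinus A ⥤ A := (minusProperty A).ι ⋙ HomologicalComplex.homologyFunctor A _ n
  have hH : (quasiIsoMinus A).IsInvertedBy H := fun K L g (hg : QuasiIso g.hom) =>
    (quasiIsoAt_iff_isIso_homologyMap g.hom n).1 inferInstance
  have : IsIso ((DMinus.Q A ⋙ Localization.lift H hH (DMinus.Q A)).map f) :=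
    inferInstanceAs (IsIso ((Localization.lift H hH (DMinus.Q A)).map ((DMinus.Q A).map f)))
  exact (NatIso.isIso_map_iff (Localization.fac H hH (DMinus.Q A)) f).1 this

theorem DMinus.isIso_Q_map_iff {K L : ComplexMinus A} (f : K ⟶ L) :
    IsIso ((DMinus.Q A).map f) ↔ QuasiIso f.hom :=
  ⟨fun _ => DMinus.quasiIso_of_isIso f, fun _ => DMinus.isIso_Q_map f⟩

end Minus

/-! ### Exactness of a single row -/

namespace TotalDecomp

variable {B : Type u'} [Category.{v'} B] [Abelian B] {Y : ℤ → ℕ → B}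
    {dv : ∀ i i' a, Y i a ⟶ Y i' a} {dh : ∀ i a a', Y i a ⟶ Y i a'}
    {T : CochainComplex B ℤ} (D : TotalDecomp Y dv dh T)

include D in
/-- If a total complex concentrated in one row is quasi-isomorphic to a complex concentrated in
degree `0`, then the row is exact. -/
theorem exact_of_quasiIso {L : CochainComplex B ℤ} (φ : T ⟶ L) (hφ : QuasiIso φ)
    (hY : ∀ i a, i ≠ 0 → IsZero (Y i a)) (hL : ∀ i, i ≠ 0 → IsZero (L.X i)) (a : ℕ) ⦃X : B⦄
    (x : X ⟶ Y 0 (a + 1)) (hx : x ≫ dh 0 (a + 1) a = 0) :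
    ∃ (X' : B) (p : X' ⟶ X) (_ : Epi p) (u : X' ⟶ Y 0 (a + 2)),
      p ≫ x = u ≫ dh 0 (a + 2) (a + 1) := by
  -- The total degree of the position (0, a + 1). It is nonzero, so L vanishes there and (x, 0) is a
  -- cycle of the cone.
  let n : ℤ := 0 - (a + 1 : ℕ)
  obtain ⟨X', p, hp, u, v, hu, -⟩ := (quasiIso_iff_up_to_refinements _).1 hφ (n - 1 - 1) (n - 1) n
    (n + 1) (by omega) (by omega) (by omega) (x ≫ D.inj 0 (a + 1) n rfl) 0 (by
      refine D.eq_zero _ fun i b hi => ?_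
      by_cases hi' : i = 0
      · subst hi'
        obtain rfl : b = a := by omega
        rw [Category.assoc, Category.assoc, D.inj_d_prj_succ 0 b n (n + 1) rfl (by omega),
          Linear.comp_units_smul, hx, smul_zero]
      · exact (hY i b hi').eq_of_tgt _ _) ((hL n (by omega)).eq_of_tgt _ _)
  have hu' := hu =≫ D.prj 0 (a + 1) n rfl
  rw [Category.assoc, Category.assoc, D.inj_prj, Category.comp_id, Category.assoc,
    D.d_prj (0 - 1) 0 (a + 1) (n - 1) n (by omega) (by omega) rfl,
    (hY (0 - 1) _ (by omega)).eq_of_src (dv _ _ _) 0, comp_zero, zero_add] at hu'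
  refine ⟨X', p, hp, (0 : ℤ).negOnePow • u ≫ D.prj 0 (a + 2) (n - 1) (by push_cast; omega), ?_⟩
  rw [hu', Linear.comp_units_smul, Linear.units_smul_comp, Category.assoc]

end TotalDecomp

/-! ### Resolutions by iterated kernels -/

/-- An exact functor `F` with a natural epimorphism `π` to the identity functor, which splits on the
values of `F`. Iterating the kernel of `π` yields functorial resolutions. -/
structure ResolutionData (A : Type u) [Category.{v} A] [Abelian A] where
  F : A ⥤ A
  π : F ⟶ 𝟭 A
  [additive : F.Additive]
  [preservesHomology : F.PreservesHomology]
  [epi : ∀ E, Epi (π.app E)]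
  split : ∀ E, IsSplitEpi (π.app (F.obj E))

namespace ResolutionData

attribute [instance] additive preservesHomology epi

variable {A : Type u} [Category.{v} A] [Abelian A] (P : ResolutionData A)

/-- The kernel of `π`. -/
noncomputable def R : A ⥤ A where
  obj E := kernel (P.π.app E)
  map f := kernel.map _ _ (P.F.map f) f (P.π.naturality f).symm
  map_id E := by rw [← cancel_mono (kernel.ι _)]; simp
  map_comp f g := by rw [← cancel_mono (kernel.ι _)]; simp

/-- The inclusion of the kernel of `π`. -/
noncomputable def ι : P.R ⟶ P.F where
  app E := kernel.ι (P.π.app E)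
  naturality E E' f := by simp [R]

instance (E : A) : Mono (P.ι.app E) := inferInstanceAs (Mono (kernel.ι _))

@[simp]
theorem ι_π (E : A) : P.ι.app E ≫ P.π.app E = 0 := kernel.condition _

@[simp]
theorem ι_π_assoc (E : A) {X : A} (h : E ⟶ X) : P.ι.app E ≫ P.π.app E ≫ h = 0 := by
  rw [← Category.assoc, ι_π, zero_comp]

instance : P.R.Additive where
  map_add {X Y f g} := by
    rw [← cancel_mono (P.ι.app _), NatTrans.naturality, Preadditive.add_comp, NatTrans.naturality,
      NatTrans.naturality, P.F.map_add, Preadditive.comp_add]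

theorem exists_lift {E X : A} (x : X ⟶ P.F.obj E) (hx : x ≫ P.π.app E = 0) :
    ∃ y : X ⟶ P.R.obj E, y ≫ P.ι.app E = x :=
  ⟨kernel.lift _ x hx, kernel.lift_ι _ _ _⟩

/-- The iterates of `R`. -/
noncomputable def syz : ℕ → A ⥤ A
  | 0 => 𝟭 A
  | a + 1 => syz a ⋙ P.R

instance additive_syz (a : ℕ) : (P.syz a).Additive := by
  induction a with
  | zero => exact inferInstanceAs (𝟭 A).Additive
  | succ a ih => exact inferInstanceAs (P.syz a ⋙ P.R).Additive

/-- The differential of the resolution. -/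
noncomputable def dRes : P.R ⋙ P.F ⟶ P.F where
  app E := P.π.app (P.R.obj E) ≫ P.ι.app E
  naturality E E' f := by
    have h₁ := P.π.naturality (P.R.map f)
    have h₂ := P.ι.naturality f
    dsimp at h₁ ⊢
    rw [reassoc_of% h₁, h₂, Category.assoc]

theorem dRes_app (E : A) : P.dRes.app E = P.π.app (P.R.obj E) ≫ P.ι.app E := rfl

theorem dRes_dRes (E : A) : P.dRes.app (P.R.obj E) ≫ P.dRes.app E = 0 := by
  rw [dRes_app, dRes_app, Category.assoc, ι_π_assoc, comp_zero]

/-- The resolution of an object by values of `F`. -/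
noncomputable def resObj (E : A) : ChainComplex A ℕ :=
  ChainComplex.of (fun a => P.F.obj ((P.syz a).obj E))
    (fun a => P.dRes.app ((P.syz a).obj E)) (fun a => P.dRes_dRes ((P.syz a).obj E))

theorem resObj_d (E : A) (a : ℕ) :
    (P.resObj E).d (a + 1) a = P.dRes.app ((P.syz a).obj E) :=
  ChainComplex.of_d (fun a => P.F.obj ((P.syz a).obj E))
    (fun a => P.dRes.app ((P.syz a).obj E)) a

/-- The functorial resolution of an object by values of `F`. -/
noncomputable def res : A ⥤ ChainComplex A ℕ where
  obj := P.resObj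
  map {E E'} f := ChainComplex.ofHom (X := P.resObj E) (Y := P.resObj E')
    (fun a => P.F.map ((P.syz a).map f)) (fun a => by
      rw [resObj_d, resObj_d]
      exact P.dRes.naturality ((P.syz a).map f))
  map_id E := by
    ext a
    exact (congrArg P.F.map ((P.syz a).map_id E)).trans (P.F.map_id _)
  map_comp f g := by
    ext a
    exact (congrArg P.F.map ((P.syz a).map_comp f g)).trans (P.F.map_comp _ _)

theorem res_d (E : A) (a : ℕ) :
    (P.res.obj E).d (a + 1) a = P.dRes.app ((P.syz a).obj E) := P.resObj_d E a

theorem isZero_res_X {E : A} (hE : IsZero E) (a : ℕ) : IsZero ((P.res.obj E).X a) :=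
  P.F.map_isZero ((P.syz a).map_isZero hE)

instance : P.res.Additive where
  map_add {X Y f g} := by
    ext a
    exact (congrArg P.F.map ((P.syz a).map_add)).trans P.F.map_add

section QuasiIso

/-- In the natural short exact sequence 0 → R → F → id → 0 the cones of F f and of f are exact,
hence so is the cone of R f. The chase solves the problem in F and corrects the solution by means of
the exactness of the cone of f, one degree lower. -/
theorem quasiIso_mapR {K L : CochainComplex A ℤ} (f : K ⟶ L) [QuasiIso f] :
    QuasiIso ((P.R.mapHomologicalComplex (ComplexShape.up ℤ)).map f) := by
  have hf := (quasiIso_iff_up_to_refinements f).1 inferInstance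
  have hF := (quasiIso_iff_up_to_refinements
    ((P.F.mapHomologicalComplex (ComplexShape.up ℤ)).map f)).1
      (HomologicalComplex.quasiIso_map_of_preservesHomology f P.F)
  have nπ {X Y : A} (g : X ⟶ Y) : P.F.map g ≫ P.π.app Y = P.π.app X ≫ g := P.π.naturality g
  have nι {X Y : A} (g : X ⟶ Y) : P.R.map g ≫ P.ι.app Y = P.ι.app X ≫ P.F.map g :=
    P.ι.naturality g
  refine (quasiIso_iff_up_to_refinements _).2 ?_
  intro m n n' n'' hm hn hn' X (x : X ⟶ P.R.obj (K.X n')) (y : X ⟶ P.R.obj (L.X n))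
    (hx : x ≫ P.R.map (K.d n' n'') = 0)
    (hxy : x ≫ P.R.map (f.f n') = y ≫ P.R.map (L.d n n'))
  obtain ⟨A₁, π₁, _, u, v, hu, hv⟩ : ∃ (A' : A) (π : A' ⟶ X) (_ : Epi π)
      (u : A' ⟶ P.F.obj (K.X n)) (v : A' ⟶ P.F.obj (L.X m)),
      π ≫ x ≫ P.ι.app _ = u ≫ P.F.map (K.d n n') ∧
        π ≫ y ≫ P.ι.app _ = u ≫ P.F.map (f.f n) + v ≫ P.F.map (L.d m n) := by
    refine hF m n n' n'' hm hn hn' (x ≫ P.ι.app _) (y ≫ P.ι.app _) ?_ ?_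
    · change (x ≫ P.ι.app _) ≫ P.F.map (K.d n' n'') = 0
      rw [Category.assoc, ← nι, reassoc_of% hx, zero_comp]
    · change (x ≫ P.ι.app _) ≫ P.F.map (f.f n') = (y ≫ P.ι.app _) ≫ P.F.map (L.d n n')
      rw [Category.assoc, ← nι, reassoc_of% hxy, Category.assoc, nι]
  have hv' := hv =≫ P.π.app _
  have hu' := hu =≫ P.π.app _
  simp only [Category.assoc, ι_π, comp_zero, Preadditive.add_comp, nπ] at hv' hu'
  -- The pair (u, v) need not lie in R. Its image under π is, up to sign, a cycle of the cone of f,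
  -- hence the boundary of some (u', v'). Lifting u' and v' to F through π and removing their
  -- boundary moves (u, v) into the kernel of π.
  obtain ⟨A₂, π₂, _, u', v', hu₂, hv₂⟩ := hf (m - 1) m n n' (by omega) hm hn
    (u ≫ P.π.app (K.X n)) (-(v ≫ P.π.app (L.X m))) (by
      rw [Category.assoc]; exact hu'.symm) (by
      rw [Preadditive.neg_comp, Category.assoc, Category.assoc]
      exact eq_neg_of_add_eq_zero_left hv'.symm)
  obtain ⟨A₃, π₃, _, ut, hut⟩ := surjective_up_to_refinements_of_epi (P.π.app (K.X m)) u'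
  obtain ⟨A₄, π₄, _, vt, hvt⟩ := surjective_up_to_refinements_of_epi (P.π.app (L.X (m - 1)))
    (π₃ ≫ v')
  obtain ⟨U, hU⟩ := P.exists_lift
    ((π₄ ≫ π₃ ≫ π₂ ≫ u) - π₄ ≫ ut ≫ P.F.map (K.d m n)) (by
      dsimp at hut
      simp only [Preadditive.sub_comp, Category.assoc, nπ]
      rw [← reassoc_of% hut, ← hu₂, sub_self])
  obtain ⟨V, hV⟩ := P.exists_lift
    ((π₄ ≫ π₃ ≫ π₂ ≫ v) + π₄ ≫ ut ≫ P.F.map (f.f m) + vt ≫ P.F.map (L.d (m - 1) m)) (by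
      dsimp at hut hvt
      simp only [Preadditive.add_comp, Category.assoc, nπ]
      rw [← reassoc_of% hut, ← reassoc_of% hvt, add_assoc, ← Preadditive.comp_add,
        ← Preadditive.comp_add, ← Preadditive.comp_add, ← hv₂]
      simp)
  refine ⟨A₄, π₄ ≫ π₃ ≫ π₂ ≫ π₁, inferInstance, U, V, ?_, ?_⟩
  · change (π₄ ≫ π₃ ≫ π₂ ≫ π₁) ≫ x = U ≫ P.R.map (K.d n n')
    rw [← cancel_mono (P.ι.app _), Category.assoc U, nι, reassoc_of% hU]
    simp only [Preadditive.sub_comp, Category.assoc, ← P.F.map_comp, K.d_comp_d, hu]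
    simp
  · change (π₄ ≫ π₃ ≫ π₂ ≫ π₁) ≫ y = U ≫ P.R.map (f.f n) + V ≫ P.R.map (L.d m n)
    rw [← cancel_mono (P.ι.app _), Preadditive.add_comp, Category.assoc U, nι, reassoc_of% hU,
      Category.assoc V, nι, reassoc_of% hV]
    simp only [Preadditive.sub_comp, Preadditive.add_comp, Preadditive.comp_add, Category.assoc,
      ← P.F.map_comp, L.d_comp_d, hv, f.comm]
    simp

theorem quasiIso_map_syz {K L : CochainComplex A ℤ} (f : K ⟶ L) [hf : QuasiIso f] (a : ℕ) :
    QuasiIso (((P.syz a).mapHomologicalComplex (ComplexShape.up ℤ)).map f) := by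
  induction a with
  | zero =>
    rw [quasiIso_iff_up_to_refinements] at hf ⊢
    exact hf
  | succ a ih => exact P.quasiIso_mapR (((P.syz a).mapHomologicalComplex _).map f)

end QuasiIso

section Total

theorem exists_isZero (K : ComplexMinus A) : ∃ N : ℤ, ∀ i, N < i → IsZero (K.obj.X i) := by
  obtain ⟨N, hN⟩ := K.2
  exact ⟨N, fun i hi => K.obj.isZero_of_isStrictlyLE N i hi⟩

variable [HasCoproducts.{0} A]

/-- The bicomplex obtained by resolving the terms of a complex. -/
noncomputable def bicomplex : ComplexMinus A ⥤
    HomologicalComplex₂ A (ComplexShape.up ℤ) (ComplexShape.down ℕ) :=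
  (minusProperty A).ι ⋙ P.res.mapHomologicalComplex (ComplexShape.up ℤ)

instance (K : HomologicalComplex₂ A (ComplexShape.up ℤ) (ComplexShape.down ℕ)) :
    K.HasTotal (ComplexShape.up ℤ) := fun _ => inferInstance

/-- The components of the total complex of the resolution of a complex. -/
noncomputable def decomp (K : ComplexMinus A) :
    TotalDecomp (fun i a => P.F.obj ((P.syz a).obj (K.obj.X i)))
      (fun i i' a => P.F.map ((P.syz a).map (K.obj.d i i')))
      (fun i a a' => (P.res.obj (K.obj.X i)).d a a')
      ((P.bicomplex.obj K).total (ComplexShape.up ℤ)) :=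
  TotalDecomp.ofBicomplex (P.bicomplex.obj K) (exists_isZero K).choose fun i hi a =>
    P.isZero_res_X ((exists_isZero K).choose_spec i hi) a

/-- The total complex of the resolution of a complex bounded from above. -/
noncomputable def T : ComplexMinus A ⥤ ComplexMinus A :=
  (minusProperty A).lift (P.bicomplex ⋙ HomologicalComplex₂.totalFunctor A
    (ComplexShape.up ℤ) (ComplexShape.down ℕ) (ComplexShape.up ℤ)) fun K => by
      obtain ⟨N, hN⟩ := exists_isZero K
      refine ⟨N, ?_⟩
      rw [CochainComplex.isStrictlyLE_iff]
      intro n hn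
      rw [IsZero.iff_id_eq_zero]
      exact (P.decomp K).eq_zero _ fun i a h =>
        (P.F.map_isZero ((P.syz a).map_isZero (hN i (by omega)))).eq_of_tgt _ _

theorem T_map_prj {K L : ComplexMinus A} (f : K ⟶ L) (i : ℤ) (a : ℕ) (n : ℤ) (h : i - a = n) :
    (P.T.map f).hom.f n ≫ (P.decomp L).prj i a n h =
      (P.decomp K).prj i a n h ≫ P.F.map ((P.syz a).map (f.hom.f i)) := by
  refine HomologicalComplex₂.total.hom_ext _ fun j b hj => ?_
  have e := HomologicalComplex₂.ιTotal_map _ _ (P.bicomplex.map f) (ComplexShape.up ℤ) j b n hj =≫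
    (P.decomp L).prj i a n h
  rw [Category.assoc, Category.assoc] at e
  refine e.trans ?_
  have hj' : j - (b : ℤ) = n := hj
  by_cases hb : b = a
  · subst hb
    obtain rfl : j = i := by omega
    have e₁ := TotalDecomp.ι_totalPrj (P.bicomplex.obj K) j b n h
    have e₂ := TotalDecomp.ι_totalPrj (P.bicomplex.obj L) j b n h
    exact ((((P.bicomplex.map f).f j).f b) ≫= e₂).trans
      ((Category.comp_id _).trans ((Category.id_comp _).symm.trans ((e₁.symm =≫ _).trans
        (Category.assoc _ _ _))))
  · have e₁ := TotalDecomp.ι_totalPrj_ne (P.bicomplex.obj K) j i b a n hj h hb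
    have e₂ := TotalDecomp.ι_totalPrj_ne (P.bicomplex.obj L) j i b a n hj h hb
    exact ((((P.bicomplex.map f).f j).f b) ≫= e₂).trans
      (comp_zero.trans (zero_comp.symm.trans ((e₁.symm =≫ _).trans
        (Category.assoc _ _ _))))

omit [Abelian A] [HasCoproducts.{0} A] in
-- The calculation behind the compatibility of `aug` with differentials: the vertical part of the
-- total differential passes through π by naturality, and the horizontal part dies under π.
theorem comm_of_d_prj [Preadditive A] {X X' Y Y' Y'' Z Z' : A} {d : X ⟶ X'} {p' : X' ⟶ Y'}
    {p : X ⟶ Y} {m : Y ⟶ Y'} {ε : ℤˣ} {r : X ⟶ Y''} {h : Y'' ⟶ Y'} {q : Y ⟶ Z} {q' : Y' ⟶ Z'}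
    {d' : Z ⟶ Z'} (e : d ≫ p' = p ≫ m + ε • r ≫ h) (e' : m ≫ q' = q ≫ d') (e'' : h ≫ q' = 0) :
    (p ≫ q) ≫ d' = d ≫ p' ≫ q' := by
  rw [reassoc_of% e, Preadditive.add_comp, Linear.units_smul_comp, Category.assoc, Category.assoc,
    Category.assoc, e', e'', comp_zero, smul_zero, add_zero]

/-- The augmentation of the resolution of a complex. -/
noncomputable def aug : P.T ⟶ 𝟭 (ComplexMinus A) where
  app K := ObjectProperty.homMk
    { f := fun n => (P.decomp K).prj n 0 n (by simp) ≫ P.π.app (K.obj.X n)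
      comm' := fun n n' (hn : n + 1 = n') => by
        have e := (P.decomp K).d_prj n n' 0 n n' hn (by simp) (by simp)
        have e₀ := P.resObj_d (K.obj.X n') 0
        have e₁ : (P.resObj (K.obj.X n')).d 1 0 ≫ P.π.app (K.obj.X n') = 0 :=
          (e₀ =≫ _).trans ((Category.assoc _ _ _).trans
            ((P.π.app _ ≫= P.ι_π _).trans comp_zero))
        have e₂ : P.F.map (K.obj.d n n') ≫ P.π.app (K.obj.X n') =
          P.π.app (K.obj.X n) ≫ K.obj.d n n' := P.π.naturality (K.obj.d n n')
        exact comm_of_d_prj e e₂ e₁ }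
  naturality K L f := by
    ext n
    have e := P.T_map_prj f n 0 n (by simp) =≫ P.π.app (L.obj.X n)
    have e₂ : P.F.map (f.hom.f n) ≫ P.π.app (L.obj.X n) = P.π.app (K.obj.X n) ≫ f.hom.f n :=
      P.π.naturality (f.hom.f n)
    exact (Category.assoc _ _ _).symm.trans (e.trans ((Category.assoc _ _ _).trans
      (((P.decomp K).prj n 0 n (by simp) ≫= e₂).trans (Category.assoc _ _ _).symm)))

theorem aug_f (K : ComplexMinus A) (n : ℤ) (h : n - (0 : ℕ) = n) :
    (P.aug.app K).hom.f n = (P.decomp K).prj n 0 n h ≫ P.π.app (K.obj.X n) := rfl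

variable {B : Type u'} [Category.{v'} B] [Abelian B] (G : A ⥤ B) [G.Additive]

/-- The components of `G (T K)`. -/
noncomputable def decompMap (K : ComplexMinus A) :
    TotalDecomp (fun i a => G.obj (P.F.obj ((P.syz a).obj (K.obj.X i))))
      (fun i i' a => G.map (P.F.map ((P.syz a).map (K.obj.d i i'))))
      (fun i a a' => G.map ((P.res.obj (K.obj.X i)).d a a'))
      ((P.T ⋙ ComplexMinus.map G).obj K).obj :=
  (P.decomp K).map G

/-- Column a is the composite of F and G applied to `P.syz a`. Syzygies preserve quasi-isomorphisms,
and `P.F ⋙ G` is exact even if G is not. -/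
theorem quasiIso_map_T [(P.F ⋙ G).PreservesHomology] {K L : ComplexMinus A} (f : K ⟶ L)
    [QuasiIso f.hom] : QuasiIso ((P.T ⋙ ComplexMinus.map G).map f).hom := by
  refine TotalDecomp.quasiIso_of_columns (P.decompMap G K) (P.decompMap G L) _
    (fun i a => G.map (P.F.map ((P.syz a).map (f.hom.f i)))) ?_ ?_
  · intro i a n h
    exact (G.map_comp _ _).symm.trans ((congrArg G.map (P.T_map_prj f i a n h)).trans
      (G.map_comp _ _))
  · intro a
    have := P.quasiIso_map_syz f.hom a
    exact (quasiIso_iff_up_to_refinements _).1 (HomologicalComplex.quasiIso_map_of_preservesHomology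
      (((P.syz a).mapHomologicalComplex (ComplexShape.up ℤ)).map f.hom) (P.F ⋙ G))

/-- The condition that `G` maps the resolution of an object to an exact complex. -/
def RowAcyclic (E : A) : Prop := ∀ a, Mono (G.map (P.ι.app ((P.syz a).obj E)))

omit [HasCoproducts.{0} A] in
-- Right exactness of G: G (R E) → G (F E) → G E is exact in the middle, and G (F (R E)) → G (R E)
-- is an epimorphism.
theorem exists_lift_of_comp_map_π [PreservesFiniteColimits G] {E : A} ⦃X : B⦄
    (x : X ⟶ G.obj (P.F.obj E)) (hx : x ≫ G.map (P.π.app E) = 0) :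
    ∃ (X' : B) (p : X' ⟶ X) (_ : Epi p) (u : X' ⟶ G.obj (P.F.obj (P.R.obj E))),
      p ≫ x = u ≫ G.map (P.dRes.app E) := by
  let S : ShortComplex A := ShortComplex.mk (P.ι.app E) (P.π.app E) (P.ι_π E)
  have hS : S.Exact := S.exact_of_f_is_kernel (kernelIsKernel (P.π.app E))
  have hGS : (S.map G).Exact := by
    have : Epi S.g := inferInstanceAs (Epi (P.π.app E))
    exact hS.map_of_epi_of_preservesCokernel G this inferInstance
  obtain ⟨X₁, p₁, _, u₁, hu₁⟩ := hGS.exact_up_to_refinements x hx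
  obtain ⟨X₂, p₂, _, u₂, hu₂⟩ := surjective_up_to_refinements_of_epi
    (G.map (P.π.app (P.R.obj E))) u₁
  refine ⟨X₂, p₂ ≫ p₁, inferInstance, u₂, ?_⟩
  rw [dRes_app, G.map_comp, ← reassoc_of% hu₂, Category.assoc]
  exact (p₂ ≫= hu₁).trans (Category.assoc _ _ _).symm

omit [HasCoproducts.{0} A] in
theorem exists_lift_of_comp_map_dRes [PreservesFiniteColimits G] {E : A}
    [Mono (G.map (P.ι.app E))] ⦃X : B⦄ (x : X ⟶ G.obj (P.F.obj (P.R.obj E)))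
    (hx : x ≫ G.map (P.dRes.app E) = 0) :
    ∃ (X' : B) (p : X' ⟶ X) (_ : Epi p) (u : X' ⟶ G.obj (P.F.obj (P.R.obj (P.R.obj E)))),
      p ≫ x = u ≫ G.map (P.dRes.app (P.R.obj E)) := by
  rw [dRes_app, G.map_comp, ← Category.assoc] at hx
  exact P.exists_lift_of_comp_map_π G x (zero_of_comp_mono _ hx)

omit [HasCoproducts.{0} A] in
-- An element killed by G (ι) lifts along G (π) to a cycle of the row. By exactness this cycle is a
-- boundary, and boundaries are killed by G (π) because ι followed by π is zero.
theorem mono_map_ι [PreservesFiniteColimits G] {E : A}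
    (h : ∀ ⦃X : B⦄ (x : X ⟶ G.obj (P.F.obj (P.R.obj E))), x ≫ G.map (P.dRes.app E) = 0 →
      ∃ (X' : B) (p : X' ⟶ X) (_ : Epi p) (u : X' ⟶ G.obj (P.F.obj (P.R.obj (P.R.obj E)))),
        p ≫ x = u ≫ G.map (P.dRes.app (P.R.obj E))) :
    Mono (G.map (P.ι.app E)) := by
  refine Preadditive.mono_of_cancel_zero _ fun {X} x hx => ?_
  obtain ⟨X₁, p₁, _, x₁, hx₁⟩ := surjective_up_to_refinements_of_epi (G.map (P.π.app (P.R.obj E))) x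
  obtain ⟨X₂, p₂, _, u, hu⟩ := h x₁ (by rw [dRes_app, G.map_comp, ← reassoc_of% hx₁, hx, comp_zero])
  have : Epi (p₂ ≫ p₁) := inferInstance
  rw [← cancel_epi (p₂ ≫ p₁), comp_zero, Category.assoc, hx₁, reassoc_of% hu, ← G.map_comp,
    dRes_app, Category.assoc, ι_π, comp_zero, G.map_zero, comp_zero]

theorem quasiIso_map_aug [PreservesFiniteColimits G] (L : ComplexMinus A)
    (hL : ∀ i, P.RowAcyclic G (L.obj.X i)) :
    QuasiIso ((ComplexMinus.map G).map (P.aug.app L)).hom := by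
  have hd (E : A) (a : ℕ) : G.map ((P.res.obj E).d (a + 1) a) =
    G.map (P.dRes.app ((P.syz a).obj E)) := congrArg G.map (P.res_d E a)
  refine TotalDecomp.quasiIso_of_rows (P.decompMap G L) _
    (fun i => G.map (P.π.app (L.obj.X i))) ?_ ?_ ?_ ?_
  · intro n h
    exact (congrArg G.map (P.aug_f L n h)).trans (G.map_comp _ _)
  · intro i
    exact G.map_epi (P.π.app (L.obj.X i))
  · intro i X x hx
    obtain ⟨X', p, hp, u, hu⟩ := P.exists_lift_of_comp_map_π G x hx
    exact ⟨X', p, hp, u, hu.trans (u ≫= (hd (L.obj.X i) 0).symm)⟩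
  · intro i a X x hx
    have := hL i a
    obtain ⟨X', p, hp, u, hu⟩ := P.exists_lift_of_comp_map_dRes G
      (E := (P.syz a).obj (L.obj.X i)) x ((x ≫= (hd _ a).symm).trans hx)
    exact ⟨X', p, hp, u, hu.trans (u ≫= (hd (L.obj.X i) (a + 1)).symm)⟩

/-- When the complex has one term, the total complex is a single row. This gives the converse of
`quasiIso_map_aug`, which passes from a statement about homology to a condition stable under
coproducts. -/
theorem rowAcyclic_of_quasiIso [PreservesFiniteColimits G] (L : ComplexMinus A)
    (hL : ∀ i, i ≠ 0 → IsZero (L.obj.X i))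
    (h : QuasiIso ((ComplexMinus.map G).map (P.aug.app L)).hom) :
    P.RowAcyclic G (L.obj.X 0) := by
  have hd (E : A) (a : ℕ) : G.map ((P.res.obj E).d (a + 1) a) =
    G.map (P.dRes.app ((P.syz a).obj E)) := congrArg G.map (P.res_d E a)
  refine fun a => P.mono_map_ι G fun X x hx => ?_
  obtain ⟨X', p, hp, u, hu⟩ := (P.decompMap G L).exact_of_quasiIso _ h
    (fun i b hi => G.map_isZero (P.F.map_isZero ((P.syz b).map_isZero (hL i hi))))
    (fun i hi => G.map_isZero (hL i hi)) a x ((x ≫= hd _ a).trans hx)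
  exact ⟨X', p, hp, u, hu.trans (u ≫= hd _ (a + 1))⟩

omit [HasCoproducts.{0} A]

/-- An object is relatively projective if `π` splits over it. -/
def RelProj (E : A) : Prop := IsSplitEpi (P.π.app E)

variable {P} in
theorem RelProj.of_retract {E E' : A} (hE : P.RelProj E) (i : E' ⟶ E) (r : E ⟶ E')
    (h : i ≫ r = 𝟙 E') : P.RelProj E' := by
  have : IsSplitEpi (P.π.app E) := hE
  have e : P.F.map r ≫ P.π.app E' = P.π.app E ≫ r := P.π.naturality r
  refine ⟨⟨i ≫ section_ (P.π.app E) ≫ P.F.map r, ?_⟩⟩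
  rw [Category.assoc, Category.assoc, e, IsSplitEpi.id_assoc, h]
  rfl

theorem relProj_F (E : A) : P.RelProj (P.F.obj E) := P.split E

variable {P} in
theorem RelProj.exists_retraction {E : A} (hE : P.RelProj E) :
    ∃ r : P.F.obj E ⟶ P.R.obj E, P.ι.app E ≫ r = 𝟙 _ := by
  have : IsSplitEpi (P.π.app E) := hE
  obtain ⟨r, hr⟩ := P.exists_lift (𝟙 _ - P.π.app E ≫ section_ (P.π.app E)) (by simp)
  refine ⟨r, ?_⟩
  rw [← cancel_mono (P.ι.app E), Category.assoc, hr]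
  simp

variable {P} in
-- If π splits over E, then R E is a retract of F E, and values of F are relatively projective.
theorem RelProj.syz {E : A} (hE : P.RelProj E) (a : ℕ) : P.RelProj ((P.syz a).obj E) := by
  induction a with
  | zero => exact hE
  | succ a ih =>
    obtain ⟨r, hr⟩ := ih.exists_retraction
    exact (P.relProj_F _).of_retract _ r hr

variable {P} in
omit [Abelian B] [G.Additive] in
-- Every ι involved is a split monomorphism, which any functor preserves.
theorem RelProj.rowAcyclic {E : A} (hE : P.RelProj E) : P.RowAcyclic G E := fun a => by
  obtain ⟨r, hr⟩ := (hE.syz a).exists_retraction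
  have : IsSplitMono (P.ι.app ((P.syz a).obj E)) := ⟨⟨⟨r, hr⟩⟩⟩
  infer_instance

variable {P} in
theorem RelProj.sigma {ι : Type} (E : ι → A) [HasCoproduct E] (hE : ∀ i, P.RelProj (E i)) :
    P.RelProj (∐ E) := by
  have (i : ι) : IsSplitEpi (P.π.app (E i)) := hE i
  refine ⟨⟨Sigma.desc fun i => section_ (P.π.app (E i)) ≫ P.F.map (Sigma.ι E i), ?_⟩⟩
  refine Sigma.hom_ext _ _ fun i => ?_
  have e : P.F.map (Sigma.ι E i) ≫ P.π.app (∐ E) = P.π.app (E i) ≫ Sigma.ι E i :=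
    P.π.naturality _
  rw [Sigma.ι_desc_assoc, Category.assoc, e, IsSplitEpi.id_assoc]
  exact (Category.comp_id _).symm

variable [HasCoproducts.{0} A]

/-- By construction, a term of the total complex is a coproduct of values of F. -/
theorem relProj_T (K : ComplexMinus A) (n : ℤ) : P.RelProj ((P.T.obj K).obj.X n) :=
  RelProj.sigma _ fun _ => P.relProj_F _

/-- The case G = 𝟭 of `quasiIso_map_aug`: there, row acyclicity only says that ι is a monomorphism.
-/
theorem quasiIso_aug (L : ComplexMinus A) : QuasiIso (P.aug.app L).hom := by
  have h := P.quasiIso_map_aug (𝟭 A) L fun i a =>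
    inferInstanceAs (Mono (P.ι.app ((P.syz a).obj (L.obj.X i))))
  rw [quasiIso_iff_up_to_refinements] at h ⊢
  exact h

section Derived

variable [(P.F ⋙ G).PreservesHomology]

theorem isInvertedBy : (quasiIsoMinus A).IsInvertedBy (P.T ⋙ ComplexMinus.map G ⋙ DMinus.Q B) :=
  fun _ _ f (_ : QuasiIso f.hom) =>
    have := P.quasiIso_map_T G f
    DMinus.isIso_Q_map ((P.T ⋙ ComplexMinus.map G).map f)

variable [PreservesFiniteColimits G]

omit [(P.F ⋙ G).PreservesHomology] in
theorem isIso_map_aug_T (K : ComplexMinus A) :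
    IsIso ((ComplexMinus.map G ⋙ DMinus.Q B).map (P.aug.app (P.T.obj K))) :=
  have := P.quasiIso_map_aug G (P.T.obj K) fun i => (P.relProj_T K i).rowAcyclic G
  DMinus.isIso_Q_map ((ComplexMinus.map G).map (P.aug.app (P.T.obj K)))

include P in
theorem hasLeftDerivedFunctor :
    (ComplexMinus.map G ⋙ DMinus.Q B).HasLeftDerivedFunctor (quasiIsoMinus A) :=
  hasLeftDerivedFunctor_of_resolution (quasiIsoMinus A) P.aug P.quasiIso_aug _ (P.isInvertedBy G)
    (P.isIso_map_aug_T G)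

variable (LG : DMinus A ⥤ DMinus B) (α : DMinus.Q A ⋙ LG ⟶ ComplexMinus.map G ⋙ DMinus.Q B)
  [LG.IsLeftDerivedFunctor α (quasiIsoMinus A)]

theorem isIso_counit_app_iff (L : ComplexMinus A) :
    IsIso (α.app L) ↔ QuasiIso ((ComplexMinus.map G).map (P.aug.app L)).hom :=
  (_root_.isIso_counit_app_iff (quasiIsoMinus A) P.aug P.quasiIso_aug _ (P.isInvertedBy G)
    (P.isIso_map_aug_T G) LG α L).trans
      (DMinus.isIso_Q_map_iff ((ComplexMinus.map G).map (P.aug.app L)))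

theorem isIso_counit_app (L : ComplexMinus A) (hL : ∀ i, P.RowAcyclic G (L.obj.X i)) :
    IsIso (α.app L) :=
  (P.isIso_counit_app_iff G LG α L).2 (P.quasiIso_map_aug G L hL)

theorem rowAcyclic_of_isIso_counit_app (L : ComplexMinus A)
    (hL : ∀ i, i ≠ 0 → IsZero (L.obj.X i)) (h : IsIso (α.app L)) : P.RowAcyclic G (L.obj.X 0) :=
  P.rowAcyclic_of_quasiIso G L hL ((P.isIso_counit_app_iff G LG α L).1 h)

end Derived

end Total

end ResolutionData

/-! ### Coproducts of monomorphisms and of functors under AB4 -/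

section Coproducts

theorem mono_sigmaMap {C : Type u} [Category.{v} C] [HasCoproducts.{0} C] [AB4OfSize.{0} C]
    {S : Type} {X Y : S → C} (f : ∀ s, X s ⟶ Y s) [∀ s, Mono (f s)] : Mono (Limits.Sigma.map f) := by
  have : PreservesFiniteLimits (colim (J := Discrete S) (C := C)) :=
    HasExactColimitsOfShape.preservesFiniteLimits
  let φ : Discrete.functor X ⟶ Discrete.functor Y := Discrete.natTrans fun s => f s.as
  have : ∀ s, Mono (φ.app s) := fun s => inferInstanceAs (Mono (f s.as))
  have : Mono φ := NatTrans.mono_of_mono_app φ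
  exact inferInstanceAs (Mono (colim.map φ))

theorem mono_app_sigma {A : Type u} [Category.{v} A] {B : Type u'} [Category.{v'} B]
    [HasCoproducts.{0} A] [HasCoproducts.{0} B] [AB4OfSize.{0} B] {G G' : A ⥤ B} (τ : G ⟶ G')
    {S : Type} [PreservesColimitsOfShape (Discrete S) G] [PreservesColimitsOfShape (Discrete S) G']
    (E : S → A) [∀ s, Mono (τ.app (E s))] : Mono (τ.app (∐ E)) := by
  have e : sigmaComparison G E ≫ τ.app (∐ E) =
      Limits.Sigma.map (fun s => τ.app (E s)) ≫ sigmaComparison G' E := by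
    refine Sigma.hom_ext _ _ fun s => ?_
    simp
  have := mono_sigmaMap fun s => τ.app (E s)
  have e' : τ.app (∐ E) = inv (sigmaComparison G E) ≫ Limits.Sigma.map (fun s => τ.app (E s)) ≫
    sigmaComparison G' E := by rw [← e, IsIso.inv_hom_id_assoc]
  rw [e']
  infer_instance

variable {D : Type u'} [Category.{v'} D] {C : Type u} [Category.{v} C] [HasCoproducts.{0} C]

/-- The coproduct of a family of functors, defined objectwise. -/
noncomputable abbrev coproductFunctor {S : Type} (H : S → D ⥤ C) : D ⥤ C where
  obj E := ∐ fun s => (H s).obj E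
  map f := Limits.Sigma.map fun s => (H s).map f
  map_id E := Sigma.hom_ext _ _ fun s => by simp
  map_comp f g := Sigma.hom_ext _ _ fun s => by simp

/-- The coproduct of functors as a composition with a colimit functor. -/
noncomputable def coproductFunctorIso {S : Type} (H : S → D ⥤ C) :
    coproductFunctor H ≅ (Discrete.functor H).flip ⋙ colim :=
  NatIso.ofComponents
    (fun E => HasColimit.isoOfNatIso (Discrete.natIso fun _ => Iso.refl _))
    fun {E E'} f => Sigma.hom_ext _ _ fun s => by
      simp [coproductFunctor]

theorem preservesFiniteLimits_coproductFunctor [AB4OfSize.{0} C] {S : Type} (H : S → D ⥤ C)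
    [∀ s, PreservesFiniteLimits (H s)] : PreservesFiniteLimits (coproductFunctor H) := by
  have : PreservesFiniteLimits (colim (J := Discrete S) (C := C)) :=
    HasExactColimitsOfShape.preservesFiniteLimits
  have : PreservesFiniteLimits (Discrete.functor H).flip :=
    preservesFiniteLimits_of_evaluation _ fun s => inferInstanceAs (PreservesFiniteLimits (H s.as))
  exact preservesFiniteLimits_of_natIso (coproductFunctorIso H).symm

theorem preservesColimitsOfShape_coproductFunctor {S : Type} (H : S → D ⥤ C) (K : Type)
    [SmallCategory K] [∀ s, PreservesColimitsOfShape K (H s)] :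
    PreservesColimitsOfShape K (coproductFunctor H) := by
  have : PreservesColimitsOfShape K (Discrete.functor H).flip :=
    preservesColimitsOfShape_of_evaluation _ _ fun s =>
      inferInstanceAs (PreservesColimitsOfShape K (H s.as))
  exact preservesColimitsOfShape_of_natIso (coproductFunctorIso H).symm

end Coproducts

/-! ### Acyclic objects are stable under coproducts -/

namespace ResolutionData

variable {A : Type u} [Category.{v} A] [Abelian A] (P : ResolutionData A)
  [HasCoproducts.{0} A] [AB4OfSize.{0} A] {S : Type}

/-- By AB4, ∐ R E is the kernel of ∐ F E → ∐ E. Since F commutes with coproducts, R (∐ E) is the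
kernel of the same morphism. -/
theorem preservesColimitsOfShape_R [PreservesColimitsOfShape (Discrete S) P.F] :
    PreservesColimitsOfShape (Discrete S) P.R := by
  have key (E : S → A) : IsIso (sigmaComparison P.R E) := by
    have hι : Mono (Limits.Sigma.map fun s => P.ι.app (E s)) := mono_sigmaMap _
    have eι : sigmaComparison P.R E ≫ P.ι.app (∐ E) =
        Limits.Sigma.map (fun s => P.ι.app (E s)) ≫ sigmaComparison P.F E :=
      Sigma.hom_ext _ _ fun s => by simp
    have eπ : sigmaComparison P.F E ≫ P.π.app (∐ E) =
        Limits.Sigma.map (fun s => P.π.app (E s)) :=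
      Sigma.hom_ext _ _ fun s => by simp
    have : Mono (sigmaComparison P.R E) := by
      have : Mono (sigmaComparison P.R E ≫ P.ι.app (∐ E)) := by rw [eι]; infer_instance
      exact mono_of_mono _ (P.ι.app (∐ E))
    have hT : (ShortComplex.mk (Limits.Sigma.map fun s => P.ι.app (E s))
        (Limits.Sigma.map fun s => P.π.app (E s))
        (Sigma.hom_ext _ _ fun s => by simp)).Exact := by
      have : PreservesFiniteLimits (colim (J := Discrete S) (C := A)) :=
        HasExactColimitsOfShape.preservesFiniteLimits
      let U : ShortComplex (Discrete S ⥤ A) := ShortComplex.mk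
        (X₁ := Discrete.functor fun s => P.R.obj (E s))
        (X₂ := Discrete.functor fun s => P.F.obj (E s)) (X₃ := Discrete.functor E)
        (Discrete.natTrans fun s => P.ι.app (E s.as)) (Discrete.natTrans fun s => P.π.app (E s.as))
        (by ext s; exact P.ι_π _)
      have hU : U.Exact := by
        have (s : Discrete S) : Mono (U.f.app s) := inferInstanceAs (Mono (P.ι.app (E s.as)))
        have : Mono U.f := NatTrans.mono_of_mono_app U.f
        refine U.exact_of_f_is_kernel (KernelFork.IsLimit.ofι' _ _ fun {W} k hk =>
          ⟨Discrete.natTrans fun s => kernel.lift (P.π.app (E s.as)) (k.app s) (NatTrans.congr_app hk s),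
            ?_⟩)
        ext s
        exact kernel.lift_ι _ _ _
      exact hU.map colim
    have : Epi (sigmaComparison P.R E) := by
      refine (epi_iff_surjective_up_to_refinements _).2 fun X x => ?_
      obtain ⟨X', p, hp, y, hy⟩ := hT.exact_up_to_refinements
        (x ≫ P.ι.app _ ≫ inv (sigmaComparison P.F E)) (by
          simp [← eπ])
      refine ⟨X', p, hp, y, ?_⟩
      rw [← cancel_mono (P.ι.app (∐ E)), Category.assoc, Category.assoc, eι, ← Category.assoc y]
      dsimp at hy
      rw [← hy]
      simp
    exact isIso_of_mono_of_epi _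
  refine ⟨fun {K} => ?_⟩
  have := key (fun s => K.obj ⟨s⟩)
  have : PreservesColimit (Discrete.functor (K.obj ∘ Discrete.mk)) P.R :=
    PreservesCoproduct.of_iso_comparison P.R fun s => K.obj ⟨s⟩
  exact preservesColimit_of_iso_diagram P.R (Discrete.natIsoFunctor (F := K)).symm

variable {B : Type u'} [Category.{v'} B] [HasCoproducts.{0} B] [AB4OfSize.{0} B] (G : A ⥤ B)

/-- R, and with it every syzygy, commutes with coproducts. The morphisms in question are thus
coproducts of monomorphisms, up to isomorphism. -/
theorem RowAcyclic.sigma [PreservesColimitsOfShape (Discrete S) P.F]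
    [PreservesColimitsOfShape (Discrete S) G] (E : S → A) (hE : ∀ s, P.RowAcyclic G (E s)) :
    P.RowAcyclic G (∐ E) := by
  have := P.preservesColimitsOfShape_R (S := S)
  have hsyz (a : ℕ) : PreservesColimitsOfShape (Discrete S) (P.syz a) := by
    induction a with
    | zero => exact inferInstanceAs (PreservesColimitsOfShape (Discrete S) (𝟭 A))
    | succ a ih => exact inferInstanceAs (PreservesColimitsOfShape (Discrete S) (P.syz a ⋙ P.R))
  intro a
  have := hE
  let τ : P.syz a ⋙ P.R ⋙ G ⟶ P.syz a ⋙ P.F ⋙ G :=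
    Functor.whiskerLeft _ (Functor.whiskerRight P.ι G)
  have (s : S) : Mono (τ.app (E s)) := hE s a
  exact mono_app_sigma τ E

end ResolutionData

/-! ### Free functors and the existence of homology -/

section FunctorCategory

variable {I : Type} [SmallCategory I] {C : Type u} [Category.{v} C] [HasCoproducts.{0} C]

/-- The coproduct of the objects `E j` over all morphisms `j ⟶ i`. -/
noncomputable abbrev freeX (E : I ⥤ C) (i : I) : C := ∐ fun x : Σ j, (j ⟶ i) => E.obj x.1

/-- The inclusion of a summand of `freeX`. -/
noncomputable def freeι (E : I ⥤ C) {j i : I} (f : j ⟶ i) : E.obj j ⟶ freeX E i :=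
  Sigma.ι (fun x : Σ j, (j ⟶ i) => E.obj x.1) ⟨j, f⟩

theorem freeX_hom_ext {E : I ⥤ C} {i : I} {X : C} {f g : freeX E i ⟶ X}
    (h : ∀ (j : I) (a : j ⟶ i), freeι E a ≫ f = freeι E a ≫ g) : f = g :=
  Sigma.hom_ext _ _ fun x => h x.1 x.2

/-- The morphism from `freeX` given by morphisms from its summands. -/
noncomputable def freeDesc {E : I ⥤ C} {i : I} {X : C} (φ : ∀ (j : I) (_ : j ⟶ i), E.obj j ⟶ X) :
    freeX E i ⟶ X :=
  Sigma.desc fun x => φ x.1 x.2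

@[simp]
theorem freeι_desc {E : I ⥤ C} {j i : I} {X : C} (φ : ∀ (j : I) (_ : j ⟶ i), E.obj j ⟶ X)
    (f : j ⟶ i) : freeι E f ≫ freeDesc φ = φ j f :=
  Sigma.ι_desc _ _

@[simp]
theorem freeι_desc_assoc {E : I ⥤ C} {j i : I} {X Y : C}
    (φ : ∀ (j : I) (_ : j ⟶ i), E.obj j ⟶ X) (f : j ⟶ i) (h : X ⟶ Y) :
    freeι E f ≫ freeDesc φ ≫ h = φ j f ≫ h := by
  rw [← Category.assoc, freeι_desc]

/-- The coproduct over all objects `j` of the copower of `E.obj j` by the functor corepresented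
by `j`. -/
@[simps]
noncomputable abbrev freeObj (E : I ⥤ C) : I ⥤ C where
  obj i := freeX E i
  map f := freeDesc fun _ a => freeι E (a ≫ f)
  map_id i := freeX_hom_ext fun j a => by simp
  map_comp f g := freeX_hom_ext fun j a => by simp

/-- The morphism `freeObj E ⟶ M` corresponding to a family of morphisms `E j ⟶ M j`. -/
@[simps]
noncomputable abbrev freeLift {E M : I ⥤ C} (φ : ∀ j, E.obj j ⟶ M.obj j) : freeObj E ⟶ M where
  app i := freeDesc fun j f => φ j ≫ M.map f
  naturality i i' f := freeX_hom_ext fun j a => by simp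

/-- The functor `E ↦ freeObj E`. -/
@[simps]
noncomputable abbrev free : (I ⥤ C) ⥤ (I ⥤ C) where
  obj := freeObj
  map {E E'} φ :=
    { app := fun i => freeDesc fun j a => φ.app j ≫ freeι E' a
      naturality := fun i i' f => freeX_hom_ext fun j a => by simp }
  map_id E := by
    ext i : 2
    exact freeX_hom_ext fun j a => by simp
  map_comp f g := by
    ext i : 2
    exact freeX_hom_ext fun j a => by simp

/-- The counit `freeObj E ⟶ E`. -/
@[simps]
noncomputable abbrev freeπ : free (I := I) (C := C) ⟶ 𝟭 _ where
  app E := freeLift fun j => 𝟙 (E.obj j)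
  naturality E E' φ := by
    ext i : 2
    exact freeX_hom_ext fun j a => by simp

theorem freeι_π (E : I ⥤ C) {j i : I} (f : j ⟶ i) :
    freeι E f ≫ (freeπ.app E).app i = E.map f := by
  simp

/-- The value of `freeObj E` at an object is a coproduct of values of `E`. -/
noncomputable def freeEvaluationIso (i : I) : free ⋙ (evaluation I C).obj i ≅
    coproductFunctor fun x : Σ j, (j ⟶ i) => (evaluation I C).obj x.1 :=
  NatIso.ofComponents (fun E => Iso.refl (freeX E i)) fun {E E'} φ => by
    refine freeX_hom_ext fun j a => ?_
    have e : freeι E a ≫ (Limits.Sigma.map fun x : Σ j, (j ⟶ i) => φ.app x.1) =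
      φ.app j ≫ freeι E' a := Limits.Sigma.ι_map (fun x : Σ j, (j ⟶ i) => φ.app x.1) ⟨j, a⟩
    dsimp
    rw [Category.comp_id, freeι_desc, Category.id_comp]
    exact e.symm

section

variable [HasColimitsOfShape I C]

/-- The morphism from the colimit of `freeObj E` to the coproduct of the values of `E`. -/
noncomputable def freeColimHom (E : I ⥤ C) : colimit (freeObj E) ⟶ ∐ fun j => E.obj j :=
  colimit.desc (freeObj E)
    { pt := ∐ fun j => E.obj j
      ι :=
        { app := fun i => freeDesc fun j _ => Sigma.ι (fun j => E.obj j) j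
          naturality := fun i i' f => freeX_hom_ext fun j a => by simp } }

@[simp]
theorem ι_freeColimHom (E : I ⥤ C) (i : I) : colimit.ι (freeObj E) i ≫ freeColimHom E =
    freeDesc fun j _ => Sigma.ι (fun j => E.obj j) j :=
  colimit.ι_desc _ _

@[simp]
theorem ι_freeColimHom_assoc (E : I ⥤ C) (i : I) {X : C} (h : (∐ fun j => E.obj j) ⟶ X) :
    colimit.ι (freeObj E) i ≫ freeColimHom E ≫ h =
      (freeDesc fun j _ => Sigma.ι (fun j => E.obj j) j) ≫ h := by
  rw [← Category.assoc, ι_freeColimHom]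

/-- The morphism from the coproduct of the values of `E` to the colimit of `freeObj E`. -/
noncomputable def freeColimInv (E : I ⥤ C) : (∐ fun j => E.obj j) ⟶ colimit (freeObj E) :=
  Sigma.desc fun j => freeι E (𝟙 j) ≫ colimit.ι (freeObj E) j

@[simp]
theorem ι_freeColimInv (E : I ⥤ C) (j : I) : Sigma.ι (fun j => E.obj j) j ≫ freeColimInv E =
    freeι E (𝟙 j) ≫ colimit.ι (freeObj E) j :=
  Sigma.ι_desc _ _

@[simp]
theorem ι_freeColimInv_assoc (E : I ⥤ C) (j : I) {X : C} (h : colimit (freeObj E) ⟶ X) :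
    Sigma.ι (fun j => E.obj j) j ≫ freeColimInv E ≫ h =
      freeι E (𝟙 j) ≫ colimit.ι (freeObj E) j ≫ h := by
  rw [← Category.assoc, ι_freeColimInv, Category.assoc]

theorem freeColimHom_inv (E : I ⥤ C) : freeColimHom E ≫ freeColimInv E = 𝟙 _ := by
  refine colimit.hom_ext fun i => freeX_hom_ext fun j a => ?_
  rw [ι_freeColimHom_assoc, freeι_desc_assoc, ι_freeColimInv, ← colimit.w (freeObj E) a]
  simp

theorem freeColimInv_hom (E : I ⥤ C) : freeColimInv E ≫ freeColimHom E = 𝟙 _ := by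
  refine Sigma.hom_ext _ _ fun j => ?_
  simp

/-- The colimit of `freeObj E` is the coproduct of the values of `E`. -/
noncomputable def freeColimIso :
    free (I := I) (C := C) ⋙ colim ≅ coproductFunctor fun j => (evaluation I C).obj j :=
  NatIso.ofComponents (fun E => ⟨freeColimHom E, freeColimInv E, freeColimHom_inv E,
    freeColimInv_hom E⟩) fun {E E'} φ => by
      have e : colim.map (free.map φ) ≫ freeColimHom E' =
          freeColimHom E ≫ Limits.Sigma.map fun j => φ.app j := by
        refine colimit.hom_ext fun i => freeX_hom_ext fun j a => ?_
        simp
      exact e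

omit [HasColimitsOfShape I C] in
theorem preservesColimitsOfShape_free (K : Type) [SmallCategory K] [HasColimitsOfShape K C] :
    PreservesColimitsOfShape K (free (I := I) (C := C)) :=
  preservesColimitsOfShape_of_evaluation _ _ fun i =>
    have := preservesColimitsOfShape_coproductFunctor
      (fun x : Σ j, (j ⟶ i) => (evaluation I C).obj x.1) K
    preservesColimitsOfShape_of_natIso (freeEvaluationIso i).symm

end

section

variable [AB4OfSize.{0} C] [HasFiniteLimits C]

instance : PreservesFiniteLimits (free (I := I) (C := C)) :=
  preservesFiniteLimits_of_evaluation _ fun i =>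
    have := preservesFiniteLimits_coproductFunctor
      (fun x : Σ j, (j ⟶ i) => (evaluation I C).obj x.1)
    preservesFiniteLimits_of_natIso (freeEvaluationIso i).symm

theorem preservesFiniteLimits_free_colim [HasColimitsOfShape I C] :
    PreservesFiniteLimits (free (I := I) (C := C) ⋙ colim) :=
  have := preservesFiniteLimits_coproductFunctor (fun j => (evaluation I C).obj j)
  preservesFiniteLimits_of_natIso freeColimIso.symm

end

section Abelian

variable (I C)
variable [Abelian C] [AB4OfSize.{0} C]

attribute [local instance] hasColimitsOfSize_of_hasCoproducts

instance : AB4OfSize.{0} (I ⥤ C) := ⟨fun _ => inferInstance⟩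

/-- The resolutions in functor categories by coproducts of copowers of corepresentable functors. -/
noncomputable def freeResolution : ResolutionData (I ⥤ C) :=
  have : PreservesFiniteColimits (free (I := I) (C := C)) :=
    ⟨fun _ _ _ => preservesColimitsOfShape_free _⟩
  have : (free (I := I) (C := C)).Additive := Functor.additive_of_preserves_binary_products _
  { F := free
    π := freeπ
    epi := fun E =>
      have (i : I) : Epi ((freeπ.app E).app i) :=
        have : IsSplitEpi ((freeπ.app E).app i) :=
          ⟨⟨freeι E (𝟙 i), (freeι_π E (𝟙 i)).trans (E.map_id i)⟩⟩
        inferInstance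
      NatTrans.epi_of_epi_app _
    -- The section is the comultiplication of the comonad `free`, which comes from restricting
    -- functors to the discrete category of objects.
    split := fun E => ⟨⟨freeLift fun j => freeι E (𝟙 j) ≫ freeι (freeObj E) (𝟙 j), by
      ext i : 2
      exact freeX_hom_ext fun j a => by simp⟩⟩ }

instance : (freeResolution I C).F.Additive := (freeResolution I C).additive

/-- Although `colim` alone is only right exact, `free ⋙ colim` is the coproduct of all evaluations
(`freeColimIso`), and AB4 makes this exact. -/
instance : ((freeResolution I C).F ⋙ colim (J := I) (C := C)).PreservesHomology :=
  have : PreservesFiniteLimits ((freeResolution I C).F ⋙ colim (J := I) (C := C)) :=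
    preservesFiniteLimits_free_colim
  have : PreservesFiniteColimits ((freeResolution I C).F ⋙ colim (J := I) (C := C)) :=
    ⟨fun K _ _ =>
      have := preservesColimitsOfShape_free (I := I) (C := C) K
      inferInstanceAs (PreservesColimitsOfShape K (free ⋙ colim))⟩
  inferInstance

theorem hasHomology : HasHomology I C :=
  (freeResolution I C).hasLeftDerivedFunctor colim

end Abelian

end FunctorCategory

/-! ### Left Kan extension from a comma category -/

section LeftKanExtension

variable {I J : Type} [SmallCategory I] [SmallCategory J] {σ : I ⥤ J} {j : J}
  {C : Type u} [Category.{v} C] [HasCoproducts.{0} C]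

/-- The coproduct of the values of `G` over all morphisms `j ⟶ σ.obj i`. -/
noncomputable abbrev lanX (G : StructuredArrow j σ ⥤ C) (i : I) : C :=
  ∐ fun f : j ⟶ σ.obj i => G.obj (StructuredArrow.mk f)

/-- The inclusion of a summand of `lanX`. -/
noncomputable def lanι (G : StructuredArrow j σ ⥤ C) {i : I} (f : j ⟶ σ.obj i) :
    G.obj (StructuredArrow.mk f) ⟶ lanX G i :=
  Sigma.ι (fun f : j ⟶ σ.obj i => G.obj (StructuredArrow.mk f)) f

theorem lanX_hom_ext {G : StructuredArrow j σ ⥤ C} {i : I} {X : C} {a b : lanX G i ⟶ X}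
    (h : ∀ f : j ⟶ σ.obj i, lanι G f ≫ a = lanι G f ≫ b) : a = b :=
  Sigma.hom_ext _ _ h

/-- The morphism from `lanX` given by morphisms from its summands. -/
noncomputable def lanDesc {G : StructuredArrow j σ ⥤ C} {i : I} {X : C}
    (φ : ∀ f : j ⟶ σ.obj i, G.obj (StructuredArrow.mk f) ⟶ X) : lanX G i ⟶ X :=
  Sigma.desc φ

@[simp]
theorem lanι_desc {G : StructuredArrow j σ ⥤ C} {i : I} {X : C}
    (φ : ∀ f : j ⟶ σ.obj i, G.obj (StructuredArrow.mk f) ⟶ X) (f : j ⟶ σ.obj i) :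
    lanι G f ≫ lanDesc φ = φ f :=
  Sigma.ι_desc _ _

@[simp]
theorem lanι_desc_assoc {G : StructuredArrow j σ ⥤ C} {i : I} {X Y : C}
    (φ : ∀ f : j ⟶ σ.obj i, G.obj (StructuredArrow.mk f) ⟶ X) (f : j ⟶ σ.obj i) (h : X ⟶ Y) :
    lanι G f ≫ lanDesc φ ≫ h = φ f ≫ h := by
  rw [← Category.assoc, lanι_desc]

/-- Replaces the index `f ≫ σ.map u` of a summand by an equal morphism; it absorbs the transport
between summands in the functoriality proofs. -/
theorem map_lanι {G : StructuredArrow j σ ⥤ C} {i i' : I} (u : i ⟶ i') {f : j ⟶ σ.obj i}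
    {f' : j ⟶ σ.obj i'} (h : f ≫ σ.map u = f') :
    G.map (StructuredArrow.homMk u : StructuredArrow.mk f ⟶ .mk (f ≫ σ.map u)) ≫
      lanι G (f ≫ σ.map u) = G.map (StructuredArrow.homMk u h) ≫ lanι G f' := by
  subst h
  rfl

/-- The left Kan extension along the projection from a category of structured arrows. -/
@[simps]
noncomputable abbrev lanObj (G : StructuredArrow j σ ⥤ C) : I ⥤ C where
  obj i := lanX G i
  map u := lanDesc fun f => G.map (StructuredArrow.homMk u : StructuredArrow.mk f ⟶ .mk (f ≫ σ.map u)) ≫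
    lanι G (f ≫ σ.map u)
  map_id i := lanX_hom_ext fun f => by
    rw [lanι_desc, Category.comp_id]
    refine (map_lanι (𝟙 i) (f' := f) (by simp)).trans ?_
    exact (congrArg (· ≫ _) (G.map_id (StructuredArrow.mk f))).trans (Category.id_comp _)
  map_comp u u' := lanX_hom_ext fun f => by
    rw [lanι_desc, lanι_desc_assoc, Category.assoc, lanι_desc,
      map_lanι (u ≫ u') (f' := (f ≫ σ.map u) ≫ σ.map u') (by simp), ← G.map_comp_assoc]
    rfl

/-- The left Kan extension along the projection from a category of structured arrows, as a
functor. -/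
@[simps]
noncomputable abbrev lanProj : (StructuredArrow j σ ⥤ C) ⥤ (I ⥤ C) where
  obj := lanObj
  map {G G'} φ :=
    { app := fun i => lanDesc fun f => φ.app _ ≫ lanι G' f
      naturality := fun i i' u => lanX_hom_ext fun f => by simp }
  map_id E := by
    ext i : 2
    exact lanX_hom_ext fun f => by simp
  map_comp f g := by
    ext i : 2
    exact lanX_hom_ext fun f => by simp

theorem lanι_map_right (G : StructuredArrow j σ ⥤ C) {x y : StructuredArrow j σ} (a : x ⟶ y) :
    lanι G x.hom ≫ (lanObj G).map a.right = G.map a ≫ lanι G y.hom := by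
  rw [lanι_desc]
  exact map_lanι a.right (StructuredArrow.w a)

/-- The morphism from a left Kan extension given by morphisms from the summands. -/
@[simps]
noncomputable abbrev lanLiftAux {G : StructuredArrow j σ ⥤ C} {M : I ⥤ C}
    (χ : ∀ (i : I) (f : j ⟶ σ.obj i), G.obj (StructuredArrow.mk f) ⟶ M.obj i)
    (h : ∀ {i i' : I} (u : i ⟶ i') (f : j ⟶ σ.obj i),
      G.map (StructuredArrow.homMk u : StructuredArrow.mk f ⟶ .mk (f ≫ σ.map u)) ≫
        χ i' (f ≫ σ.map u) = χ i f ≫ M.map u) : lanObj G ⟶ M where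
  app i := lanDesc (χ i)
  naturality i i' u := lanX_hom_ext fun f => by
    rw [lanι_desc_assoc, lanι_desc_assoc, Category.assoc, lanι_desc, h]

/-- The morphism from a left Kan extension corresponding to a morphism to a restriction. -/
noncomputable abbrev lanLift {G : StructuredArrow j σ ⥤ C} {M : I ⥤ C}
    (ψ : G ⟶ StructuredArrow.proj j σ ⋙ M) : lanObj G ⟶ M :=
  lanLiftAux (fun _ f => ψ.app (StructuredArrow.mk f)) fun u f =>
    ψ.naturality (StructuredArrow.homMk u : StructuredArrow.mk f ⟶ .mk (f ≫ σ.map u))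

/-- The morphism to a restriction corresponding to a morphism from a left Kan extension. -/
@[simps]
noncomputable abbrev lanRestr {G : StructuredArrow j σ ⥤ C} {M : I ⥤ C} (φ : lanObj G ⟶ M) :
    G ⟶ StructuredArrow.proj j σ ⋙ M where
  app x := lanι G x.hom ≫ φ.app x.right
  naturality x y a := by
    have h := lanι_map_right G a =≫ φ.app y.right
    rw [Category.assoc, Category.assoc, φ.naturality] at h
    exact h.symm.trans (Category.assoc _ _ _).symm

/-- Left Kan extension is left adjoint to restriction. -/
noncomputable def lanProjAdj : lanProj (C := C) ⊣ restr (StructuredArrow.proj j σ) C :=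
  Adjunction.mkOfHomEquiv
    { homEquiv := fun G M =>
        { toFun := lanRestr
          invFun := lanLift
          left_inv := fun φ => by
            ext i : 2
            exact lanX_hom_ext fun f => lanι_desc _ _
          right_inv := fun ψ => by
            ext x
            exact lanι_desc _ _ }
      homEquiv_naturality_left_symm := fun {G G' M} φ ψ => by
        ext i : 2
        refine lanX_hom_ext fun f => (lanι_desc _ _).trans ?_
        have e : (lanι G f ≫ lanDesc fun f => φ.app _ ≫ lanι G' f) ≫ lanDesc
          (X := M.obj i) (fun f => ψ.app (StructuredArrow.mk f)) = φ.app _ ≫ ψ.app _ := by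
            rw [lanι_desc, Category.assoc]
            exact φ.app _ ≫= lanι_desc _ _
        exact e.symm.trans (Category.assoc _ _ _)
      homEquiv_naturality_right := fun φ ψ => by
        ext x
        exact (Category.assoc _ _ _).symm }

/-- The values of the left Kan extension are coproducts. -/
noncomputable def lanProjEvaluationIso (i : I) : lanProj ⋙ (evaluation I C).obj i ≅
    coproductFunctor fun f : j ⟶ σ.obj i =>
      (evaluation (StructuredArrow j σ) C).obj (StructuredArrow.mk f) :=
  NatIso.ofComponents (fun G => Iso.refl (lanX G i)) fun {G G'} φ => by
    refine lanX_hom_ext fun f => ?_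
    have e : lanι G f ≫ (Limits.Sigma.map fun f : j ⟶ σ.obj i => φ.app (StructuredArrow.mk f)) =
      φ.app _ ≫ lanι G' f :=
        Limits.Sigma.ι_map (fun f : j ⟶ σ.obj i => φ.app (StructuredArrow.mk f)) f
    dsimp
    rw [Category.comp_id, lanι_desc, Category.id_comp]
    exact e.symm

instance [AB4OfSize.{0} C] [HasFiniteLimits C] :
    PreservesFiniteLimits (lanProj (σ := σ) (j := j) (C := C)) :=
  preservesFiniteLimits_of_evaluation _ fun i =>
    have := preservesFiniteLimits_coproductFunctor fun f : j ⟶ σ.obj i =>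
      (evaluation (StructuredArrow j σ) C).obj (StructuredArrow.mk f)
    preservesFiniteLimits_of_natIso (lanProjEvaluationIso i).symm

instance : (lanProj (σ := σ) (j := j) (C := C)).IsLeftAdjoint := lanProjAdj.isLeftAdjoint

/-- The colimit of the left Kan extension is the colimit. -/
noncomputable def lanProjColimIso [HasColimitsOfSize.{0, 0} C] :
    lanProj (σ := σ) (j := j) (C := C) ⋙ colim ≅ colim :=
  -- Both functors are left adjoint to the constant functor, because restriction along the
  -- projection sends constants to constants.
  (lanProjAdj.comp colimConstAdj).leftAdjointUniq colimConstAdj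

variable [Abelian C] [AB4OfSize.{0} C]

instance : (lanProj (σ := σ) (j := j) (C := C)).Additive :=
  Functor.additive_of_preserves_binary_products _

instance : (lanProj (σ := σ) (j := j) (C := C)).PreservesHomology :=
  have : PreservesFiniteColimits (lanProj (σ := σ) (j := j) (C := C)) := inferInstance
  inferInstance

/-- Relatively projective objects lift against pointwise split epimorphisms. -/
theorem relProj_iff (E : I ⥤ C) : (freeResolution I C).RelProj E ↔
    ∀ ⦃M N : I ⥤ C⦄ (q : M ⟶ N) (_ : ∀ i, IsSplitEpi (q.app i)) (f : E ⟶ N),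
      ∃ g : E ⟶ M, g ≫ q = f := by
  constructor
  · intro hE M N q hq f
    have : IsSplitEpi (freeπ.app E) := hE
    refine ⟨section_ (freeπ.app E) ≫ freeLift fun i => f.app i ≫ section_ (q.app i), ?_⟩
    have e : (freeLift fun i => f.app i ≫ section_ (q.app i)) ≫ q = freeπ.app E ≫ f := by
      ext i : 2
      refine freeX_hom_ext fun k a => ?_
      have h₁ := q.naturality a
      have h₂ := f.naturality a
      simp [h₁, h₂]
    rw [Category.assoc, e, IsSplitEpi.id_assoc]
  · intro h
    obtain ⟨g, hg⟩ := h (freeπ.app E) (fun i => ⟨⟨freeι E (𝟙 i),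
      (freeι_π E (𝟙 i)).trans (E.map_id i)⟩⟩) (𝟙 E)
    exact ⟨⟨g, hg⟩⟩

/-- Restriction preserves pointwise split epimorphisms, so its left adjoint preserves the objects
that lift against them. -/
theorem relProj_lanObj (G : StructuredArrow j σ ⥤ C)
    (hG : (freeResolution (StructuredArrow j σ) C).RelProj G) :
    (freeResolution I C).RelProj (lanObj G) := by
  rw [relProj_iff] at hG ⊢
  intro M N q hq f
  obtain ⟨g, hg⟩ := hG ((restr (StructuredArrow.proj j σ) C).map q) (fun x => hq x.right)
    (lanProjAdj.homEquiv G N f)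
  refine ⟨(lanProjAdj.homEquiv G M).symm g, ?_⟩
  rw [← Adjunction.homEquiv_naturality_right_symm, hg, Equiv.symm_apply_apply]

end LeftKanExtension

/-! ### Functoriality of homology in the indexing category -/

section HomologyMaps

attribute [local instance] hasColimitsOfSize_of_hasCoproducts hasHomology

variable {I J L : Type} [SmallCategory I] [SmallCategory J] [SmallCategory L]
  {C : Type u} [Category.{v} C] [Abelian C] [HasCoproducts.{0} C] [AB4OfSize.{0} C]

/-- The homology of a complex of functors. -/
noncomputable abbrev homologyObj (K : ComplexMinus (I ⥤ C)) : DMinus C :=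
  (homologyOfCat I C).obj ((DMinus.Q (I ⥤ C)).obj K)

/-- The map on homology induced by a morphism of complexes of functors. -/
noncomputable abbrev homologyObjMap {K K' : ComplexMinus (I ⥤ C)} (f : K ⟶ K') :
    homologyObj K ⟶ homologyObj K' :=
  (homologyOfCat I C).map ((DMinus.Q (I ⥤ C)).map f)

/-- The map from the homology of a complex of functors to its colimit. -/
noncomputable abbrev toColim (K : ComplexMinus (I ⥤ C)) :
    homologyObj K ⟶ (colimMinus I C).obj K :=
  (homologyOfCatCounit I C).app K

/-- The restriction of a complex of functors. -/
noncomputable abbrev restrMinus (σ : I ⥤ J) (K : ComplexMinus (J ⥤ C)) : ComplexMinus (I ⥤ C) :=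
  (ComplexMinus.map (restr σ C)).obj K

/-- The restriction of a morphism of complexes of functors. -/
noncomputable abbrev restrMinusMap (σ : I ⥤ J) {K K' : ComplexMinus (J ⥤ C)} (f : K ⟶ K') :
    restrMinus σ K ⟶ restrMinus σ K' :=
  (ComplexMinus.map (restr σ C)).map f

/-- The map on homology induced by a functor, on complexes. -/
noncomputable def homologyRestr (σ : I ⥤ J) (K : ComplexMinus (J ⥤ C)) :
    homologyObj (restrMinus σ K) ⟶ homologyObj K :=
  (homologyOfCat I C).map ((DMinus.mapFac (restr σ C)).inv.app K) ≫
    (homologyMap C σ).app ((DMinus.Q (J ⥤ C)).obj K)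

theorem isIso_homologyMap_app_iff (σ : I ⥤ J) (K : ComplexMinus (J ⥤ C)) :
    IsIso ((homologyMap C σ).app ((DMinus.Q (J ⥤ C)).obj K)) ↔ IsIso (homologyRestr σ K) :=
  (isIso_comp_left_iff ((homologyOfCat I C).map ((DMinus.mapFac (restr σ C)).inv.app K))
    ((homologyMap C σ).app ((DMinus.Q (J ⥤ C)).obj K))).symm

/-- The defining property of `homologyMap`, expressed on complexes. Together with naturality it
determines `homologyRestr`. -/
theorem homologyRestr_toColim (σ : I ⥤ J) (K : ComplexMinus (J ⥤ C)) :
    homologyRestr σ K ≫ toColim K = toColim (restrMinus σ K) ≫ (complexColimRestr C σ).app K := by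
  have h := (homologyOfCat J C).leftDerived_fac_app (homologyOfCatCounit J C)
    (quasiIsoMinus (J ⥤ C)) (DMinus.map (restr σ C) ⋙ homologyOfCat I C)
    (Functor.whiskerRight (DMinus.mapFac (restr σ C)).hom (homologyOfCat I C) ≫
      Functor.whiskerLeft (ComplexMinus.map (restr σ C)) (homologyOfCatCounit I C) ≫
      complexColimRestr C σ) K
  have h' : (homologyMap C σ).app ((DMinus.Q (J ⥤ C)).obj K) ≫ toColim K =
      (homologyOfCat I C).map ((DMinus.mapFac (restr σ C)).hom.app K) ≫
        toColim (restrMinus σ K) ≫ (complexColimRestr C σ).app K := h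
  rw [homologyRestr, Category.assoc, h', ← Functor.map_comp_assoc, Iso.inv_hom_id_app]
  exact ((homologyOfCat I C).map_id ((DMinus.Q (I ⥤ C)).obj (restrMinus σ K)) =≫ _).trans
    (Category.id_comp _)

theorem homologyRestr_naturality (σ : I ⥤ J) {K K' : ComplexMinus (J ⥤ C)} (f : K ⟶ K') :
    homologyObjMap (restrMinusMap σ f) ≫ homologyRestr σ K' =
      homologyRestr σ K ≫ homologyObjMap f := by
  have h₁ := (DMinus.mapFac (restr σ C)).inv.naturality f
  have h₂ := (homologyMap C σ).naturality ((DMinus.Q (J ⥤ C)).map f)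
  have h₁' : (DMinus.Q (I ⥤ C)).map (restrMinusMap σ f) ≫ (DMinus.mapFac (restr σ C)).inv.app K' =
    (DMinus.mapFac (restr σ C)).inv.app K ≫
      (DMinus.map (restr σ C)).map ((DMinus.Q (J ⥤ C)).map f) := h₁
  have h₂' : (homologyOfCat I C).map ((DMinus.map (restr σ C)).map ((DMinus.Q (J ⥤ C)).map f)) ≫
    (homologyMap C σ).app ((DMinus.Q (J ⥤ C)).obj K') =
      (homologyMap C σ).app ((DMinus.Q (J ⥤ C)).obj K) ≫ homologyObjMap f := h₂
  rw [homologyRestr, homologyRestr, Category.assoc, ← h₂', ← Functor.map_comp_assoc,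
    ← Functor.map_comp_assoc, h₁']

/-- The resolution of a complex of functors. -/
noncomputable abbrev freeT (K : ComplexMinus (I ⥤ C)) : ComplexMinus (I ⥤ C) :=
  (freeResolution I C).T.obj K

/-- The augmentation of the resolution of a complex of functors. -/
noncomputable abbrev freeAug (K : ComplexMinus (I ⥤ C)) : freeT K ⟶ K :=
  (freeResolution I C).aug.app K

theorem isIso_toColim (K : ComplexMinus (I ⥤ C))
    (hK : ∀ n, (freeResolution I C).RowAcyclic colim (K.obj.X n)) : IsIso (toColim K) :=
  (freeResolution I C).isIso_counit_app colim (homologyOfCat I C) (homologyOfCatCounit I C) K hK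

instance isIso_toColim_T (K : ComplexMinus (I ⥤ C)) :
    IsIso (toColim (freeT K)) :=
  isIso_toColim _ fun n => ((freeResolution I C).relProj_T K n).rowAcyclic colim

theorem isIso_homologyObjMap {K K' : ComplexMinus (I ⥤ C)} (f : K ⟶ K') [QuasiIso f.hom] :
    IsIso (homologyObjMap f) :=
  have := DMinus.isIso_Q_map f
  inferInstance

instance isIso_homologyObjMap_restr_aug (σ : I ⥤ J) (K : ComplexMinus (J ⥤ C)) :
    IsIso (homologyObjMap (restrMinusMap σ (freeAug K))) :=
  have := (freeResolution J C).quasiIso_aug K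
  have : QuasiIso (restrMinusMap σ (freeAug K)).hom :=
    HomologicalComplex.quasiIso_map_of_preservesHomology
      (freeAug K).hom (restr σ C)
  isIso_homologyObjMap _

instance isIso_homologyObjMap_aug (K : ComplexMinus (J ⥤ C)) :
    IsIso (homologyObjMap (freeAug K)) :=
  have := (freeResolution J C).quasiIso_aug K
  isIso_homologyObjMap _

/-- The way equalities of maps into homology are proved: move along the augmentation to the
resolution, where `toColim` is invertible, and compare in the colimit. -/
theorem homologyObj_hom_ext {X X' : DMinus C} {K : ComplexMinus (J ⥤ C)} (a : X' ⟶ X) [Epi a]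
    {f g : X ⟶ homologyObj K} {f' g' : X' ⟶ homologyObj (freeT K)}
    (hf : a ≫ f = f' ≫ homologyObjMap (freeAug K))
    (hg : a ≫ g = g' ≫ homologyObjMap (freeAug K))
    (h : f' ≫ toColim _ = g' ≫ toColim _) : f = g := by
  rw [cancel_mono] at h
  rw [← cancel_epi a, hf, hg, h]

theorem isIso_homologyRestr_of_T (σ : I ⥤ J) (K : ComplexMinus (J ⥤ C))
    [IsIso (homologyRestr σ (freeT K))] : IsIso (homologyRestr σ K) := by
  have h := homologyRestr_naturality σ (freeAug K)
  have : IsIso (homologyObjMap (restrMinusMap σ (freeAug K)) ≫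
      homologyRestr σ K) := by
    rw [h]
    infer_instance
  exact IsIso.of_isIso_comp_left (homologyObjMap (restrMinusMap σ (freeAug K))) _

omit [AB4OfSize.{0} C] in
theorem colimRestr_comp (σ : I ⥤ J) (τ : J ⥤ L) (K : ComplexMinus (L ⥤ C)) :
    (complexColimRestr C σ).app (restrMinus τ K) ≫ (complexColimRestr C τ).app K =
      (complexColimRestr C (σ ⋙ τ)).app K := by
  refine ((DMinus.Q C).map_comp _ _).symm.trans (congrArg (DMinus.Q C).map ?_)
  ext n
  exact colimit.pre_pre (K.obj.X n) τ σ

theorem homologyRestr_comp (σ : I ⥤ J) (τ : J ⥤ L) (K : ComplexMinus (L ⥤ C)) :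
    homologyRestr σ (restrMinus τ K) ≫ homologyRestr τ K = homologyRestr (σ ⋙ τ) K := by
  have : IsIso (homologyObjMap (restrMinusMap σ (restrMinusMap τ (freeAug K)))) :=
    isIso_homologyObjMap_restr_aug (σ ⋙ τ) K
  refine homologyObj_hom_ext (homologyObjMap (restrMinusMap σ (restrMinusMap τ (freeAug K))))
    (f' := homologyRestr σ (restrMinus τ _) ≫ homologyRestr τ _)
    (g' := homologyRestr (σ ⋙ τ) _) ?_ (homologyRestr_naturality (σ ⋙ τ) (freeAug K)) ?_
  · rw [reassoc_of% (homologyRestr_naturality (C := C)), homologyRestr_naturality, Category.assoc]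
  · have h : (homologyRestr σ (restrMinus τ (freeT K)) ≫ homologyRestr τ (freeT K)) ≫
        toColim (freeT K) = toColim (restrMinus σ (restrMinus τ (freeT K))) ≫
          (complexColimRestr C (σ ⋙ τ)).app (freeT K) := by
      rw [← colimRestr_comp, Category.assoc, homologyRestr_toColim, reassoc_of% (homologyRestr_toColim (C := C))]
    exact h.trans (homologyRestr_toColim (σ ⋙ τ) (freeT K)).symm

theorem homologyRestr_id (K : ComplexMinus (J ⥤ C)) : homologyRestr (𝟭 J) K = 𝟙 (homologyObj K) := by
  refine homologyObj_hom_ext (homologyObjMap (restrMinusMap (𝟭 J) (freeAug K)))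
    (f' := homologyRestr (𝟭 J) _) (g' := 𝟙 (homologyObj _)) (homologyRestr_naturality _ (freeAug K))
    ?_ ?_
  · exact (Category.comp_id _).trans (Category.id_comp _).symm
  · have e : (complexColimRestr C (𝟭 J)).app (freeT K) = 𝟙 ((colimMinus J C).obj (freeT K)) := by
      refine (congrArg (DMinus.Q C).map ?_).trans ((DMinus.Q C).map_id _)
      ext n
      exact (colimit.pre_id ((freeT K).obj.X n)).trans (colim.map_id _)
    refine (homologyRestr_toColim _ _).trans ((toColim (freeT K) ≫= e).trans ?_)
    exact (Category.comp_id _).trans (Category.id_comp _).symm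

end HomologyMaps

/-! ### Constant coefficients and contractible categories -/

section ConstantCoefficients

attribute [local instance] hasColimitsOfSize_of_hasCoproducts hasHomology

variable {S T : Type} [SmallCategory S] [SmallCategory T]
  {C : Type u} [Category.{v} C] [Abelian C] [HasCoproducts.{0} C] [AB4OfSize.{0} C]

/-- The morphism between restrictions induced by a natural transformation. -/
noncomputable def restrMinusNat {A B : S ⥤ T} (α : A ⟶ B) (K : ComplexMinus (T ⥤ C)) :
    restrMinus A K ⟶ restrMinus B K :=
  ObjectProperty.homMk ((NatTrans.mapHomologicalComplex
    (((Functor.whiskeringLeft S T C).map α)) (ComplexShape.up ℤ)).app K.obj)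

omit [HasCoproducts.{0} C] [AB4OfSize.{0} C] in
theorem restrMinusNat_naturality {A B : S ⥤ T} (α : A ⟶ B) {K K' : ComplexMinus (T ⥤ C)}
    (f : K ⟶ K') : restrMinusMap A f ≫ restrMinusNat α K' =
      restrMinusNat α K ≫ restrMinusMap B f := by
  ext : 1
  exact (NatTrans.mapHomologicalComplex
    (((Functor.whiskeringLeft S T C).map α)) (ComplexShape.up ℤ)).naturality f.hom

omit [AB4OfSize.{0} C] in
theorem colimRestr_nat {A B : S ⥤ T} (α : A ⟶ B) (K : ComplexMinus (T ⥤ C)) :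
    (colimMinus S C).map (restrMinusNat α K) ≫ (complexColimRestr C B).app K =
      (complexColimRestr C A).app K := by
  refine ((DMinus.Q C).map_comp _ _).symm.trans (congrArg (DMinus.Q C).map ?_)
  ext n
  have h : colim.map (Functor.whiskerRight α (K.obj.X n)) ≫ colimit.pre (K.obj.X n) B =
      colimit.pre (K.obj.X n) A := by
    refine colimit.hom_ext fun s => ?_
    simp
  exact h

theorem homologyObjMap_restrMinusNat {A B : S ⥤ T} (α : A ⟶ B) (K : ComplexMinus (T ⥤ C)) :
    homologyObjMap (restrMinusNat α K) ≫ homologyRestr B K = homologyRestr A K := by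
  refine homologyObj_hom_ext (homologyObjMap (restrMinusMap A (freeAug K)))
    (f' := homologyObjMap (restrMinusNat α _) ≫ homologyRestr B _)
    (g' := homologyRestr A _) ?_ (homologyRestr_naturality A (freeAug K)) ?_
  · have h := congrArg homologyObjMap (restrMinusNat_naturality α (freeAug K))
    simp only [homologyObjMap, Functor.map_comp] at h
    rw [reassoc_of% h, Category.assoc, ← homologyRestr_naturality]
  · have h := (homologyOfCatCounit S C).naturality (restrMinusNat α (freeT K))
    have h' : homologyObjMap (restrMinusNat α (freeT K)) ≫ toColim (restrMinus B (freeT K)) =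
      toColim (restrMinus A (freeT K)) ≫ (colimMinus S C).map (restrMinusNat α (freeT K)) := h
    rw [Category.assoc, homologyRestr_toColim, homologyRestr_toColim, reassoc_of% h']
    exact toColim (restrMinus A (freeT K)) ≫= colimRestr_nat α (freeT K)

instance : (Functor.const T (C := C)).PreservesZeroMorphisms where
  map_zero _ _ := rfl

variable (T) in
/-- The complex of constant functors attached to a complex. -/
noncomputable abbrev constMinus (K : ComplexMinus C) : ComplexMinus (T ⥤ C) :=
  (ComplexMinus.map (Functor.const T)).obj K

/-- The map on homology with constant coefficients induced by a functor. -/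
noncomputable def homologyConst (F : S ⥤ T) (K : ComplexMinus C) :
    homologyObj (constMinus S K) ⟶ homologyObj (constMinus T K) :=
  homologyRestr F (constMinus T K)

theorem homologyConst_id (K : ComplexMinus C) : homologyConst (𝟭 T) K = 𝟙 _ :=
  homologyRestr_id _

theorem homologyConst_comp {U : Type} [SmallCategory U] (F : S ⥤ T) (G : T ⥤ U)
    (K : ComplexMinus C) : homologyConst F K ≫ homologyConst G K = homologyConst (F ⋙ G) K :=
  homologyRestr_comp F G (constMinus U K)

/-- The restrictions of a constant complex along A and B are the same complex, and α acts on it as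
the identity. -/
theorem homologyConst_eq_of_hom {A B : S ⥤ T} (α : A ⟶ B) (K : ComplexMinus C) :
    homologyConst A K = homologyConst B K := by
  have h := homologyObjMap_restrMinusNat α (constMinus T K)
  have e : homologyObjMap (restrMinusNat α (constMinus T K)) = 𝟙 (homologyObj (constMinus S K)) :=
    (congrArg (homologyOfCat S C).map ((DMinus.Q (S ⥤ C)).map_id (constMinus S K))).trans
      ((homologyOfCat S C).map_id _)
  exact h.symm.trans ((e =≫ _).trans (Category.id_comp (homologyConst B K)))

theorem homologyConst_eq_of_zigzag {A B : S ⥤ T} (h : Zigzag A B) (K : ComplexMinus C) :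
    homologyConst A K = homologyConst B K := by
  induction h with
  | refl => rfl
  | tail _ h ih =>
    rw [ih]
    obtain ⟨⟨α⟩⟩ | ⟨⟨α⟩⟩ := h
    · exact homologyConst_eq_of_hom α K
    · exact (homologyConst_eq_of_hom α K).symm

theorem isIso_homologyConst {F : S ⥤ T} {G : T ⥤ S} (h : Zigzag (F ⋙ G) (𝟭 S))
    (h' : Zigzag (G ⋙ F) (𝟭 T)) (K : ComplexMinus C) : IsIso (homologyConst F K) :=
  ⟨homologyConst G K,
    by rw [homologyConst_comp, homologyConst_eq_of_zigzag h, homologyConst_id],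
    by rw [homologyConst_comp, homologyConst_eq_of_zigzag h', homologyConst_id]⟩

variable (T C) in
/-- A connected category whose homology with constant coefficients is trivial. -/
structure HomologicallyTrivial : Prop where
  isConnected : IsConnected T
  isIso_toColim : ∀ K : ComplexMinus C, IsIso (toColim (constMinus T K))

omit [AB4OfSize.{0} C] in
theorem isIso_complexColimRestr_app (F : S ⥤ T) (K : ComplexMinus (T ⥤ C))
    (h : ∀ n, IsIso (colimit.pre (K.obj.X n) F)) : IsIso ((complexColimRestr C F).app K) := by
  have (n : ℤ) : IsIso (((complexColimRestrAux C F).app K).hom.f n) := h n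
  have : IsIso ((complexColimRestrAux C F).app K).hom :=
    HomologicalComplex.Hom.isIso_of_components _
  exact DMinus.isIso_Q_map ((complexColimRestrAux C F).app K)

omit [Abelian C] [HasCoproducts.{0} C] [AB4OfSize.{0} C] in
theorem isIso_colimitι_const [IsConnected T] (M : C) (x : T) :
    IsIso (colimit.ι ((Functor.const T).obj M) x) := by
  have h : colimit.ι ((Functor.const T).obj M) x ≫ ((colimit.isColimit _).coconePointUniqueUpToIso
      (isColimitConstCocone T M)).hom = 𝟙 M :=
    IsColimit.comp_coconePointUniqueUpToIso_hom (colimit.isColimit _) _ x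
  have : IsIso (colimit.ι ((Functor.const T).obj M) x ≫
      ((colimit.isColimit _).coconePointUniqueUpToIso (isColimitConstCocone T M)).hom) := by
    rw [h]
    exact inferInstanceAs (IsIso (𝟙 M))
  exact IsIso.of_isIso_comp_right _ ((colimit.isColimit _).coconePointUniqueUpToIso
    (isColimitConstCocone T M)).hom

omit [AB4OfSize.{0} C] in
theorem isIso_colimRestr_const [IsConnected S] [IsConnected T] (F : S ⥤ T)
    (K : ComplexMinus C) : IsIso ((complexColimRestr C F).app (constMinus T K)) := by
  refine isIso_complexColimRestr_app F _ fun n => ?_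
  let x : S := Classical.arbitrary S
  have h : colimit.ι ((Functor.const S).obj (K.obj.X n)) x ≫
      colimit.pre ((Functor.const T).obj (K.obj.X n)) F =
      colimit.ι ((Functor.const T).obj (K.obj.X n)) (F.obj x) :=
    colimit.ι_pre ((Functor.const T).obj (K.obj.X n)) F x
  have h₁ := isIso_colimitι_const (K.obj.X n) x
  have h₂ := isIso_colimitι_const (K.obj.X n) (F.obj x)
  rw [← h] at h₂
  exact @IsIso.of_isIso_comp_left _ _ _ _ _ _ _ h₁ h₂

/-- In the square comparing homology with colimits of constant complexes, the map between colimits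
is invertible since both categories are connected. Two further sides are invertible by hypothesis,
so the fourth is. -/
theorem HomologicallyTrivial.of_isIso (hT : HomologicallyTrivial T C) [IsConnected S] (F : S ⥤ T)
    (hF : ∀ K : ComplexMinus C, IsIso (homologyConst F K)) : HomologicallyTrivial S C where
  isConnected := inferInstance
  isIso_toColim K := by
    have := hT.isConnected
    have h₁ := hF K
    have h₂ := hT.isIso_toColim K
    have h₃ := isIso_colimRestr_const F K
    have h : homologyConst F K ≫ toColim (constMinus T K) =
      toColim (constMinus S K) ≫ (complexColimRestr C F).app (constMinus T K) :=
        homologyRestr_toColim F (constMinus T K)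
    have h₄ : IsIso (homologyConst F K ≫ toColim (constMinus T K)) := inferInstance
    rw [h] at h₄
    exact @IsIso.of_isIso_comp_right _ _ _ _ _ _ _ h₃ h₄

/-- Colimits over a point are exact, so every coefficient object is acyclic. -/
theorem homologicallyTrivial_punit : HomologicallyTrivial (Discrete PUnit.{1}) C where
  isConnected := inferInstance
  isIso_toColim K := isIso_toColim _ fun n a => by
    have : PreservesFiniteLimits (colim (J := Discrete PUnit.{1}) (C := C)) :=
      HasExactColimitsOfShape.preservesFiniteLimits
    infer_instance

/-- A category is homologically trivial if its identity functor is connected to a constant functor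
by natural transformations. -/
theorem homologicallyTrivial_of_zigzag (t : T) (h : Zigzag (𝟭 T) ((Functor.const T).obj t)) :
    HomologicallyTrivial T C := by
  have : Nonempty T := ⟨t⟩
  have hz (x : T) : Zigzag x t := zigzag_obj_of_zigzag ((evaluation T T).obj x) h
  have : IsConnected T := zigzag_isConnected fun x y => (hz x).trans (hz y).symm
  refine homologicallyTrivial_punit.of_isIso (Functor.star T) fun K => ?_
  refine isIso_homologyConst (G := Functor.fromPUnit t) h.symm ?_ K
  exact Relation.ReflTransGen.refl

theorem HomologicallyTrivial.of_equivalence (hT : HomologicallyTrivial T C) (e : S ≌ T) :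
    HomologicallyTrivial S C :=
  have := hT.isConnected
  have := isConnected_of_equivalent e.symm
  hT.of_isIso e.functor fun K => isIso_homologyConst (G := e.inverse)
    (Zigzag.of_inv e.unit) (Zigzag.of_hom e.counit) K

end ConstantCoefficients

namespace ResolutionData

variable {A : Type u} [Category.{v} A] [Abelian A] (P : ResolutionData A)
  {B : Type u'} [Category.{v'} B] {G : A ⥤ B}

variable {P} in
theorem RowAcyclic.of_iso {E E' : A} (hE : P.RowAcyclic G E) (e : E ≅ E') : P.RowAcyclic G E' := by
  intro a
  have := hE a
  have h := P.ι.naturality ((P.syz a).map e.inv)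
  have h' : P.ι.app ((P.syz a).obj E') = P.R.map ((P.syz a).map e.inv) ≫
      P.ι.app ((P.syz a).obj E) ≫ P.F.map ((P.syz a).map e.hom) := by
    rw [← P.ι.naturality, ← P.R.map_comp_assoc, ← (P.syz a).map_comp, e.inv_hom_id]
    simp
  rw [h', G.map_comp, G.map_comp]
  infer_instance

end ResolutionData

/-! ### Theorem A in homology -/

section TheoremA

attribute [local instance] hasColimitsOfSize_of_hasCoproducts hasHomology

variable {I J : Type} [SmallCategory I] [SmallCategory J] {σ : I ⥤ J} {j : J}
  {C : Type u} [Category.{v} C] [Abelian C] [HasCoproducts.{0} C] [AB4OfSize.{0} C]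

/-- A free resolution of the constant functor on j\σ extends to a resolution of the Kan extension by
relatively projective objects with the same colimit. So the homology of I with these coefficients is
that of j\σ with coefficients M, namely M in degree 0. -/
theorem rowAcyclic_lanObj_const (h : HomologicallyTrivial (StructuredArrow j σ) C) (M : C) :
    (freeResolution I C).RowAcyclic colim
      (lanObj ((Functor.const (StructuredArrow j σ)).obj M)) := by
  let L₀ : ComplexMinus (StructuredArrow j σ ⥤ C) := constMinus _ ((ComplexMinus.single C).obj M)
  let f : (ComplexMinus.map lanProj).obj (freeT L₀) ⟶ (ComplexMinus.map (lanProj (σ := σ))).obj L₀ :=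
    (ComplexMinus.map lanProj).map (freeAug L₀)
  have hf : QuasiIso f.hom :=
    have : QuasiIso (freeAug L₀).hom := (freeResolution _ C).quasiIso_aug L₀
    HomologicalComplex.quasiIso_map_of_preservesHomology (freeAug L₀).hom (lanProj (σ := σ))
  have h₁ := isIso_homologyObjMap f
  have h₂ : IsIso (toColim ((ComplexMinus.map (lanProj (σ := σ))).obj (freeT L₀))) :=
    isIso_toColim _ fun n =>
      (relProj_lanObj _ ((freeResolution _ C).relProj_T L₀ n)).rowAcyclic colim
  -- The hypothesis on j\σ enters here, translated into a statement about the free resolution.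
  have h₃ : QuasiIso ((ComplexMinus.map colim).map (freeAug L₀)).hom :=
    ((freeResolution _ C).isIso_counit_app_iff colim (homologyOfCat _ C)
      (homologyOfCatCounit _ C) L₀).1 (h.isIso_toColim _)
  have h₄ : QuasiIso ((ComplexMinus.map colim).map f).hom := by
    let φ := NatIso.mapHomologicalComplex (lanProjColimIso (σ := σ) (j := j) (C := C))
      (ComplexShape.up ℤ)
    have e : ((ComplexMinus.map colim).map f).hom ≫ φ.hom.app L₀.obj =
      φ.hom.app (freeT L₀).obj ≫ ((ComplexMinus.map colim).map (freeAug L₀)).hom :=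
        φ.hom.naturality (freeAug L₀).hom
    have hφ (L : CochainComplex (StructuredArrow j σ ⥤ C) ℤ) : QuasiIso (φ.hom.app L) :=
      inferInstance
    have : QuasiIso (((ComplexMinus.map colim).map f).hom ≫ φ.hom.app L₀.obj) := by
      rw [e]
      exact @quasiIso_comp _ _ _ _ _ _ _ _ _ _ _ _ _ (hφ _) h₃
    exact @quasiIso_of_comp_right _ _ _ _ _ _ _ _ _ _ _ _ _ (hφ _) this
  have h₅ : IsIso ((colimMinus I C).map f) := DMinus.isIso_Q_map ((ComplexMinus.map colim).map f)
  have h₆ : homologyObjMap f ≫ toColim _ = toColim _ ≫ (colimMinus I C).map f :=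
    (homologyOfCatCounit I C).naturality f
  have h₇ : IsIso (toColim ((ComplexMinus.map (lanProj (σ := σ))).obj L₀)) := by
    have : IsIso (homologyObjMap f ≫ toColim _) := by
      rw [h₆]
      exact IsIso.comp_isIso' h₂ h₅
    exact @IsIso.of_isIso_comp_left _ _ _ _ _ _ _ h₁ this
  -- Since the complex has one term, invertibility of its counit gives back row acyclicity, the form
  -- that passes to coproducts.
  have h₈ := (freeResolution I C).rowAcyclic_of_isIso_counit_app colim (homologyOfCat I C)
    (homologyOfCatCounit I C) _ (fun i hi => by
      refine lanProj.map_isZero ((Functor.const _).map_isZero ?_)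
      exact HomologicalComplex.isZero_single_obj_X _ _ _ _ hi) h₇
  exact h₈.of_iso ((Functor.const _ ⋙ lanProj).mapIso
    (HomologicalComplex.singleObjXSelf (ComplexShape.up ℤ) 0 M))

/-- The morphism from a left Kan extension to the restriction of `freeObj E`. -/
noncomputable abbrev lanToFree (σ : I ⥤ J) (E : J ⥤ C) (j : J) :
    lanObj ((Functor.const (StructuredArrow j σ)).obj (E.obj j)) ⟶ σ ⋙ freeObj E :=
  lanLiftAux (M := σ ⋙ freeObj E) (fun _ f => freeι E f) fun u f => by
    simp

/-- The morphism from the restriction of `freeObj E` given by morphisms from left Kan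
extensions. -/
noncomputable abbrev freeRestrDesc (σ : I ⥤ J) (E : J ⥤ C) {M : I ⥤ C}
    (t : ∀ j, lanObj ((Functor.const (StructuredArrow j σ)).obj (E.obj j)) ⟶ M) :
    σ ⋙ freeObj E ⟶ M where
  app i := freeDesc fun j f =>
    lanι ((Functor.const (StructuredArrow j σ)).obj (E.obj j)) f ≫ (t j).app i
  naturality i i' u := freeX_hom_ext fun j f => by
    have h := lanι ((Functor.const (StructuredArrow j σ)).obj (E.obj j)) f ≫= (t j).naturality u
    rw [lanι_desc_assoc, Category.assoc] at h
    dsimp at h ⊢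
    rw [freeι_desc_assoc, freeι_desc_assoc, freeι_desc, Category.assoc, ← h, Category.id_comp]

omit [Abelian C] [AB4OfSize.{0} C] in
theorem lanToFree_desc (σ : I ⥤ J) (E : J ⥤ C) {M : I ⥤ C}
    (t : ∀ j, lanObj ((Functor.const (StructuredArrow j σ)).obj (E.obj j)) ⟶ M) (j : J) :
    lanToFree σ E j ≫ freeRestrDesc σ E t = t j := by
  ext i : 2
  exact lanX_hom_ext fun f => by simp

omit [Abelian C] [AB4OfSize.{0} C] in
theorem freeRestr_hom_ext {σ : I ⥤ J} {E : J ⥤ C} {M : I ⥤ C} {m m' : σ ⋙ freeObj E ⟶ M}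
    (h : ∀ j, lanToFree σ E j ≫ m = lanToFree σ E j ≫ m') : m = m' := by
  ext i : 2
  refine freeX_hom_ext fun j f => ?_
  have h' := lanι ((Functor.const (StructuredArrow j σ)).obj (E.obj j)) f ≫=
    NatTrans.congr_app (h j) i
  dsimp at h'
  rwa [lanι_desc_assoc, lanι_desc_assoc] at h'

/-- The cofan expressing the restriction of `freeObj E` as a coproduct. -/
noncomputable def freeCofan (σ : I ⥤ J) (E : J ⥤ C) :
    Cofan fun j => lanObj ((Functor.const (StructuredArrow j σ)).obj (E.obj j)) :=
  Cofan.mk (σ ⋙ freeObj E) (lanToFree σ E)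

/-- The restriction of `freeObj E` is a coproduct of left Kan extensions. -/
noncomputable def freeCofanIsColimit (σ : I ⥤ J) (E : J ⥤ C) : IsColimit (freeCofan σ E) :=
  Cofan.IsColimit.mk _ (fun s => freeRestrDesc σ E s.inj) (fun s j => lanToFree_desc σ E s.inj j)
    fun s _ hm => freeRestr_hom_ext fun j => (hm j).trans (lanToFree_desc σ E s.inj j).symm

/-- The value at i is a coproduct over all j and all j ⟶ σ i. Grouping by j gives a coproduct of Kan
extensions of constant functors, each of which is acyclic. -/
theorem rowAcyclic_restr_freeObj (h : ∀ j, HomologicallyTrivial (StructuredArrow j σ) C)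
    (E : J ⥤ C) : (freeResolution I C).RowAcyclic colim (σ ⋙ freeObj E) := by
  have : PreservesColimitsOfShape (Discrete J) (freeResolution I C).F :=
    preservesColimitsOfShape_free _
  exact (ResolutionData.RowAcyclic.sigma (freeResolution I C) colim _ fun j =>
    rowAcyclic_lanObj_const (h j) (E.obj j)).of_iso
      ((colimit.isColimit _).coconePointUniqueUpToIso (freeCofanIsColimit σ E))

/-- The analogue of Quillen's Theorem A: a functor whose categories of structured arrows are
homologically trivial induces isomorphisms on homology. -/
theorem isIso_homologyRestr (h : ∀ j, HomologicallyTrivial (StructuredArrow j σ) C)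
    (K : ComplexMinus (J ⥤ C)) : IsIso (homologyRestr σ K) := by
  have : σ.Final := ⟨fun j => (h j).isConnected⟩
  -- The terms of the resolution are coproducts of free objects, so their restrictions are acyclic
  -- and the homology of the restricted resolution is its colimit. Finality then identifies this
  -- with the colimit over J.
  have hT : IsIso (toColim (restrMinus σ (freeT K))) := isIso_toColim _ fun n => by
    have hX {S : Type} (E : S → (J ⥤ C)) : (freeResolution I C).RowAcyclic colim
        ((restr σ C).obj (∐ fun s => freeObj (E s))) := by
      have : PreservesColimitsOfShape (Discrete S) (freeResolution I C).F :=
        preservesColimitsOfShape_free _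
      exact (ResolutionData.RowAcyclic.sigma (freeResolution I C) colim _ fun s =>
        rowAcyclic_restr_freeObj h (E s)).of_iso
          (PreservesCoproduct.iso (restr σ C) fun s => freeObj (E s)).symm
    exact hX _
  have hρ : IsIso ((complexColimRestr C σ).app (freeT K)) :=
    isIso_complexColimRestr_app σ _ fun n => inferInstance
  have hm : IsIso (homologyRestr σ (freeT K)) := by
    have : IsIso (homologyRestr σ (freeT K) ≫ toColim (freeT K)) := by
      rw [homologyRestr_toColim]
      exact IsIso.comp_isIso' hT hρ
    exact IsIso.of_isIso_comp_right _ (toColim (freeT K))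
  exact isIso_homologyRestr_of_T σ K

/-- Theorem A applied to constant coefficients. -/
theorem HomologicallyTrivial.of_structuredArrow (hJ : HomologicallyTrivial J C)
    (h : ∀ j, HomologicallyTrivial (StructuredArrow j σ) C) : HomologicallyTrivial I C :=
  have : σ.Final := ⟨fun j => (h j).isConnected⟩
  have := hJ.isConnected
  have : IsConnected I := (Functor.isConnected_iff_of_final σ).2 inferInstance
  hJ.of_isIso σ fun _ => isIso_homologyRestr h _

end TheoremA

/-! ### Doubling a point in each period -/

namespace ParaMap

variable {k l m n : ℕ}

theorem map_le_map (f : ParaMap m n) {a b : ℤ} (h : a ≤ b) : f.toFun a ≤ f.toFun b := f.mono h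

/-- The pointwise sum. -/
def add (f : ParaMap l m) (g : ParaMap l n) : ParaMap l (m + n) :=
  ⟨fun a => f.toFun a + g.toFun a, f.mono.add g.mono, fun a => by
    rw [f.map_add, g.map_add]; push_cast; ring⟩

/-- The pointwise maximum. -/
def max (f g : ParaMap l m) : ParaMap l m :=
  ⟨fun a => Max.max (f.toFun a) (g.toFun a), f.mono.max g.mono, fun a => by
    rw [f.map_add, g.map_add, max_add_add_right]⟩

/-- The sum with a constant. -/
def addConst (f : ParaMap l m) (c : ℤ) : ParaMap l m :=
  ⟨fun a => f.toFun a + c, f.mono.add_const c, fun a => by rw [f.map_add]; ring⟩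

/-- The rounded up quotient of `a - s` by `n`. -/
def ceil (n : ℕ) (hn : 0 < n) (s : ℤ) : ParaMap n 1 :=
  ⟨fun a => -((s - a) / n), fun a b h => neg_le_neg
    (Int.ediv_le_ediv (by exact_mod_cast hn) (by linarith)), fun a => by
      have h : s - (a + n) = s - a + (-1) * n := by ring
      rw [h, Int.add_mul_ediv_right _ _ (by exact_mod_cast hn.ne')]
      push_cast
      ring⟩

theorem ceil_eq_iff (hn : 0 < n) (s a e : ℤ) :
    (ceil n hn s).toFun a = e ↔ (e - 1) * n < a - s ∧ a - s ≤ e * n := by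
  have hn' : (0 : ℤ) < n := by exact_mod_cast hn
  change -((s - a) / n) = e ↔ _
  rw [neg_eq_iff_eq_neg, Int.ediv_eq_iff_of_pos hn']
  constructor <;> rintro ⟨h₁, h₂⟩ <;> constructor <;> linarith

theorem lt_ceil (hn : 0 < n) (s a : ℤ) : ((ceil n hn s).toFun a - 1) * n < a - s :=
  ((ceil_eq_iff hn s a _).1 rfl).1

theorem le_ceil (hn : 0 < n) (s a : ℤ) : a - s ≤ (ceil n hn s).toFun a * n :=
  ((ceil_eq_iff hn s a _).1 rfl).2

/-- The value of `ceil` at a point of a subdivision. -/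
theorem ceil_succ_add (s a e : ℤ) (h₁ : (e - 1) * m ≤ a - s) (h₂ : a - s ≤ e * m) :
    (ceil (m + 1) m.succ_pos s).toFun (a + e) = e := by
  rw [ceil_eq_iff]
  push_cast
  constructor <;> linarith

/-- The map of degree `p` which is affine in a map of degree `1`. -/
def affine (e : ParaMap n 1) (p : ℕ) (t : ℤ) : ParaMap n p :=
  ⟨fun a => t + (e.toFun a - 1) * p, fun a b h => by
    have := e.mono h
    have hp : (0 : ℤ) ≤ p := by positivity
    dsimp only
    nlinarith, fun a => by rw [e.map_add]; push_cast; ring⟩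

/-- The map which collapses one point in each period. -/
def collapse (m : ℕ) (s : ℤ) : ParaMap (m + 1) m :=
  -- The points s + e * (m + 1) are identified with their successors, which is where the ceiling
  -- jumps.
  ⟨fun a => a - (ceil (m + 1) m.succ_pos s).toFun a, fun a b h => by
    obtain ⟨e, he⟩ : ∃ e, (ceil (m + 1) m.succ_pos s).toFun a = e := ⟨_, rfl⟩
    obtain ⟨e', he'⟩ : ∃ e, (ceil (m + 1) m.succ_pos s).toFun b = e := ⟨_, rfl⟩
    have hee : e ≤ e' := he ▸ he' ▸ (ceil (m + 1) m.succ_pos s).mono h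
    have h₁ := ((ceil_eq_iff m.succ_pos s a e).1 he).2
    have h₂ := ((ceil_eq_iff m.succ_pos s b e').1 he').1
    have hm : (0 : ℤ) ≤ m := by positivity
    push_cast at h₁ h₂
    simp only [he, he']
    obtain rfl | hlt := hee.eq_or_lt
    · linarith
    · have : e * m ≤ (e' - 1) * m := by nlinarith
      linarith, fun a => by rw [map_add]; push_cast; ring⟩

theorem collapse_add_ceil (s a : ℤ) :
    (collapse m s).toFun a + (ceil (m + 1) m.succ_pos s).toFun a = a :=
  sub_add_cancel _ _

/-- A point a of the e-th block lifts to a + e. Consecutive blocks share an end point, and there the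
choice of e selects one of its two copies; hence both inequalities are weak. -/
theorem collapse_add (s a e : ℤ) (h₁ : (e - 1) * m ≤ a - s) (h₂ : a - s ≤ e * m) :
    (collapse m s).toFun (a + e) = a := by
  change a + e - (ceil (m + 1) m.succ_pos s).toFun (a + e) = a
  rw [ceil_succ_add s a e h₁ h₂]
  ring

theorem le_collapse (s a : ℤ) : ((ceil (m + 1) m.succ_pos s).toFun a - 1) * m ≤
    (collapse m s).toFun a - s := by
  have h := lt_ceil m.succ_pos s a
  have h' := collapse_add_ceil (m := m) s a
  push_cast at h
  linarith

theorem collapse_le (s a : ℤ) : (collapse m s).toFun a - s ≤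
    (ceil (m + 1) m.succ_pos s).toFun a * m := by
  have h := le_ceil m.succ_pos s a
  have h' := collapse_add_ceil (m := m) s a
  push_cast at h
  linarith

/-- The extension of a map to subdivisions of its source and target. -/
def extend (g : ParaMap m n) (s : ℤ) : ParaMap (m + 1) (n + 1) :=
  ((collapse m s).comp g).add (ceil (m + 1) m.succ_pos s)

theorem extend_add (g : ParaMap m n) (s a e : ℤ) (h₁ : (e - 1) * m ≤ a - s) (h₂ : a - s ≤ e * m) :
    (g.extend s).toFun (a + e) = g.toFun a + e := by
  change g.toFun ((collapse m s).toFun (a + e)) + (ceil (m + 1) m.succ_pos s).toFun (a + e) = _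
  rw [collapse_add s a e h₁ h₂, ceil_succ_add s a e h₁ h₂]

/-- A map carries the blocks based at s to the blocks based at its value at s. -/
theorem map_bounds (g : ParaMap m n) {s a e : ℤ} (h₁ : (e - 1) * m ≤ a - s)
    (h₂ : a - s ≤ e * m) : (e - 1) * n ≤ g.toFun a - g.toFun s ∧ g.toFun a - g.toFun s ≤ e * n := by
  have h₃ := g.map_le_map (show s + (e - 1) * m ≤ a by linarith)
  have h₄ := g.map_le_map (show a ≤ s + e * m by linarith)
  rw [map_add_mul] at h₃ h₄
  constructor <;> linarith

/-- With `collapse_extend`: a point of the doubled object has the coordinates `collapse` and `ceil`,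
with sum the point itself, and `extend` acts by g on the first and trivially on the second. The
functoriality of doubling and the naturality of the maps out of it rest on this. -/
theorem ceil_extend (g : ParaMap m n) (s a : ℤ) :
    (ceil (n + 1) n.succ_pos (g.toFun s)).toFun ((g.extend s).toFun a) =
      (ceil (m + 1) m.succ_pos s).toFun a := by
  obtain ⟨h₁, h₂⟩ := g.map_bounds (le_collapse s a) (collapse_le s a)
  exact ceil_succ_add _ _ _ h₁ h₂

theorem collapse_extend (g : ParaMap m n) (s a : ℤ) :
    (collapse n (g.toFun s)).toFun ((g.extend s).toFun a) =
      g.toFun ((collapse m s).toFun a) := by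
  obtain ⟨h₁, h₂⟩ := g.map_bounds (le_collapse s a) (collapse_le s a)
  exact collapse_add _ _ _ h₁ h₂

theorem extend_id (s a : ℤ) : ((ParaMap.id m).extend s).toFun a = a :=
  collapse_add_ceil s a

theorem extend_comp (f : ParaMap l m) (g : ParaMap m n) (s a : ℤ) :
    ((f.comp g).extend s).toFun a = (g.extend (f.toFun s)).toFun ((f.extend s).toFun a) := by
  change g.toFun (f.toFun ((collapse l s).toFun a)) + (ceil (l + 1) l.succ_pos s).toFun a =
    g.toFun ((collapse m (f.toFun s)).toFun ((f.extend s).toFun a)) +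
      (ceil (m + 1) m.succ_pos (f.toFun s)).toFun ((f.extend s).toFun a)
  rw [collapse_extend, ceil_extend]

/-- This is where the injectivity of the right leg of a cospan is needed. -/
theorem lo_apply (f : ParaMap m n) (hn : 0 < n) (hf : StrictMono f.toFun) (a : ℤ) :
    f.lo (f.toFun a) = a := by
  refine eq_of_forall_ge_iff fun i => ?_
  rw [f.lo_le_iff hn, hf.le_iff_le]

end ParaMap

/-! ### The categories of marked maps -/

/-- The maps `[m] ⟶ [m']` which send the points of one family to those of another. -/
structure MarkedHom {K : Type} (m m' : ℕ) (x x' : K → ℤ) : Type where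
  /-- The underlying map. -/
  map : ParaMap m m'
  map_point : ∀ k, map.toFun (x k) = x' k

namespace MarkedHom

variable {K : Type} {m m' m'' : ℕ} {x x' x'' : K → ℤ}

theorem ext_apply {f g : MarkedHom m m' x x'} (h : ∀ a, f.map.toFun a = g.map.toFun a) : f = g := by
  obtain ⟨f, hf⟩ := f
  obtain ⟨g, hg⟩ := g
  obtain rfl : f = g := ParaMap.ext (funext h)
  rfl

/-- The identity. -/
def id (m : ℕ) (x : K → ℤ) : MarkedHom m m x x := ⟨ParaMap.id m, fun _ => rfl⟩

/-- The composition. -/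
def comp (f : MarkedHom m m' x x') (g : MarkedHom m' m'' x' x'') : MarkedHom m m'' x x'' :=
  ⟨f.map.comp g.map, fun k => (congrArg g.map.toFun (f.map_point k)).trans (g.map_point k)⟩

end MarkedHom

/-- The maps `[n] ⟶ [m * p]` which send `0` to `0`, for varying `m`. -/
structure PointedUnder (n p : ℕ) : Type where
  /-- The integer `m`. -/
  len : ℕ
  len_pos : 0 < len
  /-- The map. -/
  map : ParaMap n (len * p)
  map_zero : map.toFun 0 = 0

instance (n p : ℕ) : SmallCategory (PointedUnder n p) where
  Hom X Y := MarkedHom X.len Y.len X.map.toFun Y.map.toFun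
  id X := MarkedHom.id _ _
  comp f g := MarkedHom.comp f g

/-- A map from `[n]` and an injective map from `[p]` with the same target, both of which send `0`
to `0`. -/
structure PointedCospan (n p : ℕ) : Type where
  /-- The target `[len]`. -/
  len : ℕ
  len_pos : 0 < len
  /-- The map from `[n]`. -/
  map : ParaMap n len
  /-- The injective map from `[p]`. -/
  inj : ParaMap p len
  strictMono_inj : StrictMono inj.toFun
  map_zero : map.toFun 0 = 0
  inj_zero : inj.toFun 0 = 0

instance (n p : ℕ) : SmallCategory (PointedCospan n p) where
  Hom X Y := MarkedHom X.len Y.len (Sum.elim X.map.toFun X.inj.toFun)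
    (Sum.elim Y.map.toFun Y.inj.toFun)
  id X := MarkedHom.id _ _
  comp f g := MarkedHom.comp f g

/-- The extensions of the subdivision `[p] ⟶ [m * p]` along a map `c` from `[p]`, for varying
`m`. -/
structure SubdivisionExtension {p l : ℕ} (c : ParaMap p l) : Type where
  /-- The integer `m`. -/
  len : ℕ
  len_pos : 0 < len
  /-- The map. -/
  map : ParaMap l (len * p)
  map_apply : ∀ i, map.toFun (c.toFun i) = i * len

instance {p l : ℕ} (c : ParaMap p l) : SmallCategory (SubdivisionExtension c) where
  Hom X Y := MarkedHom X.len Y.len X.map.toFun Y.map.toFun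
  id X := MarkedHom.id _ _
  comp f g := MarkedHom.comp f g

/-! ### Contraction of the extensions of a subdivision -/

namespace SubdivisionExtension

variable {p l : ℕ} {c : ParaMap p l}

/-- Constructor for morphisms. -/
abbrev homMk {X Y : SubdivisionExtension c} (f : ParaMap X.len Y.len)
    (h : ∀ a, f.toFun (X.map.toFun a) = Y.map.toFun a) : X ⟶ Y := ⟨f, h⟩

variable (hl : 0 < l) (hc : StrictMono c.toFun) (hc₀ : c.toFun 0 = 0)

include hc₀ in
theorem hom_zero {X Y : SubdivisionExtension c} (f : X ⟶ Y) :
    f.map.toFun 0 = 0 := by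
  have h := f.map_point (c.toFun 0)
  rw [hc₀] at h
  have hX := X.map_apply 0
  have hY := Y.map_apply 0
  rw [hc₀] at hX hY
  rw [hX, hY] at h
  simpa using h

include hl in
-- The point a lies in the block from c (lo a - 1) to c (lo a), whose ends go to consecutive
-- multiples of the length. The bounds are written with base point 0 to fit `ParaMap.collapse_add`.
theorem le_map_apply (X : SubdivisionExtension c) (a : ℤ) :
    (c.lo a - 1) * X.len ≤ X.map.toFun a - 0 := by
  have h : c.toFun (c.lo a - 1) ≤ a := by
    have := (c.lo_le_iff hl (c.lo a - 1) a).not.1 (by omega)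
    omega
  have h' := X.map.map_le_map h
  rw [X.map_apply] at h'
  linarith

include hl in
theorem map_apply_le (X : SubdivisionExtension c) (a : ℤ) :
    X.map.toFun a - 0 ≤ c.lo a * X.len := by
  have h' := X.map.map_le_map ((c.lo_le_iff hl _ a).1 le_rfl)
  rw [X.map_apply] at h'
  linarith

/-- The functor which inserts a point at `0`. -/
noncomputable abbrev insertPoint : SubdivisionExtension c ⥤ SubdivisionExtension c where
  obj X :=
    { len := X.len + 1
      len_pos := X.len.succ_pos
      -- Each multiple of the length is doubled. Points c i, which end a block, go to the first
      -- copy; points of the next block with the same image go to the second.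
      map := ⟨fun a => X.map.toFun a + c.lo a, X.map.mono.add fun _ _ h => c.lo_mono hl h,
        fun a => by
          have h : c.lo (a + l) = c.lo a + p := by simpa using c.lo_add_mul hl a 1
          rw [h, X.map.map_add]
          push_cast
          ring⟩
      map_apply := fun i => by
        change X.map.toFun _ + c.lo _ = _
        rw [X.map_apply, c.lo_apply hl hc]
        push_cast
        ring }
  map {X Y} f := homMk (f.map.extend 0) fun a =>
    (f.map.extend_add 0 _ _ (le_map_apply hl X a) (map_apply_le hl X a)).trans
      (congrArg (· + c.lo a) (f.map_point a))
  map_id X := MarkedHom.ext_apply fun a => ParaMap.extend_id 0 a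
  map_comp {X Y Z} f g := MarkedHom.ext_apply fun a => by
    have h := ParaMap.extend_comp f.map g.map 0 a
    rw [hom_zero hc₀ f] at h
    exact h

/-- The terminal subdivision. -/
noncomputable abbrev unit : SubdivisionExtension c where
  len := 1
  len_pos := one_pos
  map := ⟨c.lo, fun _ _ h => c.lo_mono hl h, fun a => by simpa using c.lo_add_mul hl a 1⟩
  map_apply i := by
    change c.lo _ = _
    rw [c.lo_apply hl hc]
    simp

/-- The map which forgets the inserted point. -/
noncomputable def insertPointToId : insertPoint hl hc hc₀ ⟶ 𝟭 _ where
  app X := homMk (X := (insertPoint hl hc hc₀).obj X) (ParaMap.collapse X.len 0) fun a =>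
    ParaMap.collapse_add 0 _ _ (le_map_apply hl X a) (map_apply_le hl X a)
  naturality X Y f := MarkedHom.ext_apply fun a => by
    have h := ParaMap.collapse_extend f.map 0 a
    rw [hom_zero hc₀ f] at h
    exact h

/-- The map which only keeps the inserted point. -/
noncomputable def insertPointToUnit :
    insertPoint hl hc hc₀ ⟶ (Functor.const _).obj (unit hl hc) where
  app X := homMk (X := (insertPoint hl hc hc₀).obj X) (Y := unit hl hc)
    (ParaMap.ceil (X.len + 1) X.len.succ_pos 0) fun a =>
      ParaMap.ceil_succ_add _ _ _ (le_map_apply hl X a) (map_apply_le hl X a)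
  naturality X Y f := MarkedHom.ext_apply fun a => by
    have h := ParaMap.ceil_extend f.map 0 a
    rw [hom_zero hc₀ f] at h
    exact h

include hl hc hc₀ in
-- The doubled object maps naturally to X, by merging the two copies, and to the extension of length
-- 1, by remembering only the block.
theorem homologicallyTrivial (C : Type u) [Category.{v} C] [Abelian C] [HasCoproducts.{0} C]
    [AB4OfSize.{0} C] : HomologicallyTrivial (SubdivisionExtension c) C :=
  homologicallyTrivial_of_zigzag (unit hl hc)
    ((Zigzag.of_inv (insertPointToId hl hc hc₀)).trans
      (Zigzag.of_hom (insertPointToUnit hl hc hc₀)))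

end SubdivisionExtension

/-! ### Contraction of the pointed cospans -/

namespace PointedCospan

variable {n p : ℕ}

/-- Constructor for morphisms. -/
abbrev homMk {X Y : PointedCospan n p} (f : ParaMap X.len Y.len)
    (h : ∀ a, f.toFun (X.map.toFun a) = Y.map.toFun a)
    (h' : ∀ a, f.toFun (X.inj.toFun a) = Y.inj.toFun a) : X ⟶ Y :=
  ⟨f, Sum.rec h h'⟩

theorem hom_map {X Y : PointedCospan n p} (f : X ⟶ Y) (a : ℤ) :
    f.map.toFun (X.map.toFun a) = Y.map.toFun a := f.map_point (Sum.inl a)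

theorem hom_inj {X Y : PointedCospan n p} (f : X ⟶ Y) (a : ℤ) :
    f.map.toFun (X.inj.toFun a) = Y.inj.toFun a := f.map_point (Sum.inr a)

variable (hn : 0 < n)

theorem ceil_zero : (ParaMap.ceil n hn 0).toFun 0 = 0 := by
  rw [ParaMap.ceil_eq_iff]
  have : (0 : ℤ) < n := by exact_mod_cast hn
  constructor <;> linarith

theorem le_map (X : PointedCospan n p) (a : ℤ) :
    ((ParaMap.ceil n hn 0).toFun a - 1) * X.len ≤ X.map.toFun a := by
  have h := X.map.map_le_map
    (show 0 + ((ParaMap.ceil n hn 0).toFun a - 1) * n ≤ a by linarith [ParaMap.lt_ceil hn 0 a])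
  rw [ParaMap.map_add_mul, X.map_zero] at h
  linarith

theorem map_le (X : PointedCospan n p) (a : ℤ) :
    X.map.toFun a ≤ (ParaMap.ceil n hn 0).toFun a * X.len := by
  have h := X.map.map_le_map
    (show a ≤ 0 + (ParaMap.ceil n hn 0).toFun a * n by linarith [ParaMap.le_ceil hn 0 a])
  rw [ParaMap.map_add_mul, X.map_zero] at h
  linarith

/-- The maximum of the map from `[n]` with a map which factors through `[p]`. -/
def maxMap (X : PointedCospan n p) (t : ℤ) : ParaMap n X.len :=
  -- For 0 < a ≤ n the second map has the constant value `X.inj.toFun t`. As t runs from 0 to p, the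
  -- maximum thus goes from `X.map` to the map with constant value `X.len` there.
  X.map.max (((ParaMap.ceil n hn 0).affine p t).comp X.inj)

theorem inj_affine (X : PointedCospan n p) (t e : ℤ) :
    X.inj.toFun (t + (e - 1) * p) = X.inj.toFun t + (e - 1) * X.len :=
  X.inj.map_add_mul _ _

theorem maxMap_apply (X : PointedCospan n p) (t a : ℤ) : (X.maxMap hn t).toFun a =
    max (X.map.toFun a) (X.inj.toFun (t + ((ParaMap.ceil n hn 0).toFun a - 1) * p)) := rfl

theorem hom_maxMap {X Y : PointedCospan n p} (f : X ⟶ Y) (t a : ℤ) :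
    f.map.toFun ((X.maxMap hn t).toFun a) = (Y.maxMap hn t).toFun a := by
  rw [maxMap_apply, maxMap_apply, f.map.mono.map_max, hom_map, hom_inj]

theorem maxMap_zero (X : PointedCospan n p) {t : ℤ} (ht : t ≤ p) :
    (X.maxMap hn t).toFun 0 = 0 := by
  have h := X.inj.map_le_map (show t + (0 - 1) * p ≤ 0 by linarith)
  rw [X.inj_zero] at h
  rw [maxMap_apply, ceil_zero, X.map_zero, max_eq_left h]

theorem le_maxMap (X : PointedCospan n p) (t a : ℤ) :
    ((ParaMap.ceil n hn 0).toFun a - 1) * X.len ≤ (X.maxMap hn t).toFun a - X.inj.toFun t := by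
  have h := le_max_right (X.map.toFun a)
    (X.inj.toFun (t + ((ParaMap.ceil n hn 0).toFun a - 1) * p))
  rw [inj_affine] at h
  rw [maxMap_apply, inj_affine]
  linarith

theorem maxMap_le (X : PointedCospan n p) {t : ℤ} (ht : 0 ≤ t) (a : ℤ) :
    (X.maxMap hn t).toFun a - X.inj.toFun t ≤ (ParaMap.ceil n hn 0).toFun a * X.len := by
  have h := X.map_le hn a
  have h' := X.inj.map_le_map ht
  rw [X.inj_zero] at h'
  rw [maxMap_apply, inj_affine, sub_le_iff_le_add]
  have : (0 : ℤ) ≤ X.len := by positivity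
  refine max_le (by linarith) (by linarith)

variable (hp : 0 < p)

theorem le_inj (X : PointedCospan n p) (t a : ℤ) :
    ((ParaMap.ceil p hp t).toFun a - 1) * X.len ≤ X.inj.toFun a - X.inj.toFun t :=
  (X.inj.map_bounds (ParaMap.lt_ceil hp t a).le (ParaMap.le_ceil hp t a)).1

theorem inj_le (X : PointedCospan n p) (t a : ℤ) :
    X.inj.toFun a - X.inj.toFun t ≤ (ParaMap.ceil p hp t).toFun a * X.len :=
  (X.inj.map_bounds (ParaMap.lt_ceil hp t a).le (ParaMap.le_ceil hp t a)).2

/-- The functor which replaces the map from `[n]` by its maximum with a map through `[p]`. -/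
abbrev raise {t : ℤ} (ht : t ≤ p) : PointedCospan n p ⥤ PointedCospan n p where
  obj X := { X with map := X.maxMap hn t, map_zero := X.maxMap_zero hn ht }
  map {X Y} f := homMk f.map (hom_maxMap hn f t) (hom_inj f)

/-- The functor which inserts a point at the image of `t`. -/
abbrev insertPoint {t : ℤ} (ht : 0 ≤ t) (ht' : t < p) : PointedCospan n p ⥤ PointedCospan n p where
  obj X :=
    { len := X.len + 1
      len_pos := X.len.succ_pos
      -- The image of t is doubled. The leg from [p] sends t to the first copy, while points a with
      -- 0 < a ≤ n, all sent to this image or beyond, land at the second copy or after it.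
      map := (X.maxMap hn t).add (ParaMap.ceil n hn 0)
      inj := X.inj.add (ParaMap.ceil p hp t)
      strictMono_inj := X.strictMono_inj.add_monotone (ParaMap.ceil p hp t).mono
      map_zero := by
        change (X.maxMap hn t).toFun 0 + (ParaMap.ceil n hn 0).toFun 0 = 0
        rw [ceil_zero, maxMap_zero hn X ht'.le, add_zero]
      inj_zero := by
        change X.inj.toFun 0 + (ParaMap.ceil p hp t).toFun 0 = 0
        rw [X.inj_zero, (ParaMap.ceil_eq_iff hp t 0 0).2 ⟨by linarith, by linarith⟩, add_zero] }
  map {X Y} f := homMk (f.map.extend (X.inj.toFun t))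
    (fun a => (f.map.extend_add _ _ _ (X.le_maxMap hn t a) (X.maxMap_le hn ht a)).trans
      (congrArg (· + (ParaMap.ceil n hn 0).toFun a) (hom_maxMap hn f t a)))
    (fun a => (f.map.extend_add _ _ _ (X.le_inj hp t a) (X.inj_le hp t a)).trans
      (congrArg (· + (ParaMap.ceil p hp t).toFun a) (hom_inj f a)))
  map_id X := MarkedHom.ext_apply fun a => ParaMap.extend_id _ a
  map_comp {X Y Z} f g := MarkedHom.ext_apply fun a => by
    have h := ParaMap.extend_comp f.map g.map (X.inj.toFun t) a
    rw [hom_inj f] at h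
    exact h

/-- The map which forgets the inserted point. -/
def insertPointToRaise {t : ℤ} (ht : 0 ≤ t) (ht' : t < p) :
    insertPoint hn hp ht ht' ⟶ raise hn ht'.le where
  app X := homMk (X := (insertPoint hn hp ht ht').obj X) (Y := (raise hn ht'.le).obj X)
    (ParaMap.collapse X.len (X.inj.toFun t))
    (fun a => ParaMap.collapse_add _ _ _ (X.le_maxMap hn t a) (X.maxMap_le hn ht a))
    (fun a => ParaMap.collapse_add _ _ _ (X.le_inj hp t a) (X.inj_le hp t a))
  naturality X Y f := MarkedHom.ext_apply fun a => by
    have h := ParaMap.collapse_extend f.map (X.inj.toFun t) a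
    rw [hom_inj f] at h
    exact h

/-- The map which merges the inserted point with the image of `t + 1`. -/
def insertPointToRaiseSucc {t : ℤ} (ht : 0 ≤ t) (ht' : t < p) :
    insertPoint hn hp ht ht' ⟶ raise hn (Int.add_one_le_of_lt ht') where
  app X := homMk (X := (insertPoint hn hp ht ht').obj X)
    (Y := (raise hn (Int.add_one_le_of_lt ht')).obj X)
    -- Without doubling, taking the maximum with the image of t + 1 would also move the image of t,
    -- which a morphism has to preserve. Now only the second copy and what follows it are raised.
    ((ParaMap.collapse X.len (X.inj.toFun t)).max
      (((ParaMap.ceil (X.len + 1) X.len.succ_pos (X.inj.toFun t)).affine p (t + 1)).comp X.inj))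
    (fun a => by
      have h₁ := X.le_maxMap hn t a
      have h₂ := X.maxMap_le hn ht a
      change max ((ParaMap.collapse X.len _).toFun ((X.maxMap hn t).toFun a + _))
        (X.inj.toFun (t + 1 + ((ParaMap.ceil (X.len + 1) _ _).toFun
          ((X.maxMap hn t).toFun a + _) - 1) * p)) = (X.maxMap hn (t + 1)).toFun a
      rw [ParaMap.collapse_add _ _ _ h₁ h₂, ParaMap.ceil_succ_add _ _ _ h₁ h₂, maxMap_apply,
        maxMap_apply, max_assoc, max_eq_right (a := X.inj.toFun _)]
      exact X.inj.map_le_map (by linarith))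
    (fun a => by
      have h₁ := X.le_inj hp t a
      have h₂ := X.inj_le hp t a
      change max ((ParaMap.collapse X.len _).toFun (X.inj.toFun a + _))
        (X.inj.toFun (t + 1 + ((ParaMap.ceil (X.len + 1) _ _).toFun
          (X.inj.toFun a + _) - 1) * p)) = X.inj.toFun a
      rw [ParaMap.collapse_add _ _ _ h₁ h₂, ParaMap.ceil_succ_add _ _ _ h₁ h₂]
      refine max_eq_left (X.inj.map_le_map ?_)
      -- With e the ceiling, the strict bound (e - 1) * p < a - t leaves room for the extra 1: t + 1
      -- + (e - 1) * p ≤ a, so the points of the leg from [p] are not raised.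
      have := ParaMap.lt_ceil hp t a
      linarith [Int.add_one_le_of_lt this])
  naturality X Y f := MarkedHom.ext_apply fun a => by
    have h := ParaMap.collapse_extend f.map (X.inj.toFun t) a
    have h' := ParaMap.ceil_extend f.map (X.inj.toFun t) a
    rw [hom_inj f] at h h'
    change max ((ParaMap.collapse _ _).toFun _) (Y.inj.toFun (t + 1 +
      ((ParaMap.ceil _ _ (Y.inj.toFun t)).toFun ((f.map.extend _).toFun a) - 1) * p)) =
        f.map.toFun (max _ (X.inj.toFun _))
    rw [h, h', f.map.mono.map_max, hom_inj]
    rfl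

/-- The map to the first raised functor. -/
def toRaiseZero : 𝟭 (PointedCospan n p) ⟶ raise hn (Int.natCast_nonneg p) where
  app X := homMk (Y := (raise hn (Int.natCast_nonneg p)).obj X) (ParaMap.id _)
    (fun a => (max_eq_left (by
      have h := X.le_map hn a
      have h' := X.inj_affine 0 ((ParaMap.ceil n hn 0).toFun a)
      rw [X.inj_zero] at h'
      change X.inj.toFun (0 + ((ParaMap.ceil n hn 0).toFun a - 1) * p) ≤ X.map.toFun a
      rw [h']
      linarith)).symm) fun a => rfl

/-- The universal cospan. -/
abbrev unit : PointedCospan n p where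
  len := p
  len_pos := hp
  map := (ParaMap.ceil n hn 0).affine p p
  inj := ParaMap.id p
  strictMono_inj := strictMono_id
  map_zero := by
    change p + ((ParaMap.ceil n hn 0).toFun 0 - 1) * p = (0 : ℤ)
    rw [ceil_zero]
    ring
  inj_zero := rfl

/-- The map to the last raised functor. -/
def unitToRaise : (Functor.const (PointedCospan n p)).obj (unit hn hp) ⟶
    raise hn (le_refl (p : ℤ)) where
  app X := homMk (X := unit hn hp) (Y := (raise hn (le_refl (p : ℤ))).obj X) X.inj
    (fun a => (max_eq_right (by
      have h := X.map_le hn a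
      have h' := X.inj.map_add_mul ((ParaMap.ceil n hn 0).toFun a) 0
      rw [X.inj_zero] at h'
      have e : (p : ℤ) + ((ParaMap.ceil n hn 0).toFun a - 1) * p =
        0 + (ParaMap.ceil n hn 0).toFun a * p := by ring
      change _ ≤ X.inj.toFun (p + ((ParaMap.ceil n hn 0).toFun a - 1) * p)
      rw [e, h']
      linarith)).symm) fun a => rfl
  naturality X Y f := MarkedHom.ext_apply fun a => (hom_inj f a).symm

include hp in
-- Raising by t and by t + 1 are both targets of the functor that doubles the image of t.
theorem zigzag_raise (t : ℕ) (ht : (t : ℤ) ≤ p) :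
    Zigzag (𝟭 (PointedCospan n p)) (raise hn ht) := by
  induction t with
  | zero => exact Zigzag.of_hom (toRaiseZero hn)
  | succ t ih =>
    have h : (t : ℤ) < p := by push_cast at ht; linarith
    exact (ih h.le).trans ((Zigzag.of_inv (insertPointToRaise hn hp t.cast_nonneg h)).trans
      (Zigzag.of_hom (insertPointToRaiseSucc hn hp t.cast_nonneg h)))

include hn hp in
-- After raising by t = p, the leg from [n] takes only multiples of the length as values, so it
-- factors through the leg from [p]. The leg from [p] then is a natural map from the fixed cospan
-- `unit`.
theorem homologicallyTrivial (C : Type u) [Category.{v} C] [Abelian C] [HasCoproducts.{0} C]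
    [AB4OfSize.{0} C] : HomologicallyTrivial (PointedCospan n p) C :=
  homologicallyTrivial_of_zigzag (unit hn hp)
    ((zigzag_raise hn hp p le_rfl).trans (Zigzag.of_inv (unitToRaise hn hp)))

end PointedCospan

/-! ### The comma categories of the embedding -/

namespace PointedUnder

variable {n p : ℕ}

/-- The subdivision `[p] ⟶ [m * p]`. -/
def multiples (m p : ℕ) (hm : 0 < m) : ParaMap p (m * p) :=
  ⟨fun i => i * m, fun _ _ h => by
      have : (0 : ℤ) < m := by exact_mod_cast hm
      dsimp only
      nlinarith, fun i => by push_cast; ring⟩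

theorem hom_mul {X Y : PointedUnder n p} (f : X ⟶ Y) (i : ℤ) :
    f.map.toFun (i * X.len) = i * Y.len := by
  have h := f.map_point 0
  have h' := f.map.map_add_mul i 0
  rw [X.map_zero, Y.map_zero] at h
  rwa [h, zero_add, zero_add] at h'

variable (n) in
/-- The functor which adds the subdivision `[p] ⟶ [m * p]` to a map `[n] ⟶ [m * p]`. -/
abbrev toCospan (hp : 0 < p) : PointedUnder n p ⥤ PointedCospan n p where
  obj X :=
    { len := X.len * p
      len_pos := Nat.mul_pos X.len_pos hp
      map := X.map
      inj := multiples X.len p X.len_pos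
      strictMono_inj := fun _ _ h => Int.mul_lt_mul_of_pos_right h (by exact_mod_cast X.len_pos)
      map_zero := X.map_zero
      inj_zero := zero_mul _ }
  map {X Y} f := PointedCospan.homMk (f.map.subdivide p) f.map_point (hom_mul f)

/-- The extensions of subdivisions along an injective map as a comma category. -/
abbrev ofExtension (hp : 0 < p) (w : PointedCospan n p) :
    SubdivisionExtension w.inj ⥤ StructuredArrow w (toCospan n hp) where
  obj X := StructuredArrow.mk
    (Y := ({ len := X.len
             len_pos := X.len_pos
             map := w.map.comp X.map
             map_zero := by
               change X.map.toFun (w.map.toFun 0) = 0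
               have h := X.map_apply 0
               rw [w.inj_zero, zero_mul] at h
               rw [w.map_zero, h] } : PointedUnder n p))
    (PointedCospan.homMk (Y := (toCospan n hp).obj _) X.map (fun _ => rfl) X.map_apply)
  map {X Y} f := StructuredArrow.homMk ⟨f.map, fun a => f.map_point (w.map.toFun a)⟩
    (MarkedHom.ext_apply fun a => f.map_point a)

/-- A morphism from w to the cospan of an object of `PointedUnder n p` is a map compatible with both
legs. Compatibility with the leg from [p] is the condition in `SubdivisionExtension`; compatibility
with the other leg recovers the map from [n] as a composite. -/
instance (hp : 0 < p) (w : PointedCospan n p) : (ofExtension hp w).IsEquivalence where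
  faithful :=
    { map_injective := fun {X Y f g} h => MarkedHom.ext_apply fun a => by
        have h' := congrArg (fun k => k.right.map.toFun a) h
        exact h' }
  full :=
    { map_surjective := fun {X Y} f => by
        refine ⟨⟨f.right.map, fun a => ?_⟩, rfl⟩
        have h := congrArg (fun k => k.map.toFun a) (StructuredArrow.w f)
        exact h }
  essSurj :=
    { mem_essImage := fun A => by
        let X : SubdivisionExtension w.inj :=
          { len := A.right.len
            len_pos := A.right.len_pos
            map := A.hom.map
            map_apply := PointedCospan.hom_inj A.hom }
        refine ⟨X, ⟨StructuredArrow.isoMk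
          { hom := ⟨ParaMap.id _, fun a => PointedCospan.hom_map A.hom a⟩
            inv := ⟨ParaMap.id _, fun a => (PointedCospan.hom_map A.hom a).symm⟩
            hom_inv_id := rfl
            inv_hom_id := rfl } rfl⟩⟩ }

/-- Theorem A for `toCospan`: its target and its comma categories have both been contracted. -/
theorem homologicallyTrivial (hn : 0 < n) (hp : 0 < p) (C : Type u) [Category.{v} C] [Abelian C]
    [HasCoproducts.{0} C] [AB4OfSize.{0} C] : HomologicallyTrivial (PointedUnder n p) C :=
  (PointedCospan.homologicallyTrivial hn hp C).of_structuredArrow (σ := toCospan n hp) fun w =>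
    (SubdivisionExtension.homologicallyTrivial w.len_pos w.strictMono_inj
      w.inj_zero C).of_equivalence (ofExtension hp w).asEquivalence.symm

/-- The comma categories of the embedding of the paracyclic category. -/
abbrev toStructuredArrow (hp : 0 < p) (X : CyclicCat) :
    PointedUnder X.len p ⥤ StructuredArrow X (cyclicEmbedding p hp) where
  obj Y := StructuredArrow.mk (Y := (⟨Y.len, Y.len_pos⟩ : Paracyclic p))
    (Quotient.mk (ParaMap.rel 1 X.len (Y.len * p)) Y.map)
  map {Y Z} f := StructuredArrow.homMk (Quotient.mk (ParaMap.rel p Y.len Z.len) f.map)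
    (congrArg (Quotient.mk (ParaMap.rel 1 X.len (Z.len * p))) (ParaMap.ext (funext f.map_point)))
  map_id _ := rfl
  map_comp _ _ := rfl

theorem hom_zero {X Y : PointedUnder n p} (f : X ⟶ Y) : f.map.toFun 0 = 0 := by
  simpa using hom_mul f 0

/-- Translations are isomorphisms in the paracyclic category, so a map from [n] can be normalized to
send 0 to 0. A morphism of normalized objects then has exactly one representative for which the
triangle commutes in Λ_∞. -/
instance (hp : 0 < p) (X : CyclicCat) : (toStructuredArrow hp X).IsEquivalence where
  faithful :=
    { map_injective := fun {Y Z f g} h => MarkedHom.ext_apply fun a => by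
        have h' := congrArg (fun k => k.right) h
        obtain ⟨k, hk⟩ := Quotient.exact (s := ParaMap.rel p Y.len Z.len) h'
        -- Both representatives fix 0, so the translation by which they differ is zero.
        have h₀ := hk 0
        have h₁ := hk a
        have e₀ := f.map.map_add_mul (k * p) 0
        have e₁ := f.map.map_add_mul (k * p) a
        rw [hom_zero] at e₀
        rw [hom_zero, ← mul_assoc, e₀] at h₀
        rw [← mul_assoc, e₁] at h₁
        linarith }
  full :=
    { map_surjective := fun {Y Z} f => by
        obtain ⟨g, hg⟩ := Quotient.exists_rep (s := ParaMap.rel p Y.len Z.len) f.right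
        have hw := StructuredArrow.w f
        rw [← hg] at hw
        obtain ⟨k, hk⟩ := Quotient.exact (s := ParaMap.rel 1 X.len (Z.len * p)) hw
        have hk' (a : ℤ) : Z.map.toFun a = g.toFun (Y.map.toFun a) + k * p * Z.len := by
          have h₁ : Z.map.toFun a = g.toFun (Y.map.toFun (a + k * ((1 : ℕ) * X.len))) := hk a
          have h₂ := Y.map.map_add_mul k a
          have h₃ := g.map_add_mul (k * p) (Y.map.toFun a)
          rw [h₁, Nat.cast_one, one_mul, h₂, ← h₃]
          congr 1
          push_cast
          ring
        -- The triangle commutes up to the k * p-th power of σ on the target. Absorbing this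
        -- translation into g does not change its class modulo σ ^ p.
        refine ⟨⟨g.addConst (k * p * Z.len), fun a => (hk' a).symm⟩, ?_⟩
        refine StructuredArrow.hom_ext _ _ (Eq.trans ?_ hg)
        refine (Quotient.sound (s := ParaMap.rel p Y.len Z.len) ⟨k, fun a => ?_⟩).symm
        have h := g.map_add_mul (k * p) a
        rw [mul_assoc k p (Y.len : ℤ)] at h
        exact h.symm }
  essSurj :=
    { mem_essImage := fun A => by
        obtain ⟨f, hf⟩ := Quotient.exists_rep (s := ParaMap.rel 1 X.len (A.right.len * p)) A.hom
        let Y : PointedUnder X.len p :=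
          { len := A.right.len
            len_pos := A.right.len_pos
            map := f.addConst (-f.toFun 0)
            map_zero := add_neg_cancel _ }
        let e : (⟨Y.len, Y.len_pos⟩ : Paracyclic p) ≅ A.right :=
          { hom := Quotient.mk (ParaMap.rel p _ _) ((ParaMap.id Y.len).addConst (f.toFun 0))
            inv := Quotient.mk (ParaMap.rel p _ _) ((ParaMap.id Y.len).addConst (-f.toFun 0))
            hom_inv_id := congrArg (Quotient.mk (ParaMap.rel p _ _))
              (ParaMap.ext (funext fun a => add_neg_cancel_right a _))
            inv_hom_id := congrArg (Quotient.mk (ParaMap.rel p _ _))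
              (ParaMap.ext (funext fun a => neg_add_cancel_right a _)) }
        refine ⟨Y, ⟨StructuredArrow.isoMk e (Eq.trans ?_ hf)⟩⟩
        exact congrArg (Quotient.mk (ParaMap.rel 1 _ _))
          (ParaMap.ext (funext fun a => neg_add_cancel_right (f.toFun a) _)) }

end PointedUnder

theorem homologicallyTrivial_structuredArrow_cyclicEmbedding {p : ℕ} (hp : 0 < p) (X : CyclicCat)
    (C : Type u) [Category.{v} C] [Abelian C] [HasCoproducts.{0} C] [AB4OfSize.{0} C] :
    HomologicallyTrivial (StructuredArrow X (cyclicEmbedding p hp)) C :=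
  (PointedUnder.homologicallyTrivial X.len_pos hp C).of_equivalence
    (PointedUnder.toStructuredArrow hp X).asEquivalence.symm

theorem exists_isIso_homologyMap_cyclicEmbedding {p : ℕ} (hp : 0 < p) (C : Type u)
    [Category.{v} C] [Abelian C] [HasCoproducts.{0} C] [AB4OfSize.{0} C] (E : CyclicCat ⥤ C) :
    ∃ (_ : HasHomology (Paracyclic p) C) (_ : HasHomology CyclicCat C),
      IsIso ((homologyMap C (cyclicEmbedding p hp)).app ((DMinus.single (CyclicCat ⥤ C)).obj E)) :=
  ⟨hasHomology _ _, hasHomology _ _, (isIso_homologyMap_app_iff _ _).2 (isIso_homologyRestr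
    (fun X => homologicallyTrivial_structuredArrow_cyclicEmbedding hp X C)
    ((ComplexMinus.single (CyclicCat ⥤ C)).obj E))⟩

/-- The abelian category `C` is only assumed to have exact small coproducts (AB3 and AB4); this
covers every Grothendieck abelian category. -/
theorem proposition1p6 (p : ℕ) (hp : 0 < p) :
    (∀ (C : Type u) [Category.{v} C] [Abelian C] [HasCoproducts.{0} C] [AB4OfSize.{0} C]
      (E : CyclicCat ⥤ C),
      ∃ (_ : HasHomology (Paracyclic p) C) (_ : HasHomology CyclicCat C),
        IsIso ((homologyMap C (cyclicEmbedding p hp)).app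
          ((DMinus.single (CyclicCat ⥤ C)).obj E))) ∧
    (∀ (k : Type w) [CommRing k] (A : Type w) [Ring A] [Algebra k A],
      (∀ X : Paracyclic p, (cyclicEmbedding p hp ⋙ cyclicModule k A).obj X =
        ModuleCat.of k (PiTensorProduct k fun _ : Fin (X.len * p) => A)) ∧
      ∃ (_ : HasHomology (Paracyclic p) (ModuleCat.{w} k))
        (_ : HasHomology CyclicCat (ModuleCat.{w} k)),
        IsIso ((homologyMap (ModuleCat.{w} k) (cyclicEmbedding p hp)).app
          ((DMinus.single (CyclicCat ⥤ ModuleCat.{w} k)).obj (cyclicModule k A)))) :=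
  ⟨fun C _ _ _ _ E => exists_isIso_homologyMap_cyclicEmbedding hp C E,
    fun k _ A _ _ => ⟨fun _ => rfl,
      exists_isIso_homologyMap_cyclicEmbedding hp (ModuleCat.{w} k) (cyclicModule k A)⟩⟩
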